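/- Let $k$ be a $\mathfrak p$-adic field (a non-archimedean local field of characteristic $0$) with ring of integers $\mathfrak o$, prime element $\pi$, residue field of odd cardinality $q$, and absolute value normalized by $|\pi|=q^{-1}$. Let $D$ be the division quaternion algebra over $k$, written as $D=k\oplus k\varepsilon\oplus k\Pi\oplus k\Pi\varepsilon$ with $\varepsilon^2\in\mathfrak o^\times$ not a square, $\Pi^2=\pi$, $\Pi\varepsilon=-\varepsilon\Pi$; let $*$ be its canonical involution ($1\mapsto 1$, and $\varepsilon,\Pi,\Pi\varepsilon$ change sign), $\mathcal O=\mathfrak o\oplus\mathfrak o\varepsilon\oplus\mathfrak o\Pi\oplus\mathfrak o\Pi\varepsilon$ its maximal order and $\mathcal P=\Pi\mathcal O$ its maximal ideal. For a matrix $A=(a_{ij})$ over $D$ put $A^*=(a_{ji}^*)$, and let $\mathrm{N_{rd}}$ denote the reduced norm on $M_r(D)$. Let $X_n=\{A\in GL_n(D): A^*=A\}$ and $K_n=GL_n(\mathcal O)$, which acts on $X_n$ by $g\cdot x=gxg^*$. For $y\in X_n$ let $y^{(i)}$ be its upper left $i\times i$ block and define $d_i(y)\in k$, up to sign, by $d_i(y)^2=\mathrm{N_{rd}}(y^{(i)})$.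 For $s\in\mathbb C^n$ the spherical function is $$\omega(x;s)=\int_{K_n}|\mathbf d(g\cdot x)|^s\,dg,\qquad |\mathbf d(y)|^s=\begin{cases}\prod_{i=1}^n|d_i(y)|^{s_i}&\text{if all } d_i(y)\neq 0,\\ 0&\text{otherwise,}\end{cases}$$ with $dg$ the normalized Haar measure on $K_n$. Let $\Lambda_n^+$ be the set of sequences $\alpha_1\ge\dots\ge\alpha_n\ge 0$ of integers in which every odd number occurs an even number of times. For $\alpha\in\Lambda_n^+$ let $\pi^\alpha\in X_n\cap M_n(\mathcal O)$ be the block diagonal matrix, with blocks in the order of the sequence $\alpha$, in which every even term $2e$ of $\alpha$ contributes the $1\times 1$ block $\pi^e$ and every pair of equal consecutive odd terms $2e+1,2e+1$ contributes the block $\begin{pmatrix}0&\pi^e\Pi\\-\pi^e\Pi&0\end{pmatrix}$. For $m\ge n$, $A\in X_m\cap M_m(\mathcal O)$ and $B\in X_n\cap M_n(\mathcal O)$ let $N_\ell(B,A)$ be the number of classes in $M_{mn}(\mathcal O)/M_{mn}(\mathcal P^{2\ell})$ of matrices $u\in M_{mn}(\mathcal O)$ ($m$ rows and $n$ columns) with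 $u^*Au-B\in M_n(\mathcal P^{2\ell-1})$, and let $N^{pr}_\ell(B,A)$ be the number of those classes for which in addition $u$ is primitive, that is, $u$ consists of the first $n$ columns of an element of $GL_m(\mathcal O)$. The local density and the primitive local density are $$\mu(B,A)=\lim_{\ell\to\infty}\frac{N_\ell(B,A)}{q^{\ell n(4m-2n+1)+n(n-1)}},\qquad \mu^{pr}(B,A)=\lim_{\ell\to\infty}\frac{N^{pr}_\ell(B,A)}{q^{\ell n(4m-2n+1)+n(n-1)}}.$$ Put $w_r(t)=\prod_{i=1}^r(1-t^i)$. **Theorem.** Let $m>n$ and let $s=(s_1,\dots,s_n)\in\mathbb C^n$ with $\mathrm{Re}(s_i)\ge 0$ for $1\le i\le n$. Then for every $\xi\in\Lambda_m^+$ $$\omega(\pi^\xi;s_1,\dots,s_n,0,\dots,0)=\frac{w_n(q^{-2})\,w_{m-n}(q^{-2})}{w_m(q^{-2})}\sum_{\alpha\in\Lambda_n^+}\frac{\mu^{pr}(\pi^\alpha,\pi^\xi)}{\mu(\pi^\alpha,\pi^\alpha)}\,\omega(\pi^\alpha;s)$$ $$=\frac{w_n(q^{-2})\,w_{m-n}(q^{-2})}{w_m(q^{-2})}\prod_{i=1}^n\left(1-q^{-(s_i+\cdots+s_n+2m-2i+2)}\right)\sum_{\alpha\in\Lambda_n^+}\frac{\mu(\pi^\alpha,\pi^\xi)}{\mu(\pi^\alpha,\pi^\alpha)}\,\omega(\pi^\alpha;s).$$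 Here the integrals defining the spherical functions and both series converge absolutely, the limits defining the densities exist, and $\mu(\pi^\alpha,\pi^\alpha)\neq 0$. -/

import Mathlib

open MeasureTheory Filter Topology
open scoped NormedField Valued Quaternion Matrix

namespace QuatHerm

variable {k : Type*} [NontriviallyNormedField k] [IsUltrametricDist k]

/-- The number `q` of elements of the residue field of `k`. -/
noncomputable def resCard (k : Type*) [NontriviallyNormedField k] [IsUltrametricDist k] : ℕ :=
  Nat.card 𝓀[k]

/-- The quaternion algebra `D = k ⊕ kε ⊕ kΠ ⊕ kεΠ` with `ε² = u`, `Π² = π`, `Πε = -εΠ`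
(`ε`, `Π`, `εΠ` are the units `i`, `j`, `k` of Mathlib's quaternion algebra); `star` is its canonical
involution. When `u` is a nonsquare unit and `π` is a prime element of the ring of integers `𝒪[k]`
(`q` odd), this is the division quaternion algebra over `k`. -/
abbrev QAlg (u π : 𝒪[k]) : Type _ := ℍ[k, (u : k), 0, (π : k)]

/-- The maximal order of `D`, which has the basis `1, ε, Π, εΠ` over `𝒪[k]`. -/
abbrev QOrd (u π : 𝒪[k]) : Type _ := ℍ[𝒪[k], u, 0, π]

/-- The inclusion of the maximal order into `D`. -/
noncomputable def toD (u π : 𝒪[k]) : QOrd u π →+* QAlg u π where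
  toFun x := ⟨x.re, x.imI, x.imJ, x.imK⟩
  map_one' := by ext <;> simp
  map_mul' x y := by ext <;> simp
  map_zero' := by ext <;> simp
  map_add' x y := by ext <;> simp

/-- The prime element `Π` of `D`, `Π² = π`. -/
noncomputable def primeElt (u π : 𝒪[k]) : QOrd u π := ⟨0, 0, 1, 0⟩

/-- The power `P ^ r = Π ^ r · O` of the maximal ideal `P` of the maximal order `O`. -/
noncomputable def idealPow (u π : 𝒪[k]) (r : ℕ) : AddSubgroup (QOrd u π) :=
  (AddMonoidHom.mulLeft (primeElt u π ^ r)).range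

/-- The quadratic extension `k' = k(ε)`, `ε² = u`. -/
abbrev QuadExt (u : 𝒪[k]) : Type _ := QuadraticAlgebra k (u : k) 0

/-- The inclusion `φ : D → M₂(k')` determined by `x (1 Π) = (1 Π) φ(x)`.
If `x = a + bε + cΠ + dΠε` then `x.imK = -d`. -/
noncomputable def splitting {u π : 𝒪[k]} (x : QAlg u π) : Matrix (Fin 2) (Fin 2) (QuadExt u) :=
  !![⟨x.re, x.imI⟩, ⟨x.imJ * (π : k), x.imK * (π : k)⟩; ⟨x.imJ, -x.imK⟩, ⟨x.re, -x.imI⟩]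

/-- The inclusion `φₙ : Mₙ(D) → M₂ₙ(k')`. -/
noncomputable def splittingMat {u π : 𝒪[k]} {n : ℕ} (A : Matrix (Fin n) (Fin n) (QAlg u π)) :
    Matrix (Fin n × Fin 2) (Fin n × Fin 2) (QuadExt u) :=
  Matrix.of fun p r => splitting (A p.1 r.1) p.2 r.2

/-- The reduced norm on `Mₙ(D)`: the determinant of `φₙ(A)`. It lies in `k`, that is, it is equal
to its first coordinate with respect to the basis `1, ε` of `k'`. -/
noncomputable def redNorm {u π : 𝒪[k]} {n : ℕ} (A : Matrix (Fin n) (Fin n) (QAlg u π)) : k :=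
  (splittingMat A).det.re

/-- The space `Xₙ` of nondegenerate quaternion hermitian matrices. -/
def hermSpace (u π : 𝒪[k]) (n : ℕ) : Set (Matrix (Fin n) (Fin n) (QAlg u π)) :=
  {A | IsUnit A ∧ Aᴴ = A}

/-- The upper left block of size `i + 1`. -/
def block {R : Type*} {n : ℕ} (x : Matrix (Fin n) (Fin n) R) (i : Fin n) :
    Matrix (Fin (i + 1)) (Fin (i + 1)) R :=
  x.submatrix (Fin.castLE i.isLt) (Fin.castLE i.isLt)

/-- The absolute value `|dᵢ(x)|`, where `dᵢ(x)² = Nrd(x⁽ⁱ⁾)`. The index `i : Fin n` stands for the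
block of size `i + 1`. -/
noncomputable def absMinor {u π : 𝒪[k]} {n : ℕ} (x : Matrix (Fin n) (Fin n) (QAlg u π))
    (i : Fin n) : ℝ :=
  Real.sqrt ‖redNorm (block x i)‖

/-- The set `Xₙᵒᵖ` of the elements of `Xₙ` all of whose `dᵢ` are nonzero. -/
def hermOp (u π : 𝒪[k]) (n : ℕ) : Set (Matrix (Fin n) (Fin n) (QAlg u π)) :=
  {x | x ∈ hermSpace u π n ∧ ∀ i, redNorm (block x i) ≠ 0}

open Classical in
/-- `|d(y)|ˢ = ∏ |dᵢ(y)| ^ sᵢ` on `Xₙᵒᵖ`, and `0` elsewhere. -/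
noncomputable def absPow {u π : 𝒪[k]} {n : ℕ} (s : Fin n → ℂ)
    (y : Matrix (Fin n) (Fin n) (QAlg u π)) : ℂ :=
  if y ∈ hermOp u π n then ∏ i, (absMinor y i : ℂ) ^ s i else 0

/-- The topology of the maximal order: the product topology of the four coordinates. -/
noncomputable instance instTopQOrd (u π : 𝒪[k]) : TopologicalSpace (QOrd u π) :=
  TopologicalSpace.induced (QuaternionAlgebra.equivProd u 0 π) inferInstance

/-- The coordinates of the maximal order, as a homeomorphism. -/
noncomputable def coordHomeo (u π : 𝒪[k]) : QOrd u π ≃ₜ 𝒪[k] × 𝒪[k] × 𝒪[k] × 𝒪[k] :=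
  (QuaternionAlgebra.equivProd u 0 π).toHomeomorphOfIsInducing ⟨rfl⟩

theorem continuous_coords (u π : 𝒪[k]) :
    Continuous (fun x : QOrd u π => x.re) ∧ Continuous (fun x : QOrd u π => x.imI) ∧
      Continuous (fun x : QOrd u π => x.imJ) ∧ Continuous (fun x : QOrd u π => x.imK) := by
  have h := (coordHomeo u π).continuous
  exact ⟨h.fst, h.snd.fst, h.snd.snd.fst, h.snd.snd.snd⟩

theorem continuous_of_coords {α : Type*} [TopologicalSpace α] {u π : 𝒪[k]} {f : α → QOrd u π}
    (h0 : Continuous fun a => (f a).re) (h1 : Continuous fun a => (f a).imI)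
    (h2 : Continuous fun a => (f a).imJ) (h3 : Continuous fun a => (f a).imK) : Continuous f :=
  (coordHomeo u π).comp_continuous_iff.mp (h0.prodMk (h1.prodMk (h2.prodMk h3)))

instance instTopRingQOrd (u π : 𝒪[k]) : IsTopologicalRing (QOrd u π) := by
  obtain ⟨c0, c1, c2, c3⟩ := continuous_coords u π
  refine { continuous_add := ?_, continuous_mul := ?_, continuous_neg := ?_ }
  · refine continuous_of_coords ?_ ?_ ?_ ?_ <;> simp only [QuaternionAlgebra.re_add,
      QuaternionAlgebra.imI_add, QuaternionAlgebra.imJ_add, QuaternionAlgebra.imK_add] <;> fun_prop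
  · refine continuous_of_coords ?_ ?_ ?_ ?_ <;> simp only [QuaternionAlgebra.re_mul,
      QuaternionAlgebra.imI_mul, QuaternionAlgebra.imJ_mul, QuaternionAlgebra.imK_mul] <;> fun_prop
  · refine continuous_of_coords ?_ ?_ ?_ ?_ <;> simp only [QuaternionAlgebra.re_neg,
      QuaternionAlgebra.imI_neg, QuaternionAlgebra.imJ_neg, QuaternionAlgebra.imK_neg] <;> fun_prop

instance instT2QOrd (u π : 𝒪[k]) : T2Space (QOrd u π) :=
  (coordHomeo u π).symm.t2Space

instance instCompactIntegers [ProperSpace k] : CompactSpace 𝒪[k] := by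
  refine isCompact_iff_compactSpace.mp ?_
  convert isCompact_closedBall (0 : k) 1 using 1
  ext x
  simp [Valued.integer.mem_iff]

instance instCompactQOrd [ProperSpace k] (u π : 𝒪[k]) : CompactSpace (QOrd u π) :=
  (coordHomeo u π).symm.compactSpace

/-- The group `Kₙ = GLₙ(O)`. -/
abbrev maxCompact (u π : 𝒪[k]) (n : ℕ) : Type _ := (Matrix (Fin n) (Fin n) (QOrd u π))ˣ

noncomputable instance instMeasK (u π : 𝒪[k]) (n : ℕ) : MeasurableSpace (maxCompact u π n) := borel _

instance instBorelK (u π : 𝒪[k]) (n : ℕ) : BorelSpace (maxCompact u π n) := ⟨rfl⟩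

instance instCompactMat [ProperSpace k] (u π : 𝒪[k]) (n : ℕ) :
    CompactSpace (Matrix (Fin n) (Fin n) (QOrd u π)) :=
  inferInstanceAs (CompactSpace (Fin n → Fin n → QOrd u π))

/-- The normalized Haar measure `dk` of the compact group `Kₙ`. -/
noncomputable def haarK [ProperSpace k] (u π : 𝒪[k]) (n : ℕ) : Measure (maxCompact u π n) :=
  Measure.haarMeasure ⊤

/-- The action `g · x = g x g*` of `Kₙ` on hermitian matrices over `D`. -/
noncomputable def act {u π : 𝒪[k]} {n : ℕ} (g : maxCompact u π n) (x : Matrix (Fin n) (Fin n) (QAlg u π)) :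
    Matrix (Fin n) (Fin n) (QAlg u π) :=
  g.val.map (toD u π) * x * (g.val.map (toD u π))ᴴ

/-- The spherical function `ω(x; s) = ∫ |d(g · x)|ˢ dg`, the integral being taken over `Kₙ`. -/
noncomputable def sphericalFn [ProperSpace k] {u π : 𝒪[k]} {n : ℕ}
    (x : Matrix (Fin n) (Fin n) (QAlg u π)) (s : Fin n → ℂ) : ℂ :=
  ∫ g, absPow s (act g x) ∂haarK u π n

/-- The integral that defines `ω(x; s)` converges absolutely. -/
def SphericalConverges [ProperSpace k] {u π : 𝒪[k]} {n : ℕ}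
    (x : Matrix (Fin n) (Fin n) (QAlg u π)) (s : Fin n → ℂ) : Prop :=
  Integrable (fun g => absPow s (act g x)) (haarK u π n)

/-- The set `Λₙ⁺` of weakly decreasing sequences of nonnegative integers in which every odd number
occurs an even number of times. -/
def lambdaPlus (n : ℕ) : Set (Fin n → ℕ) :=
  {α | Antitone α ∧ ∀ i, Odd (α i) → Even (Finset.univ.filter fun j => α j = α i).card}

/-- The number of earlier indices with the same value as `i`. -/
def rankIn {n : ℕ} (α : Fin n → ℕ) (i : Fin n) : ℕ :=
  (Finset.univ.filter fun j => j < i ∧ α j = α i).card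

/-- The matrix `π^α`, for `α` in `Λₙ⁺`, with entries in the maximal order: an even value `2e` of `α`
contributes the diagonal entry `π^e`; the positions of an odd value `2e + 1` are grouped into
consecutive pairs, and each pair contributes a diagonal block `(0, π^e Π; -π^e Π, 0)`. -/
noncomputable def piMat (u π : 𝒪[k]) {n : ℕ} (α : Fin n → ℕ) : Matrix (Fin n) (Fin n) (QOrd u π) :=
  Matrix.of fun i j =>
    if Even (α i) then
      if i = j then algebraMap 𝒪[k] (QOrd u π) (π ^ (α i / 2)) else 0
    else if α i = α j ∧ (j : ℕ) = i + 1 ∧ Even (rankIn α i) then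
      algebraMap 𝒪[k] (QOrd u π) (π ^ (α i / 2)) * primeElt u π
    else if α i = α j ∧ (i : ℕ) = j + 1 ∧ Even (rankIn α j) then
      -(algebraMap 𝒪[k] (QOrd u π) (π ^ (α i / 2)) * primeElt u π)
    else 0

/-- `π^α` as a matrix over `D`. -/
noncomputable def piMatD (u π : 𝒪[k]) {n : ℕ} (α : Fin n → ℕ) : Matrix (Fin n) (Fin n) (QAlg u π) :=
  (piMat u π α).map (toD u π)

/-- An `m × n` matrix over the maximal order is primitive if it consists of the first `n` columns of
an element of `GLₘ(O)`. -/
def IsPrimitive {u π : 𝒪[k]} {m n : ℕ} (x : Matrix (Fin m) (Fin n) (QOrd u π)) : Prop :=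
  ∃ g : maxCompact u π m,
    x = g.val * Matrix.of fun (i : Fin m) (j : Fin n) => if (i : ℕ) = j then (1 : QOrd u π) else 0

/-- `A[x] = x* A x` represents `B` modulo `P ^ (2ℓ - 1)`. -/
def Represents {u π : 𝒪[k]} {m n : ℕ} (B : Matrix (Fin n) (Fin n) (QOrd u π))
    (A : Matrix (Fin m) (Fin m) (QOrd u π)) (l : ℕ) (x : Matrix (Fin m) (Fin n) (QOrd u π)) :
    Prop :=
  ∀ i j, (xᴴ * A * x - B) i j ∈ idealPow u π (2 * l - 1)

/-- The class of a matrix modulo `P ^ (2ℓ)`. -/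
noncomputable def reduction {u π : 𝒪[k]} {m n : ℕ} (l : ℕ) (x : Matrix (Fin m) (Fin n) (QOrd u π)) :
    Matrix (Fin m) (Fin n) (QOrd u π ⧸ idealPow u π (2 * l)) :=
  x.map (QuotientAddGroup.mk (s := idealPow u π (2 * l)))

/-- The number `N_ℓ(B, A)` of classes modulo `P ^ (2ℓ)` of representations of `B` by `A`. -/
noncomputable def repCount {u π : 𝒪[k]} {m n : ℕ} (B : Matrix (Fin n) (Fin n) (QOrd u π))
    (A : Matrix (Fin m) (Fin m) (QOrd u π)) (l : ℕ) : ℕ :=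
  (reduction l '' {x : Matrix (Fin m) (Fin n) (QOrd u π) | Represents B A l x}).ncard

/-- The number of classes modulo `P ^ (2ℓ)` of primitive representations of `B` by `A`. -/
noncomputable def repCountPr {u π : 𝒪[k]} {m n : ℕ} (B : Matrix (Fin n) (Fin n) (QOrd u π))
    (A : Matrix (Fin m) (Fin m) (QOrd u π)) (l : ℕ) : ℕ :=
  (reduction l ''
    {x : Matrix (Fin m) (Fin n) (QOrd u π) | IsPrimitive x ∧ Represents B A l x}).ncard

/-- The normalizing factor `q ^ (ℓn(4m - 2n + 1) + n(n - 1))`. -/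
noncomputable def densityNorm (k : Type*) [NontriviallyNormedField k] [IsUltrametricDist k]
    (m n l : ℕ) : ℝ :=
  (resCard k : ℝ) ^ ((l : ℤ) * n * (4 * m - 2 * n + 1) + n * (n - 1))

/-- The quotient whose limit is the local density. -/
noncomputable def densityRatio {u π : 𝒪[k]} {m n : ℕ} (B : Matrix (Fin n) (Fin n) (QOrd u π))
    (A : Matrix (Fin m) (Fin m) (QOrd u π)) (l : ℕ) : ℝ :=
  repCount B A l / densityNorm k m n l

/-- The quotient whose limit is the primitive local density. -/
noncomputable def densityRatioPr {u π : 𝒪[k]} {m n : ℕ} (B : Matrix (Fin n) (Fin n) (QOrd u π))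
    (A : Matrix (Fin m) (Fin m) (QOrd u π)) (l : ℕ) : ℝ :=
  repCountPr B A l / densityNorm k m n l

/-- The local density `μ(B, A)`. -/
noncomputable def density {u π : 𝒪[k]} {m n : ℕ} (B : Matrix (Fin n) (Fin n) (QOrd u π))
    (A : Matrix (Fin m) (Fin m) (QOrd u π)) : ℝ :=
  limUnder atTop (densityRatio B A)

/-- The primitive local density `μᵖʳ(B, A)`. -/
noncomputable def densityPr {u π : 𝒪[k]} {m n : ℕ} (B : Matrix (Fin n) (Fin n) (QOrd u π))
    (A : Matrix (Fin m) (Fin m) (QOrd u π)) : ℝ :=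
  limUnder atTop (densityRatioPr B A)

/-- `w_m(t) = ∏_{i = 1}^m (1 - t ^ i)`. -/
noncomputable def wPoly (m : ℕ) (t : ℂ) : ℂ := ∏ i ∈ Finset.Icc 1 m, (1 - t ^ i)

/-- `(s₁, …, sₙ, 0, …, 0)` with `m` entries. -/
noncomputable def extendZero {n : ℕ} (m : ℕ) (s : Fin n → ℂ) (i : Fin m) : ℂ :=
  if h : (i : ℕ) < n then s ⟨i, h⟩ else 0

end QuatHerm

/-!
Write `f(y) = |d(y)|ˢ`, `A = π^ξ`, and consider the function `F(x) = f(xᴴ A x)` on the `m × n`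
matrices over the maximal order, a compact group with normalized Haar measure. Both identities
compute the integral of `F` over the primitive matrices, respectively over all matrices, in two ways.

*Decomposition into orbits.* Every nondegenerate hermitian matrix over the maximal order is congruent
to exactly one `π^α` with `α ∈ Λₙ⁺`, and the orbits are open (`exists_cong_piMat`,
`piMat_cong_unique`, `cong_of_close`). Uniqueness and openness both come from the index of the kernel
of `π^α` modulo powers of `P`, an invariant of the congruence class that depends only on the matrix
modulo that power. The matrices `x` for which `xᴴ A x` has a vanishing leading minor form a null set
(`ae_minorNorm_ne_zero`): along a suitable progression `y + N z` each minor is a nonzero polynomial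
in `1 / N` up to a power of `N`, and a set of positive measure would be met infinitely often, by
Poincaré recurrence. Since the measure is invariant under `x ↦ x gᴴ`, the mean of `F` over
`{x | xᴴ A x ∈ Kₙ · π^α}` is `ω(π^α; s)`, and so the integral of `F` over an invariant set `W` is
`∑ vol (W ∩ {x | xᴴ A x ∈ Kₙ · π^α}) ω(π^α; s)` (`hasSum_setIntegral_gram`).

*Local densities are quotients of volumes.* The volume of the `x ∈ W` for which `xᴴ A x` is close to
`π^α` is, by invariance again, the volume of `W ∩ {x | xᴴ A x ∈ Kₙ · π^α}` times the same factor that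
relates a small neighbourhood of `π^α` to the orbit `Kₙ · π^α` in the group of hermitian matrices.
Hence the sequence that defines a density is constant as soon as `P ^ (2 l - 1)` is deep enough for
`α` (`ncard_div_densityNorm`), with value `vol (W ∩ {x | xᴴ A x ∈ Kₙ · π^α}) / vol (Kₙ · π^α)`. For
`A = π^α` the set in the numerator is `GLₙ` of the maximal order (`isUnit_of_cong_gram`), so in the
quotients `μ(π^α, π^ξ) / μ(π^α, π^α)` the volume of the orbit cancels.

*The spherical function.* Averaging over `Kₘ` instead, whose action on the primitive matrices is
transitive, shows that the mean of `F` over the primitive matrices is `ω(π^ξ; s, 0)`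
(`setIntegral_primitive`). This gives the first identity.

*Column operations.* For the second identity the two integrals of `F` are compared. Primitive
matrices are those whose columns are independent modulo `P` (`isPrimitive_iff_indepMod`). If the
first `j` columns are independent and column `j + 1` depends on them modulo `P`, then `x` is, in
exactly one way up to the choice of residues, obtained by multiplying column `j + 1` of another such
matrix by `Π` and adding a combination of the earlier columns; this multiplies `F` by a constant and
the measure by `q ^ (-2 m)`, and there are `q ^ (2 j)` choices. Each column therefore contributes a
factor `1 - q ^ (-(sᵢ + ⋯ + sₙ + 2 m - 2 i + 2))` (`setIntegral_indepMod`,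
`setIntegral_primitive_eq`). For `F = 1` this is the volume `w_m(q⁻²) / w_{m - n}(q⁻²)` of the
primitive matrices.
-/

namespace QuatHerm

set_option linter.unusedSectionVars false

section

variable {k : Type*} [NontriviallyNormedField k] [IsUltrametricDist k]

/-! ### The ring of integers -/

/-- The standing hypotheses on the parameters: the residue cardinality is odd, `π` is a prime element
with normalized absolute value, and `u` is a unit that is not a square. -/
class StandardPair (u π : 𝒪[k]) : Prop where
  odd_resCard : Odd (resCard k)
  irreducible : Irreducible π
  norm_eq : ‖(π : k)‖ = (resCard k : ℝ)⁻¹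
  isUnit : IsUnit u
  not_isSquare : ¬ IsSquare (u : k)

section Integers

variable [ProperSpace k]

instance instDVR : IsDiscreteValuationRing 𝒪[k] := by
  have : (Valued.v : Valuation k _).IsNontrivial := by
    obtain ⟨x, hx⟩ := NormedField.exists_one_lt_norm k
    refine ⟨x, ?_, fun h1 => ?_⟩
    · rw [Ne, map_eq_zero]
      rintro rfl
      simp at hx
      linarith
    · have h2 : NormedField.valuation x = 1 := h1
      rw [NormedField.valuation_apply] at h2
      rw [← coe_nnnorm, h2] at hx
      simp at hx
  exact Valued.integer.isDiscreteValuationRing_of_compactSpace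

variable (u π : 𝒪[k]) [h : StandardPair u π]

include u π h

theorem finite_residueField : Finite 𝓀[k] := by
  have := h.odd_resCard
  refine Nat.finite_of_card_ne_zero fun h0 => ?_
  rw [resCard, h0] at this
  simp at this

theorem one_lt_resCard : 1 < resCard k := by
  have := finite_residueField u π
  exact Finite.one_lt_card

omit h in
theorem isUnit_iff_not_dvd (hπ : Irreducible π) {a : 𝒪[k]} : IsUnit a ↔ ¬ π ∣ a := by
  have := hπ.maximalIdeal_eq
  rw [← Ideal.mem_span_singleton, ← this, IsLocalRing.mem_maximalIdeal, mem_nonunits_iff, not_not]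

theorem isUnit_iff {a : 𝒪[k]} : IsUnit a ↔ ¬ π ∣ a := isUnit_iff_not_dvd u π h.irreducible

theorem pi_ne_zero : π ≠ 0 := h.irreducible.ne_zero

theorem residue_eq_zero_iff {a : 𝒪[k]} : IsLocalRing.residue 𝒪[k] a = 0 ↔ π ∣ a := by
  rw [IsLocalRing.residue_eq_zero_iff, IsLocalRing.mem_maximalIdeal, mem_nonunits_iff,
    isUnit_iff u π, not_not]

theorem two_residue_ne_zero : (2 : 𝓀[k]) ≠ 0 := by
  have := finite_residueField u π
  have := Fintype.ofFinite 𝓀[k]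
  have hodd := h.odd_resCard
  rw [resCard, Nat.card_eq_fintype_card] at hodd
  refine Ring.two_ne_zero fun h2 => ?_
  have := FiniteField.even_card_of_char_two h2
  rw [Nat.odd_iff] at hodd
  omega

theorem isUnit_two : IsUnit (2 : 𝒪[k]) := by
  rw [isUnit_iff u π, ← residue_eq_zero_iff u π, map_ofNat]
  exact two_residue_ne_zero u π

theorem exists_not_pow_dvd {a : 𝒪[k]} (ha : a ≠ 0) : ∃ n, ¬ π ^ n ∣ a := by
  obtain ⟨n, hn⟩ := FiniteMultiplicity.of_not_isUnit h.irreducible.not_isUnit ha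
  exact ⟨n + 1, hn⟩

/-- Elements congruent to `1` modulo `π` are squares, the square root being the fixed point of a
contraction. -/
theorem exists_sq_eq_one_add (x : 𝒪[k]) : ∃ t : 𝒪[k], (1 + π * t) ^ 2 = 1 + π * x := by
  obtain ⟨c, hc⟩ := (isUnit_two u π).exists_right_inv
  have hπ1 : ‖(π : k)‖ < 1 := by
    rw [h.norm_eq]
    exact inv_lt_one_of_one_lt₀ (by exact_mod_cast one_lt_resCard u π)
  have hcon : ContractingWith ‖(π : k)‖₊ (fun t : 𝒪[k] => (x - π * t ^ 2) * c) := by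
    refine ⟨by exact_mod_cast hπ1, LipschitzWith.of_dist_le_mul fun a b => ?_⟩
    have hn (y : 𝒪[k]) : ‖(y : k)‖ ≤ 1 := Valued.integer.norm_le_one y
    rw [Subtype.dist_eq, Subtype.dist_eq, dist_eq_norm, dist_eq_norm, coe_nnnorm]
    have : (((x - π * a ^ 2) * c : 𝒪[k]) : k) - ((x - π * b ^ 2) * c : 𝒪[k])
        = π * (-(c : k)) * ((a + b : 𝒪[k]) : k) * ((a : k) - b) := by
      push_cast; ring
    rw [this, norm_mul, norm_mul, norm_mul, norm_neg]
    refine mul_le_mul_of_nonneg_right ?_ (norm_nonneg _)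
    have h1 := mul_le_mul (hn c) (hn (a + b)) (norm_nonneg _) zero_le_one
    calc _ = ‖(π : k)‖ * (‖(c : k)‖ * ‖((a + b : 𝒪[k]) : k)‖) := by ring
      _ ≤ ‖(π : k)‖ * (1 * 1) := mul_le_mul_of_nonneg_left h1 (norm_nonneg _)
      _ = _ := by ring
  have hfix := hcon.fixedPoint_isFixedPt
  set t := ContractingWith.fixedPoint _ hcon
  refine ⟨t, ?_⟩
  have ht : (x - π * t ^ 2) * c = t := hfix
  have : 2 * t = x - π * t ^ 2 := by
    calc 2 * t = 2 * ((x - π * t ^ 2) * c) := by rw [ht]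
      _ = (2 * c) * (x - π * t ^ 2) := by ring
      _ = _ := by rw [hc, one_mul]
  linear_combination π * this

theorem isSquare_of_residue {a b : 𝒪[k]} (ha : IsUnit a) (hab : π ∣ a - b ^ 2) :
    ∃ c, IsUnit c ∧ a = (c * b) ^ 2 := by
  have hb : IsUnit (b ^ 2) := by
    rw [isUnit_iff u π] at ha ⊢
    exact fun hd => ha ((dvd_sub_left hd).mp hab)
  obtain ⟨x, hx⟩ := hab
  obtain ⟨d, hd⟩ := hb.exists_right_inv
  obtain ⟨t, ht⟩ := exists_sq_eq_one_add u π (x * d)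
  refine ⟨1 + π * t, ?_, ?_⟩
  · rw [isUnit_iff u π]
    exact fun hd => h.irreducible.not_isUnit
      (isUnit_of_dvd_one ((dvd_add_left (dvd_mul_right π t)).mp hd))
  · rw [mul_pow, ht]
    linear_combination hx - π * x * hd

/-- The norm form `a² - u b²` of the unramified extension is anisotropic modulo `π`. -/
theorem dvd_of_dvd_norm {a b : 𝒪[k]} (hab : π ∣ a ^ 2 - u * b ^ 2) : π ∣ a ∧ π ∣ b := by
  have hp : Prime π := h.irreducible.prime
  by_cases hb : π ∣ b
  · refine ⟨hp.dvd_of_dvd_pow (n := 2) ?_, hb⟩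
    have : π ∣ u * b ^ 2 := (hb.trans (dvd_pow_self b two_ne_zero)).mul_left u
    simpa using dvd_add hab this
  · exfalso
    obtain ⟨d, hd⟩ := ((isUnit_iff u π).2 hb).exists_right_inv
    obtain ⟨c, -, hc2⟩ := isSquare_of_residue u π h.isUnit (b := a * d) (by
      have : u - (a * d) ^ 2 = -((a ^ 2 - u * b ^ 2) * d ^ 2) + u * (1 - b * d) * (1 + b * d) := by
        ring
      rw [this, hd]
      simpa using hab.mul_right _)
    refine h.not_isSquare ⟨c * (a * d), ?_⟩
    have := congrArg (Subtype.val : 𝒪[k] → k) hc2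
    push_cast at this
    rw [this]; ring

/-- Every unit is a norm from the unramified quadratic extension. -/
theorem exists_norm_eq {v : 𝒪[k]} (hv : IsUnit v) : ∃ a b : 𝒪[k], a ^ 2 - u * b ^ 2 = v := by
  have := finite_residueField u π
  have := Fintype.ofFinite 𝓀[k]
  set r := IsLocalRing.residue 𝒪[k]
  have hru : r u ≠ 0 := by
    rw [Ne, residue_eq_zero_iff u π, ← isUnit_iff u π]; exact h.isUnit
  have hodd : Fintype.card 𝓀[k] % 2 = 1 := by
    have hodd := h.odd_resCard
    rw [resCard, Nat.card_eq_fintype_card] at hodd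
    exact Nat.odd_iff.mp hodd
  obtain ⟨a, b, hab⟩ := FiniteField.exists_root_sum_quadratic
    (f := (Polynomial.X ^ 2 : Polynomial 𝓀[k]))
    (g := Polynomial.C (-r u) * Polynomial.X ^ 2 - Polynomial.C (r v))
    (Polynomial.degree_X_pow 2) (by compute_degree!) hodd
  obtain ⟨a, rfl⟩ := IsLocalRing.residue_surjective a
  obtain ⟨b, rfl⟩ := IsLocalRing.residue_surjective b
  have hd : π ∣ (a ^ 2 - u * b ^ 2) - v := by
    rw [← residue_eq_zero_iff u π]
    simp only [Polynomial.eval_pow, Polynomial.eval_X, Polynomial.eval_sub, Polynomial.eval_mul,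
      Polynomial.eval_C] at hab
    simp only [map_sub, map_mul, map_pow]
    linear_combination hab
  obtain ⟨d, hd1⟩ := hv.exists_right_inv
  have hN : IsUnit (a ^ 2 - u * b ^ 2) := by
    rw [isUnit_iff u π] at hv ⊢
    exact fun h1 => hv ((dvd_sub_right h1).mp hd)
  obtain ⟨w, hw⟩ := hN.exists_right_inv
  obtain ⟨c, hc, hc2⟩ := isSquare_of_residue u π (a := v * w) (b := 1)
    (hv.mul (IsUnit.of_mul_eq_one _ (by rw [mul_comm]; exact hw))) (by
      have : v * w - 1 ^ 2 = -(w * ((a ^ 2 - u * b ^ 2) - v)) := by linear_combination hw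
      rw [this]
      exact (hd.mul_left w).neg_right)
  refine ⟨c * a, c * b, ?_⟩
  rw [mul_one] at hc2
  linear_combination v * hw - (a ^ 2 - u * b ^ 2) * hc2

end Integers

/-! ### The maximal order and the powers of its maximal ideal -/

section Order

variable {u π : 𝒪[k]}

theorem star_primeElt : star (primeElt u π) = -primeElt u π := by
  ext <;> simp [primeElt]

theorem primeElt_mul (y : QOrd u π) :
    primeElt u π * y = ⟨π * y.imJ, -(π * y.imK), y.re, -y.imI⟩ := by
  ext <;> simp [primeElt]

theorem primeElt_mul_self : primeElt u π * primeElt u π = algebraMap 𝒪[k] (QOrd u π) π := by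
  rw [primeElt_mul]; ext <;> simp [primeElt, QuaternionAlgebra.algebraMap_eq]

theorem algebraMap_comm (a : 𝒪[k]) (x : QOrd u π) :
    algebraMap 𝒪[k] (QOrd u π) a * x = x * algebraMap 𝒪[k] (QOrd u π) a :=
  Algebra.commutes a x

theorem star_algebraMap (a : 𝒪[k]) :
    star (algebraMap 𝒪[k] (QOrd u π) a) = algebraMap 𝒪[k] (QOrd u π) a := by
  ext <;> simp [QuaternionAlgebra.algebraMap_eq]

theorem primeElt_pow_two_mul (e : ℕ) :
    primeElt u π ^ (2 * e) = algebraMap 𝒪[k] (QOrd u π) (π ^ e) := by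
  rw [pow_mul, pow_two, primeElt_mul_self, map_pow]

theorem mem_idealPow {r : ℕ} {x : QOrd u π} :
    x ∈ idealPow u π r ↔ ∃ y, primeElt u π ^ r * y = x := by
  simp [idealPow, AddMonoidHom.mem_range]

/-- Membership in `P ^ r` in terms of coordinates. -/
theorem mem_idealPow_iff {r : ℕ} {x : QOrd u π} :
    x ∈ idealPow u π r ↔ (π ^ ((r + 1) / 2) ∣ x.re ∧ π ^ ((r + 1) / 2) ∣ x.imI) ∧
      π ^ (r / 2) ∣ x.imJ ∧ π ^ (r / 2) ∣ x.imK := by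
  induction r generalizing x with
  | zero => simp [mem_idealPow]
  | succ r ih =>
    have hs : x ∈ idealPow u π (r + 1) ↔ ∃ y ∈ idealPow u π r, primeElt u π * y = x := by
      simp only [mem_idealPow, pow_succ']
      constructor
      · rintro ⟨y, rfl⟩; exact ⟨_, ⟨y, rfl⟩, by rw [mul_assoc]⟩
      · rintro ⟨_, ⟨y, rfl⟩, rfl⟩; exact ⟨y, by rw [mul_assoc]⟩
    have e1 : (r + 1 + 1) / 2 = r / 2 + 1 := by omega
    rw [hs, e1]
    constructor
    · rintro ⟨y, hy, rfl⟩
      obtain ⟨⟨h1, h2⟩, h3, h4⟩ := ih.1 hy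
      rw [primeElt_mul]
      refine ⟨⟨?_, ?_⟩, h1, h2.neg_right⟩
      · rw [pow_succ']; exact mul_dvd_mul_left π h3
      · rw [pow_succ']; exact (mul_dvd_mul_left π h4).neg_right
    · rintro ⟨⟨⟨a, ha⟩, ⟨b, hb⟩⟩, h3, h4⟩
      refine ⟨⟨x.imJ, -x.imK, π ^ (r / 2) * a, -(π ^ (r / 2) * b)⟩, ih.2 ⟨⟨h3, h4.neg_right⟩,
        dvd_mul_right _ _, (dvd_mul_right _ _).neg_right⟩, ?_⟩
      rw [primeElt_mul]
      ext
      · rw [ha]; ring_nf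
      · rw [hb]; ring_nf
      · rfl
      · simp

theorem idealPow_zero : idealPow u π 0 = ⊤ := by
  ext x; simp [mem_idealPow]

theorem idealPow_anti {r s : ℕ} (hrs : r ≤ s) : idealPow u π s ≤ idealPow u π r := by
  intro x hx
  rw [mem_idealPow_iff] at hx ⊢
  have h1 : π ^ ((r + 1) / 2) ∣ π ^ ((s + 1) / 2) := pow_dvd_pow _ (by omega)
  have h2 : π ^ (r / 2) ∣ π ^ (s / 2) := pow_dvd_pow _ (by omega)
  exact ⟨⟨h1.trans hx.1.1, h1.trans hx.1.2⟩, h2.trans hx.2.1, h2.trans hx.2.2⟩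

theorem star_mem_idealPow {r : ℕ} {x : QOrd u π} (hx : x ∈ idealPow u π r) :
    star x ∈ idealPow u π r := by
  rw [mem_idealPow_iff] at hx ⊢
  simpa using hx

theorem mul_mem_idealPow_left {r : ℕ} {x : QOrd u π} (hx : x ∈ idealPow u π r) (a : QOrd u π) :
    x * a ∈ idealPow u π r := by
  obtain ⟨y, rfl⟩ := mem_idealPow.1 hx
  exact mem_idealPow.2 ⟨y * a, by rw [mul_assoc]⟩

theorem mul_mem_idealPow_right {r : ℕ} {x : QOrd u π} (hx : x ∈ idealPow u π r) (a : QOrd u π) :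
    a * x ∈ idealPow u π r := by
  have := star_mem_idealPow (mul_mem_idealPow_left (star_mem_idealPow hx) (star a))
  simpa using this

theorem primeElt_pow_mem (r : ℕ) : primeElt u π ^ r ∈ idealPow u π r :=
  mem_idealPow.2 ⟨1, mul_one _⟩

theorem mul_mem_idealPow {r s : ℕ} {x y : QOrd u π} (hx : x ∈ idealPow u π r)
    (hy : y ∈ idealPow u π s) : x * y ∈ idealPow u π (r + s) := by
  obtain ⟨a, rfl⟩ := mem_idealPow.1 hx
  obtain ⟨b, hb⟩ := mem_idealPow.1 (mul_mem_idealPow_right hy a)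
  exact mem_idealPow.2 ⟨b, by rw [pow_add, mul_assoc, hb, mul_assoc]⟩

/-- `P ^ r` is also generated by `Π ^ r` as a left ideal. -/
theorem mem_idealPow_left {r : ℕ} {x : QOrd u π} :
    x ∈ idealPow u π r ↔ ∃ y, y * primeElt u π ^ r = x := by
  constructor
  · intro hx
    obtain ⟨y, hy⟩ := mem_idealPow.1 (star_mem_idealPow hx)
    refine ⟨star y * (-1) ^ r, ?_⟩
    have := congrArg star hy
    rw [star_star] at this
    rw [← this, star_mul, star_pow, star_primeElt, neg_pow (primeElt u π), mul_assoc]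
  · rintro ⟨y, rfl⟩
    exact mul_mem_idealPow_right (primeElt_pow_mem r) y

theorem idealPow_sum_mem {r : ℕ} {ι : Type*} (s : Finset ι) {f : ι → QOrd u π}
    (hf : ∀ i ∈ s, f i ∈ idealPow u π r) : ∑ i ∈ s, f i ∈ idealPow u π r :=
  AddSubgroup.sum_mem _ hf

theorem mul_star_eq (x : QOrd u π) : x * star x =
    algebraMap 𝒪[k] (QOrd u π)
      (x.re ^ 2 - u * x.imI ^ 2 - π * (x.imJ ^ 2 - u * x.imK ^ 2)) := by
  ext <;> simp [QuaternionAlgebra.algebraMap_eq] <;> ring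

theorem star_mul_eq (x : QOrd u π) : star x * x =
    algebraMap 𝒪[k] (QOrd u π)
      (x.re ^ 2 - u * x.imI ^ 2 - π * (x.imJ ^ 2 - u * x.imK ^ 2)) := by
  ext <;> simp [QuaternionAlgebra.algebraMap_eq] <;> ring

theorem eq_algebraMap_of_star_eq [CharZero k] {x : QOrd u π} (hx : star x = x) :
    x = algebraMap 𝒪[k] (QOrd u π) x.re := by
  have key (a : 𝒪[k]) (ha : -a = a) : a = 0 := by
    have h1 : (a : k) + a = 0 := by
      have := congrArg (Subtype.val : 𝒪[k] → k) ha
      push_cast at this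
      linear_combination -this
    exact Subtype.ext (by simpa using h1)
  have h1 := congrArg QuaternionAlgebra.imI hx
  have h2 := congrArg QuaternionAlgebra.imJ hx
  have h3 := congrArg QuaternionAlgebra.imK hx
  simp only [QuaternionAlgebra.imI_star, QuaternionAlgebra.imJ_star,
    QuaternionAlgebra.imK_star] at h1 h2 h3
  ext <;> simp [QuaternionAlgebra.algebraMap_eq, key _ h1, key _ h2, key _ h3]

section

variable [ProperSpace k] [h : StandardPair u π]

theorem isUnit_iff_not_mem {x : QOrd u π} : IsUnit x ↔ x ∉ idealPow u π 1 := by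
  constructor
  · rintro ⟨x, rfl⟩ hx
    have : (1 : QOrd u π) ∈ idealPow u π 1 := by
      rw [← x.mul_inv]; exact mul_mem_idealPow_left hx _
    rw [mem_idealPow_iff] at this
    have h1 : π ∣ 1 := by simpa using this.1.1
    exact h.irreducible.not_isUnit (isUnit_of_dvd_one h1)
  · intro hx
    have hN : IsUnit (x.re ^ 2 - u * x.imI ^ 2 - π * (x.imJ ^ 2 - u * x.imK ^ 2)) := by
      rw [isUnit_iff u π]
      intro hd
      have := dvd_of_dvd_norm u π ((dvd_sub_left (dvd_mul_right π _)).mp hd)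
      exact hx (mem_idealPow_iff.2 (by simpa using this))
    obtain ⟨d, hd⟩ := hN.exists_right_inv
    refine ⟨⟨x, star x * algebraMap _ _ d, ?_, ?_⟩, rfl⟩
    · rw [← mul_assoc, mul_star_eq, ← map_mul, hd, map_one]
    · rw [mul_assoc, algebraMap_comm, ← mul_assoc, star_mul_eq, ← map_mul, hd, map_one]

theorem primeElt_mul_cancel {x y : QOrd u π} (hxy : primeElt u π * x = primeElt u π * y) :
    x = y := by
  have hπ := pi_ne_zero u π
  rw [primeElt_mul, primeElt_mul] at hxy
  simp only [QuaternionAlgebra.mk.injEq, mul_eq_mul_left_iff, hπ, or_false, neg_inj] at hxy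
  ext1 <;> tauto

theorem primeElt_pow_mul_cancel (r : ℕ) {x y : QOrd u π}
    (hxy : primeElt u π ^ r * x = primeElt u π ^ r * y) : x = y := by
  induction r with
  | zero => simpa using hxy
  | succ r ih =>
    rw [pow_succ', mul_assoc, mul_assoc] at hxy
    exact ih (primeElt_mul_cancel hxy)

theorem primeElt_pow_mul_mem_iff {r s : ℕ} {x : QOrd u π} :
    primeElt u π ^ r * x ∈ idealPow u π (r + s) ↔ x ∈ idealPow u π s := by
  constructor
  · intro hx
    obtain ⟨y, hy⟩ := mem_idealPow.1 hx
    rw [pow_add, mul_assoc] at hy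
    exact mem_idealPow.2 ⟨y, primeElt_pow_mul_cancel r hy⟩
  · exact fun hx => mul_mem_idealPow (primeElt_pow_mem r) hx

theorem primeElt_pow_mul_mem_iff' {r s : ℕ} {x : QOrd u π} :
    primeElt u π ^ r * x ∈ idealPow u π s ↔ x ∈ idealPow u π (s - r) := by
  rcases le_total r s with hrs | hrs
  · obtain ⟨t, rfl⟩ := Nat.exists_eq_add_of_le hrs
    rw [primeElt_pow_mul_mem_iff, Nat.add_sub_cancel_left]
  · rw [Nat.sub_eq_zero_of_le hrs, idealPow_zero]
    simp only [AddSubgroup.mem_top, iff_true]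
    exact idealPow_anti hrs (mul_mem_idealPow_left (primeElt_pow_mem r) _)

theorem exists_not_mem_idealPow {x : QOrd u π} (hx : x ≠ 0) : ∃ r, x ∉ idealPow u π r := by
  by_contra! hall
  refine hx ?_
  have key (a : 𝒪[k]) (ha : ∀ n, π ^ n ∣ a) : a = 0 := by
    by_contra h0
    obtain ⟨n, hn⟩ := exists_not_pow_dvd u π h0
    exact hn (ha n)
  have hall' (n : ℕ) := mem_idealPow_iff.1 (hall (2 * n))
  have e1 (n : ℕ) : (2 * n + 1) / 2 = n := by omega
  have e2 (n : ℕ) : (2 * n) / 2 = n := by omega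
  simp only [e1, e2] at hall'
  ext1
  · exact key _ fun n => (hall' n).1.1
  · exact key _ fun n => (hall' n).1.2
  · exact key _ fun n => (hall' n).2.1
  · exact key _ fun n => (hall' n).2.2

theorem exists_unit_of_mem {r : ℕ} {x : QOrd u π} (hx : x ∈ idealPow u π r)
    (hx' : x ∉ idealPow u π (r + 1)) : ∃ c : (QOrd u π)ˣ, x = c * primeElt u π ^ r := by
  obtain ⟨y, rfl⟩ := mem_idealPow_left.1 hx
  have hy : IsUnit y := by
    rw [isUnit_iff_not_mem]
    intro hy
    refine hx' ?_
    rw [add_comm]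
    exact mul_mem_idealPow hy (primeElt_pow_mem r)
  exact ⟨hy.unit, rfl⟩

/-- A self-adjoint element of an odd power of `P` lies in the next power. -/
theorem mem_idealPow_succ_of_star_eq [CharZero k] {e : ℕ} {x : QOrd u π} (hx : star x = x)
    (hxm : x ∈ idealPow u π (2 * e + 1)) : x ∈ idealPow u π (2 * e + 2) := by
  rw [eq_algebraMap_of_star_eq hx] at hxm ⊢
  rw [mem_idealPow_iff] at hxm ⊢
  have e1 : (2 * e + 1 + 1) / 2 = e + 1 := by omega
  have e2 : (2 * e + 2 + 1) / 2 = e + 1 := by omega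
  rw [e1] at hxm
  rw [e2]
  simpa [QuaternionAlgebra.algebraMap_eq] using hxm

theorem exists_mul_star_eq {v : 𝒪[k]} (hv : IsUnit v) :
    ∃ c : (QOrd u π)ˣ, (c : QOrd u π) * star (c : QOrd u π) = algebraMap 𝒪[k] (QOrd u π) v := by
  obtain ⟨a, b, hab⟩ := exists_norm_eq u π hv
  set x : QOrd u π := ⟨a, b, 0, 0⟩
  have hx : x * star x = algebraMap 𝒪[k] (QOrd u π) v := by
    rw [mul_star_eq, ← hab]; simp [x]
  have hx' : star x * x = algebraMap 𝒪[k] (QOrd u π) v := by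
    rw [star_mul_eq, ← hab]; simp [x]
  obtain ⟨d, hd⟩ := hv.exists_right_inv
  refine ⟨⟨x, star x * algebraMap _ _ d, ?_, ?_⟩, hx⟩
  · rw [← mul_assoc, hx, ← map_mul, hd, map_one]
  · rw [mul_assoc, algebraMap_comm, ← mul_assoc, hx', ← map_mul, hd, map_one]

/-- The index of `P` is `q ^ 2`. -/
theorem index_idealPow_one : (idealPow u π 1).index = resCard k ^ 2 := by
  let f : QOrd u π →+ 𝓀[k] × 𝓀[k] :=
    { toFun := fun x => (IsLocalRing.residue 𝒪[k] x.re, IsLocalRing.residue 𝒪[k] x.imI)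
      map_zero' := by simp
      map_add' := by intro x y; simp }
  have hk : idealPow u π 1 = f.ker := by
    ext x
    rw [mem_idealPow_iff, AddMonoidHom.mem_ker]
    simp [f, residue_eq_zero_iff u π]
  have hs : Function.Surjective f := by
    rintro ⟨a, b⟩
    obtain ⟨a, rfl⟩ := IsLocalRing.residue_surjective a
    obtain ⟨b, rfl⟩ := IsLocalRing.residue_surjective b
    exact ⟨⟨a, b, 0, 0⟩, rfl⟩
  rw [hk, AddSubgroup.index_ker, AddMonoidHom.range_eq_top.mpr hs, resCard]
  simp [pow_two, Nat.card_prod]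

theorem index_idealPow (r : ℕ) : (idealPow u π r).index = resCard k ^ (2 * r) := by
  induction r with
  | zero => simp [idealPow_zero]
  | succ r ih =>
    have hm : idealPow u π (r + 1) =
        (idealPow u π r).map (AddMonoidHom.mulLeft (primeElt u π)) := by
      ext x
      simp only [AddSubgroup.mem_map, mem_idealPow, AddMonoidHom.coe_mulLeft, pow_succ']
      constructor
      · rintro ⟨y, rfl⟩; exact ⟨_, ⟨y, rfl⟩, by rw [mul_assoc]⟩
      · rintro ⟨_, ⟨y, rfl⟩, rfl⟩; exact ⟨y, by rw [mul_assoc]⟩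
    have h1 : (AddMonoidHom.mulLeft (primeElt u π)).range = idealPow u π 1 := by
      rw [idealPow, pow_one]
    rw [hm, AddSubgroup.index_map_of_injective _ (fun x y => primeElt_mul_cancel), ih, h1,
      index_idealPow_one]
    ring

end

end Order

end

section

/-! ### Congruence of matrices over a star ring -/

section Congruence

variable {R : Type*} [Ring R] [StarRing R]
variable {ι κ : Type*} [Fintype ι] [DecidableEq ι] [Fintype κ] [DecidableEq κ]

/-- Two square matrices are congruent if they are in the same orbit under `x ↦ g x gᴴ`. -/
def Cong (x y : Matrix ι ι R) : Prop :=
  ∃ g : (Matrix ι ι R)ˣ, y = g.val * x * (g.val)ᴴ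

theorem Cong.refl (x : Matrix ι ι R) : Cong x x := ⟨1, by simp⟩

theorem Cong.symm {x y : Matrix ι ι R} (h : Cong x y) : Cong y x := by
  obtain ⟨g, rfl⟩ := h
  refine ⟨g⁻¹, ?_⟩
  have h1 : (g.val)ᴴ * ((g⁻¹).val)ᴴ = 1 := by
    rw [← Matrix.conjTranspose_mul, g.inv_mul, Matrix.conjTranspose_one]
  have h2 : (g⁻¹).val * g.val = 1 := g.inv_mul
  calc x = ((g⁻¹).val * g.val) * x * ((g.val)ᴴ * ((g⁻¹).val)ᴴ) := by rw [h1, h2]; simp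
    _ = _ := by simp only [Matrix.mul_assoc]

theorem Cong.trans {x y z : Matrix ι ι R} (h : Cong x y) (h' : Cong y z) : Cong x z := by
  obtain ⟨g, rfl⟩ := h
  obtain ⟨g', rfl⟩ := h'
  exact ⟨g' * g, by simp [Matrix.mul_assoc]⟩

theorem Cong.isHermitian {x y : Matrix ι ι R} (h : Cong x y) (hx : xᴴ = x) : yᴴ = y := by
  obtain ⟨g, rfl⟩ := h
  simp [hx, Matrix.mul_assoc]

theorem Cong.fromBlocks {x y : Matrix ι ι R} {z w : Matrix κ κ R} (h : Cong x y) (h' : Cong z w) :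
    Cong (Matrix.fromBlocks x 0 0 z) (Matrix.fromBlocks y 0 0 w) := by
  obtain ⟨g, rfl⟩ := h
  obtain ⟨g', rfl⟩ := h'
  refine ⟨⟨Matrix.fromBlocks g.val 0 0 g'.val, Matrix.fromBlocks (g⁻¹).val 0 0 (g'⁻¹).val, ?_, ?_⟩,
    ?_⟩
  · simp [Matrix.fromBlocks_multiply]
  · simp [Matrix.fromBlocks_multiply]
  · simp [Matrix.fromBlocks_multiply, Matrix.fromBlocks_conjTranspose]

theorem Cong.submatrix {x y : Matrix ι ι R} (h : Cong x y) (e : κ ≃ ι) :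
    Cong (x.submatrix e e) (y.submatrix e e) := by
  obtain ⟨g, rfl⟩ := h
  refine ⟨⟨g.val.submatrix e e, (g⁻¹).val.submatrix e e, ?_, ?_⟩, ?_⟩
  · rw [Matrix.submatrix_mul_equiv, g.mul_inv, Matrix.submatrix_one_equiv]
  · rw [Matrix.submatrix_mul_equiv, g.inv_mul, Matrix.submatrix_one_equiv]
  · rw [Matrix.conjTranspose_submatrix, Matrix.submatrix_mul_equiv, Matrix.submatrix_mul_equiv]

theorem cong_submatrix_perm (x : Matrix ι ι R) (σ : Equiv.Perm ι) : Cong x (x.submatrix σ σ) := by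
  refine ⟨⟨(1 : Matrix ι ι R).submatrix σ id, (1 : Matrix ι ι R).submatrix id σ, ?_, ?_⟩, ?_⟩
  · rw [Matrix.submatrix_mul _ _ _ _ _ Function.bijective_id |>.symm, Matrix.one_mul,
      Matrix.submatrix_one_equiv]
  · rw [Matrix.submatrix_mul_equiv, Matrix.one_mul, Matrix.submatrix_id_id]
  · ext i j
    simp [Matrix.mul_apply, Matrix.one_apply]

/-- Clearing the off-diagonal blocks against the lower right block. -/
theorem cong_clear (y : Matrix ι ι R) (A : Matrix κ κ R) (C : Matrix ι κ R) :
    Cong (Matrix.fromBlocks y (C * A) (A * Cᴴ) A)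
      (Matrix.fromBlocks (y - C * A * Cᴴ) 0 0 A) := by
  refine ⟨⟨Matrix.fromBlocks 1 (-C) 0 1, Matrix.fromBlocks 1 C 0 1, ?_, ?_⟩, ?_⟩
  · simp [Matrix.fromBlocks_multiply]
  · simp [Matrix.fromBlocks_multiply]
  · simp [Matrix.fromBlocks_multiply, Matrix.fromBlocks_conjTranspose, Matrix.mul_assoc,
      sub_eq_add_neg]

theorem cong_single_add (x : Matrix ι ι R) {i j : ι} (hij : i ≠ j) (c : R) :
    Cong x ((1 + Matrix.single i j c) * x * (1 + Matrix.single i j c)ᴴ) := by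
  have hs : Matrix.single i j c * Matrix.single i j c = (0 : Matrix ι ι R) :=
    Matrix.single_mul_single_of_ne _ _ _ _ (Ne.symm hij) _
  refine ⟨⟨1 + Matrix.single i j c, 1 - Matrix.single i j c, ?_, ?_⟩, rfl⟩
  · simp [add_mul, mul_sub, hs]
  · simp [sub_mul, mul_add, hs]

theorem cong_two_upper (a p q b c : R) :
    Cong !![a, p; q, b] !![a + c * q + p * star c + c * b * star c, p + c * b;
      q + b * star c, b] := by
  refine ⟨⟨!![1, c; 0, 1], !![1, -c; 0, 1], ?_, ?_⟩, ?_⟩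
  · ext i j; fin_cases i <;> fin_cases j <;> simp
  · ext i j; fin_cases i <;> fin_cases j <;> simp
  · ext i j; fin_cases i <;> fin_cases j <;> simp [Matrix.mul_apply, add_mul] <;> abel

theorem cong_two_lower (a p q b c : R) :
    Cong !![a, p; q, b] !![a, p + a * star c;
      q + c * a, b + c * p + q * star c + c * a * star c] := by
  refine ⟨⟨!![1, 0; c, 1], !![1, 0; -c, 1], ?_, ?_⟩, ?_⟩
  · ext i j; fin_cases i <;> fin_cases j <;> simp
  · ext i j; fin_cases i <;> fin_cases j <;> simp
  · ext i j; fin_cases i <;> fin_cases j <;> simp [Matrix.mul_apply, add_mul] <;> abel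

theorem cong_two_scale (a p q b : R) (c : Rˣ) :
    Cong !![a, p; q, b] !![c * a * star (c : R), c * p; q * star (c : R), b] := by
  refine ⟨⟨!![c, 0; 0, 1], !![(c⁻¹ : Rˣ), 0; 0, 1], ?_, ?_⟩, ?_⟩
  · ext i j; fin_cases i <;> fin_cases j <;> simp
  · ext i j; fin_cases i <;> fin_cases j <;> simp
  · ext i j; fin_cases i <;> fin_cases j <;> simp [Matrix.mul_apply]

theorem cong_one_scale (a : R) (c : Rˣ) :
    Cong !![a] !![c * a * star (c : R)] := by
  refine ⟨⟨!![(c : R)], !![((c⁻¹ : Rˣ) : R)], ?_, ?_⟩, ?_⟩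
  · ext i j; fin_cases i; fin_cases j; simp
  · ext i j; fin_cases i; fin_cases j; simp
  · ext i j; fin_cases i; fin_cases j; simp [Matrix.mul_apply]

/-- The orthogonal sum of two square matrices indexed by `Fin n` and `Fin p`. -/
def blockSum {S : Type*} [Zero S] {n p : ℕ} (x : Matrix (Fin n) (Fin n) S)
    (y : Matrix (Fin p) (Fin p) S) :
    Matrix (Fin (n + p)) (Fin (n + p)) S :=
  (Matrix.fromBlocks x 0 0 y).submatrix finSumFinEquiv.symm finSumFinEquiv.symm

theorem Cong.blockSum {n p : ℕ} {x x' : Matrix (Fin n) (Fin n) R} {y y' : Matrix (Fin p) (Fin p) R}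
    (h : Cong x x') (h' : Cong y y') : Cong (blockSum x y) (blockSum x' y') :=
  (h.fromBlocks h').submatrix _

/-- The matrix annihilates no nonzero vector. -/
def Nondeg (x : Matrix ι ι R) : Prop := ∀ v : ι → R, x.mulVec v = 0 → v = 0

theorem Cong.nondeg {x y : Matrix ι ι R} (h : Cong x y) (hx : Nondeg x) : Nondeg y := by
  obtain ⟨g, rfl⟩ := h
  intro v hv
  have h1 : (g⁻¹).val.mulVec ((g.val * x * (g.val)ᴴ).mulVec v) = 0 := by rw [hv]; simp
  rw [Matrix.mulVec_mulVec, ← Matrix.mul_assoc, ← Matrix.mul_assoc, g.inv_mul, Matrix.one_mul,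
    ← Matrix.mulVec_mulVec] at h1
  have h2 := congrArg (((g⁻¹).val)ᴴ.mulVec) (hx _ h1)
  rw [Matrix.mulVec_mulVec, ← Matrix.conjTranspose_mul, g.mul_inv] at h2
  simpa using h2

theorem nondeg_of_blockSum {n p : ℕ} {x : Matrix (Fin n) (Fin n) R} {y : Matrix (Fin p) (Fin p) R}
    (h : Nondeg (QuatHerm.blockSum x y)) : Nondeg x := by
  intro v hv
  have := h (Fin.append v 0) (by
    rw [QuatHerm.blockSum, Matrix.submatrix_mulVec_equiv]
    have : (Fin.append v (0 : Fin p → R)) ∘ finSumFinEquiv.symm.symm = Sum.elim v 0 := by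
      ext i; cases i <;> simp
    rw [this, Matrix.fromBlocks_mulVec]
    ext i
    rcases finSumFinEquiv.symm i with j | j <;>
      simp [show Sum.elim v (0 : Fin p → R) ∘ Sum.inl = v from rfl, hv])
  ext i
  have h1 := congrFun this (Fin.castAdd p i)
  simpa using h1

end Congruence

variable {k : Type*} [NontriviallyNormedField k] [IsUltrametricDist k]

/-! ### Elementary divisor sequences and their hermitian matrices -/

section PiMat

theorem mem_lambdaPlus {n : ℕ} {α : Fin n → ℕ} : α ∈ lambdaPlus n ↔
    Antitone α ∧ ∀ i, Odd (α i) → Even (Finset.univ.filter fun j => α j = α i).card := Iff.rfl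

theorem card_append {n p : ℕ} (α : Fin n → ℕ) (r v : ℕ) :
    (Finset.univ.filter fun j => Fin.append α (fun _ : Fin p => r) j = v).card =
      (Finset.univ.filter fun j => α j = v).card + if r = v then p else 0 := by
  rw [Finset.card_filter, Fin.sum_univ_add, Finset.card_filter]
  congr 1
  · simp
  · split_ifs with h <;> simp [h]

theorem antitone_append {n p : ℕ} [NeZero p] (α : Fin n → ℕ) (r : ℕ) :
    Antitone (Fin.append α (fun _ : Fin p => r)) ↔ Antitone α ∧ ∀ i, r ≤ α i := by
  constructor
  · intro h
    refine ⟨fun i j hij => ?_, fun i => ?_⟩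
    · simpa using h (show Fin.castAdd p i ≤ Fin.castAdd p j from hij)
    · simpa using h (show Fin.castAdd p i ≤ Fin.natAdd n (0 : Fin p) by
        rw [Fin.le_def]; simp)
  · rintro ⟨h, hr⟩ i j hij
    induction i using Fin.addCases with
    | left i =>
      induction j using Fin.addCases with
      | left j => simpa using h hij
      | right j => simpa using hr i
    | right i =>
      induction j using Fin.addCases with
      | left j => rw [Fin.le_def] at hij; simp at hij; omega
      | right j => simp

theorem append_even_mem {n : ℕ} (α : Fin n → ℕ) (e : ℕ) :
    Fin.append α (fun _ : Fin 1 => 2 * e) ∈ lambdaPlus (n + 1) ↔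
      α ∈ lambdaPlus n ∧ ∀ i, 2 * e ≤ α i := by
  simp only [mem_lambdaPlus, antitone_append, card_append]
  constructor
  · rintro ⟨⟨h1, h2⟩, h3⟩
    refine ⟨⟨h1, fun i hi => ?_⟩, h2⟩
    have := h3 (Fin.castAdd 1 i)
    rw [Fin.append_left] at this
    have h4 := this hi
    rwa [if_neg (by intro h; rw [← h] at hi; exact absurd hi (by simp)), add_zero] at h4
  · rintro ⟨⟨h1, h3⟩, h2⟩
    refine ⟨⟨h1, h2⟩, fun i hi => ?_⟩
    induction i using Fin.addCases with
    | left i =>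
      rw [Fin.append_left] at hi ⊢
      rw [if_neg (by intro h; rw [← h] at hi; exact absurd hi (by simp)), add_zero]
      exact h3 i hi
    | right i =>
      rw [Fin.append_right] at hi
      exact absurd hi (Nat.not_odd_iff_even.2 (even_two_mul e))

theorem append_odd_mem {n : ℕ} (α : Fin n → ℕ) (e : ℕ) :
    Fin.append α (fun _ : Fin 2 => 2 * e + 1) ∈ lambdaPlus (n + 2) ↔
      α ∈ lambdaPlus n ∧ ∀ i, 2 * e + 1 ≤ α i := by
  simp only [mem_lambdaPlus, antitone_append, card_append]
  have key (a : ℕ) (P : Prop) [Decidable P] : Even (a + if P then 2 else 0) ↔ Even a := by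
    split_ifs <;> simp [Nat.even_add]
  simp only [key]
  constructor
  · rintro ⟨⟨h1, h2⟩, h3⟩
    refine ⟨⟨h1, fun i hi => ?_⟩, h2⟩
    have := h3 (Fin.castAdd 2 i)
    rw [Fin.append_left] at this
    exact this hi
  · rintro ⟨⟨h1, h3⟩, h2⟩
    refine ⟨⟨h1, h2⟩, fun i hi => ?_⟩
    induction i using Fin.addCases with
    | left i =>
      rw [Fin.append_left] at hi ⊢
      exact h3 i hi
    | right i =>
      rw [Fin.append_right]
      by_cases hex : ∃ j, α j = 2 * e + 1
      · obtain ⟨j, hj⟩ := hex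
        have := h3 j (by rw [hj]; simp)
        rwa [hj] at this
      · push Not at hex
        rw [Finset.filter_false_of_mem (fun j _ => hex j)]
        simp

/-- Every sequence in `Λₙ⁺` arises from the empty one by appending single even terms and pairs of
equal odd terms. -/
theorem lambdaPlus_induction {motive : ∀ n, (Fin n → ℕ) → Prop}
    (nil : ∀ α : Fin 0 → ℕ, motive 0 α)
    (even : ∀ n (α : Fin n → ℕ) e, α ∈ lambdaPlus n → (∀ i, 2 * e ≤ α i) → motive n α →
      motive (n + 1) (Fin.append α fun _ => 2 * e))
    (odd : ∀ n (α : Fin n → ℕ) e, α ∈ lambdaPlus n → (∀ i, 2 * e + 1 ≤ α i) → motive n α →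
      motive (n + 2) (Fin.append α fun _ => 2 * e + 1)) :
    ∀ n (α : Fin n → ℕ), α ∈ lambdaPlus n → motive n α := by
  intro n
  induction n using Nat.strong_induction_on with
  | _ n ih =>
    intro α hα
    rcases n with _ | n
    · exact nil α
    · rcases Nat.even_or_odd' (α (Fin.last n)) with ⟨e, he | he⟩
      · have hα' : α = Fin.append (fun i => α (Fin.castAdd 1 i)) (fun _ : Fin 1 => 2 * e) := by
          ext i
          induction i using Fin.addCases with
          | left i => simp
          | right i =>
            rw [Fin.append_right, ← he, Subsingleton.elim i 0]; rfl
        rw [hα'] at hα ⊢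
        obtain ⟨h1, h2⟩ := (append_even_mem _ e).1 hα
        exact even n _ e h1 h2 (ih n (by omega) _ h1)
      · obtain ⟨j, hj, hjn⟩ : ∃ j, α j = 2 * e + 1 ∧ j ≠ Fin.last n := by
          by_contra! hall
          have h1 := hα.2 (Fin.last n) (by rw [he]; simp)
          rw [he] at h1
          have : (Finset.univ.filter fun j => α j = 2 * e + 1) = {Fin.last n} := by
            ext j
            simp only [Finset.mem_filter, Finset.mem_univ, true_and, Finset.mem_singleton]
            exact ⟨hall j, fun h => by rw [h, he]⟩
          rw [this] at h1
          simp at h1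
        rcases n with _ | n
        · exact absurd (Subsingleton.elim (α := Fin 1) _ _) hjn
        · have hpen : α (Fin.castSucc (Fin.last n)) = 2 * e + 1 := by
            have hjlt : j ≤ Fin.castSucc (Fin.last n) := by
              rw [Fin.le_def]
              have : (j : ℕ) ≠ n + 1 := fun h => hjn (Fin.ext h)
              have := j.isLt
              simp; omega
            have h1 := hα.1 hjlt
            have h2 := hα.1 (Fin.castSucc_lt_last (Fin.last n)).le
            omega
          have hα' : α = Fin.append (fun i => α (Fin.castAdd 2 i)) (fun _ : Fin 2 => 2 * e + 1) := by
            refine funext fun i => Fin.addCases (m := n) (n := 2) (fun i => ?_) (fun i => ?_) i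
            · rw [Fin.append_left]
            · rw [Fin.append_right]
              fin_cases i
              · exact hpen
              · exact he
          rw [hα'] at hα ⊢
          obtain ⟨h1, h2⟩ := (append_odd_mem _ e).1 hα
          exact odd n _ e h1 h2 (ih n (by omega) _ h1)

theorem rankIn_append_left {n p : ℕ} (α : Fin n → ℕ) (r : ℕ) (i : Fin n) :
    rankIn (Fin.append α (fun _ : Fin p => r)) (Fin.castAdd p i) = rankIn α i := by
  rw [rankIn, rankIn, Finset.card_filter, Fin.sum_univ_add, Finset.card_filter]
  have h2 : ∀ j : Fin p, ¬ Fin.natAdd n j < Fin.castAdd p i := by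
    intro j; rw [Fin.lt_def]; simp; omega
  have h1 : ∀ j : Fin n, Fin.castAdd p j < Fin.castAdd p i ↔ j < i := fun j => Iff.rfl
  simp [h2, h1]

variable (u π : 𝒪[k])

theorem piMat_append_even {n : ℕ} (α : Fin n → ℕ) (e : ℕ) :
    piMat u π (Fin.append α fun _ : Fin 1 => 2 * e) =
      blockSum (piMat u π α) !![algebraMap 𝒪[k] (QOrd u π) (π ^ e)] := by
  ext1 i j
  have hne : ∀ i : Fin n, ¬ Even (α i) → ¬ α i = 2 * e := by
    intro i hi h; exact hi (by rw [h]; simp)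
  induction i using Fin.addCases with
  | left i =>
    induction j using Fin.addCases with
    | left j => simp [piMat, blockSum, rankIn_append_left]
    | right j =>
      have h1 : Fin.castAdd 1 i ≠ Fin.natAdd n j := by
        intro h; have := congrArg Fin.val h; simp at this; omega
      by_cases h : Even (α i)
      · simp [piMat, blockSum, h1, h]
      · simp [piMat, blockSum, h, hne i h]
  | right i =>
    induction j using Fin.addCases with
    | left j =>
      have h1 : Fin.natAdd n i ≠ Fin.castAdd 1 j := by
        intro h; have := congrArg Fin.val h; simp at this; omega
      simp [piMat, blockSum, h1]
    | right j =>
      rw [Subsingleton.elim i 0, Subsingleton.elim j 0]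
      simp [piMat, blockSum]

theorem piMat_append_odd {n : ℕ} (α : Fin n → ℕ) (e : ℕ) (hα : α ∈ lambdaPlus n) :
    piMat u π (Fin.append α fun _ : Fin 2 => 2 * e + 1) =
      blockSum (piMat u π α)
        !![0, algebraMap 𝒪[k] (QOrd u π) (π ^ e) * primeElt u π;
          -(algebraMap 𝒪[k] (QOrd u π) (π ^ e) * primeElt u π), 0] := by
  have hcard : Even (Finset.univ.filter fun j => α j = 2 * e + 1).card := by
    by_cases hex : ∃ j, α j = 2 * e + 1
    · obtain ⟨j, hj⟩ := hex
      have := hα.2 j (by rw [hj]; simp)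
      rwa [hj] at this
    · push Not at hex
      rw [Finset.filter_false_of_mem (fun j _ => hex j)]
      simp
  -- an entry next to the new block has odd rank, hence is already paired
  have hlast : ∀ i : Fin n, (i : ℕ) + 1 = n → α i = 2 * e + 1 → ¬ Even (rankIn α i) := by
    intro i hi hαi hev
    have : (Finset.univ.filter fun j => α j = 2 * e + 1) =
        insert i (Finset.univ.filter fun j => j < i ∧ α j = α i) := by
      ext j
      simp only [Finset.mem_filter, Finset.mem_univ, true_and, Finset.mem_insert, hαi]
      constructor
      · intro h
        by_cases hji : j = i
        · exact Or.inl hji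
        · refine Or.inr ⟨?_, h⟩
          have : (j : ℕ) ≠ i := fun h => hji (Fin.ext h)
          rw [Fin.lt_def]; omega
      · rintro (rfl | h)
        · exact hαi
        · exact h.2
    rw [this, Finset.card_insert_of_notMem (by simp)] at hcard
    rw [rankIn] at hev
    exact absurd hcard (by simp [Nat.even_add_one, hev])
  have hr0 : rankIn (Fin.append α fun _ : Fin 2 => 2 * e + 1) (Fin.natAdd n 0) =
      (Finset.univ.filter fun j => α j = 2 * e + 1).card := by
    rw [rankIn, Finset.card_filter, Fin.sum_univ_add, Finset.card_filter]
    have h1 : ∀ x : Fin n, Fin.castAdd 2 x < Fin.natAdd n 0 := by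
      intro x; rw [Fin.lt_def]; simp
    simp [h1]
  have hr1 : ¬ Even (rankIn (Fin.append α fun _ : Fin 2 => 2 * e + 1) (Fin.natAdd n 1)) := by
    have : rankIn (Fin.append α fun _ : Fin 2 => 2 * e + 1) (Fin.natAdd n 1) =
      (Finset.univ.filter fun j => α j = 2 * e + 1).card + 1 := by
      rw [rankIn, Finset.card_filter, Fin.sum_univ_add, Finset.card_filter]
      have h1 : ∀ x : Fin n, Fin.castAdd 2 x < Fin.natAdd n 1 := by
        intro x; rw [Fin.lt_def]; simp
      simp [h1]
    rw [this, Nat.even_add_one, not_not]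
    exact hcard
  have hdiv : (2 * e + 1) / 2 = e := by omega
  have hnev : ¬ Even (2 * e + 1) := by simp
  ext1 i j
  induction i using Fin.addCases with
  | left i =>
    induction j using Fin.addCases with
    | left j => simp [piMat, blockSum, rankIn_append_left]
    | right j =>
      have h1 : Fin.castAdd 2 i ≠ Fin.natAdd n j := by
        intro h; have := congrArg Fin.val h; simp at this; omega
      by_cases h : Even (α i)
      · simp [piMat, blockSum, h1, h]
      · have h2 : ¬ ((i : ℕ) = n + j + 1) := by omega
        have h3 : ¬ (α i = 2 * e + 1 ∧ n + (j : ℕ) = i + 1 ∧ Even (rankIn α i)) := by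
          rintro ⟨a, b, c⟩
          exact hlast i (by omega) a c
        simp [piMat, blockSum, h, rankIn_append_left, h2, h3]
  | right i =>
    induction j using Fin.addCases with
    | left j =>
      have h1 : ¬ (j : ℕ) = n + i + 1 := by omega
      have h3 : ¬ (2 * e + 1 = α j ∧ n + (i : ℕ) = j + 1 ∧ Even (rankIn α j)) := by
          rintro ⟨a, b, c⟩
          exact hlast j (by omega) a.symm c
      simp [piMat, blockSum, rankIn_append_left, h1, h3]
    | right j =>
      fin_cases i <;> fin_cases j <;>
        simp [piMat, blockSum, hr0, hr1, hcard, hdiv]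

end PiMat

end

section

variable {k : Type*} [NontriviallyNormedField k] [IsUltrametricDist k] {u π : 𝒪[k]}

/-! ### Reduction of hermitian matrices to the standard form -/

section Reduction

variable {ι κ : Type*} [Fintype ι] [DecidableEq ι] [Fintype κ] [DecidableEq κ]

/-- All entries of the matrix lie in `P ^ r`. -/
def EntriesIn {ι κ : Type*} (r : ℕ) (x : Matrix ι κ (QOrd u π)) : Prop :=
  ∀ i j, x i j ∈ idealPow u π r

theorem EntriesIn.mul_left {l : Type*} {r : ℕ} {x : Matrix ι κ (QOrd u π)} (hx : EntriesIn r x)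
    (a : Matrix l ι (QOrd u π)) : EntriesIn r (a * x) := fun i j => by
  rw [Matrix.mul_apply]
  exact idealPow_sum_mem _ fun t _ => mul_mem_idealPow_right (hx t j) _

theorem EntriesIn.mul_right {l : Type*} {r : ℕ} {x : Matrix ι κ (QOrd u π)} (hx : EntriesIn r x)
    (a : Matrix κ l (QOrd u π)) : EntriesIn r (x * a) := fun i j => by
  rw [Matrix.mul_apply]
  exact idealPow_sum_mem _ fun t _ => mul_mem_idealPow_left (hx i t) _

theorem EntriesIn.sub {r : ℕ} {x y : Matrix ι κ (QOrd u π)} (hx : EntriesIn r x)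
    (hy : EntriesIn r y) : EntriesIn r (x - y) := fun i j => AddSubgroup.sub_mem _ (hx i j) (hy i j)

theorem EntriesIn.add {r : ℕ} {x y : Matrix ι κ (QOrd u π)} (hx : EntriesIn r x)
    (hy : EntriesIn r y) : EntriesIn r (x + y) := fun i j => AddSubgroup.add_mem _ (hx i j) (hy i j)

theorem EntriesIn.conjTranspose {r : ℕ} {x : Matrix ι κ (QOrd u π)} (hx : EntriesIn r x) :
    EntriesIn r xᴴ := fun i j => star_mem_idealPow (hx j i)

theorem Cong.entriesIn {r : ℕ} {x y : Matrix ι ι (QOrd u π)} (h : Cong x y) (hx : EntriesIn r x) :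
    EntriesIn r y := by
  obtain ⟨g, rfl⟩ := h
  exact (hx.mul_left _).mul_right _

/-- Splitting off a block `A` congruent to the lower right block, provided the rows with entries in
`P ^ r` are multiples of `A`. -/
theorem exists_split {r : ℕ} {y : Matrix (ι ⊕ κ) (ι ⊕ κ) (QOrd u π)} (hy : yᴴ = y)
    (hr : EntriesIn r y) {A : Matrix κ κ (QOrd u π)} (hA : Cong y.toBlocks₂₂ A)
    (hdiv : ∀ x : κ → QOrd u π, (∀ j, x j ∈ idealPow u π r) → ∃ c, Matrix.vecMul c A = x) :
    ∃ y' : Matrix ι ι (QOrd u π), y'ᴴ = y' ∧ EntriesIn r y' ∧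
      Cong y (Matrix.fromBlocks y' 0 0 A) := by
  obtain ⟨g, rfl⟩ := hA
  set A := g.val * y.toBlocks₂₂ * (g.val)ᴴ with hAdef
  have hb := Matrix.fromBlocks_toBlocks y
  set Y := y.toBlocks₁₁
  set X := y.toBlocks₁₂
  have hherm : Yᴴ = Y ∧ y.toBlocks₂₁ = Xᴴ ∧ y.toBlocks₂₂ᴴ = y.toBlocks₂₂ := by
    refine ⟨?_, ?_, ?_⟩
    · ext1 i j; exact congrFun (congrFun hy (Sum.inl i)) (Sum.inl j)
    · ext1 i j; exact (congrFun (congrFun hy (Sum.inr i)) (Sum.inl j)).symm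
    · ext1 i j; exact congrFun (congrFun hy (Sum.inr i)) (Sum.inr j)
  have hA2 : Aᴴ = A := by
    simp [hAdef, hherm.2.2, Matrix.mul_assoc]
  have hX : EntriesIn r (X * (g.val)ᴴ) := EntriesIn.mul_right (fun i j => hr _ _) _
  choose C hC using fun i => hdiv ((X * (g.val)ᴴ) i) (hX i)
  have hCA : Matrix.of C * A = X * (g.val)ᴴ := by
    ext1 i j; exact congrFun (hC i) j
  have hCA' : A * (Matrix.of C)ᴴ = g.val * Xᴴ := by
    have := congrArg Matrix.conjTranspose hCA
    simpa [hA2] using this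
  have h1 : Cong y (Matrix.fromBlocks Y (Matrix.of C * A) (A * (Matrix.of C)ᴴ) A) := by
    refine ⟨⟨Matrix.fromBlocks 1 0 0 g.val, Matrix.fromBlocks 1 0 0 (g⁻¹).val, ?_, ?_⟩, ?_⟩
    · simp [Matrix.fromBlocks_multiply]
    · simp [Matrix.fromBlocks_multiply]
    · rw [← hb, hherm.2.1, hCA, hCA']
      simp [Matrix.fromBlocks_multiply, Matrix.fromBlocks_conjTranspose, hAdef]
  have h2 := h1.trans (cong_clear Y A (Matrix.of C))
  refine ⟨Y - Matrix.of C * A * (Matrix.of C)ᴴ, ?_, ?_, h2⟩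
  · simp [hherm.1, hA2, Matrix.mul_assoc]
  · rw [hCA]
    exact EntriesIn.sub (fun i j => hr _ _) (hX.mul_right _)

variable [ProperSpace k] [CharZero k] [h : StandardPair u π]

theorem cong_even_block {e : ℕ} {a : QOrd u π} (ha : star a = a) (ha1 : a ∈ idealPow u π (2 * e))
    (ha2 : a ∉ idealPow u π (2 * e + 1)) :
    Cong !![a] !![algebraMap 𝒪[k] (QOrd u π) (π ^ e)] := by
  have e1 : (2 * e + 1) / 2 = e := by omega
  have e2 : (2 * e + 1 + 1) / 2 = e + 1 := by omega
  have hre := eq_algebraMap_of_star_eq ha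
  obtain ⟨v, hv⟩ := (mem_idealPow_iff.1 ha1).1.1
  rw [e1] at hv
  have hvu : IsUnit v := by
    rw [isUnit_iff u π]
    rintro ⟨w, rfl⟩
    refine ha2 ?_
    rw [hre, mem_idealPow_iff, e2, hv]
    simp only [QuaternionAlgebra.algebraMap_eq, dvd_zero, and_true]
    exact ⟨w, by ring⟩
  obtain ⟨d, hd⟩ := hvu.exists_right_inv
  obtain ⟨c, hc⟩ := exists_mul_star_eq (u := u) (π := π)
    (IsUnit.of_mul_eq_one v (by rw [mul_comm]; exact hd))
  have := cong_one_scale a c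
  have hval : (c : QOrd u π) * a * star (c : QOrd u π) = algebraMap 𝒪[k] (QOrd u π) (π ^ e) := by
    rw [hre, ← algebraMap_comm, mul_assoc, hc, ← map_mul, hv, mul_assoc, hd, mul_one]
  rwa [hval] at this

theorem two_ext {R : Type*} {a a' b b' c c' d d' : R} (ha : a = a') (hb : b = b') (hc : c = c')
    (hd : d = d') : !![a, b; c, d] = !![a', b'; c', d'] := by
  rw [ha, hb, hc, hd]

theorem cong_odd_block {e : ℕ} {a p b : QOrd u π} (ha : star a = a) (hb : star b = b)
    (ha1 : a ∈ idealPow u π (2 * e + 1)) (hb1 : b ∈ idealPow u π (2 * e + 1))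
    (hp1 : p ∈ idealPow u π (2 * e + 1)) (hp2 : p ∉ idealPow u π (2 * e + 2)) :
    Cong !![a, p; star p, b] !![0, algebraMap 𝒪[k] (QOrd u π) (π ^ e) * primeElt u π;
          -(algebraMap 𝒪[k] (QOrd u π) (π ^ e) * primeElt u π), 0] := by
  have e1 : (2 * e + 1 + 1) / 2 = e + 1 := by omega
  obtain ⟨c, rfl⟩ := exists_unit_of_mem hp1 hp2
  have hP : primeElt u π ^ (2 * e + 1) = ⟨0, 0, π ^ e, 0⟩ := by
    rw [pow_succ, primeElt_pow_two_mul]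
    ext <;> simp [primeElt, QuaternionAlgebra.algebraMap_eq]
  have hP' : algebraMap 𝒪[k] (QOrd u π) (π ^ e) * primeElt u π = ⟨0, 0, π ^ e, 0⟩ := by
    ext <;> simp [primeElt, QuaternionAlgebra.algebraMap_eq]
  rw [hP, hP']
  -- normalize the off-diagonal entry
  have h1 := cong_two_scale a (c * ⟨0, 0, π ^ e, 0⟩) (star (c * ⟨0, 0, π ^ e, 0⟩ : QOrd u π)) b c⁻¹
  have hq : star ((c : QOrd u π) * ⟨0, 0, π ^ e, 0⟩ : QOrd u π) * star ((c⁻¹ : (QOrd u π)ˣ) : QOrd u π)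
      = ⟨0, 0, -π ^ e, 0⟩ := by
    rw [← star_mul, ← mul_assoc, c.inv_mul, one_mul]
    ext <;> simp
  rw [hq, ← mul_assoc, c.inv_mul, one_mul] at h1
  refine h1.trans ?_
  set a' := (c⁻¹ : (QOrd u π)ˣ).val * a * star (c⁻¹ : (QOrd u π)ˣ).val
  have ha' : star a' = a' := by simp [a', ha, mul_assoc]
  have ha1' : a' ∈ idealPow u π (2 * e + 1) :=
    mul_mem_idealPow_left (mul_mem_idealPow_right ha1 _) _
  clear_value a'
  rw [eq_algebraMap_of_star_eq ha', eq_algebraMap_of_star_eq hb]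
  obtain ⟨α, hα⟩ := (mem_idealPow_iff.1 ha1').1.1
  obtain ⟨β, hβ⟩ := (mem_idealPow_iff.1 hb1).1.1
  rw [hα, hβ, e1, QuaternionAlgebra.algebraMap_eq, QuaternionAlgebra.algebraMap_eq]
  -- a root of `2 t + π β t ^ 2 = α`
  obtain ⟨s, hs⟩ := exists_sq_eq_one_add u π (α * β)
  have h2u := isUnit_two u π
  have hnd (x y : 𝒪[k]) (hx : IsUnit x) : IsUnit (x + π * y) := by
    rw [isUnit_iff u π] at hx ⊢
    exact fun hd => hx ((dvd_add_left (dvd_mul_right π y)).mp hd)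
  obtain ⟨w, hw⟩ := (hnd 2 s h2u).exists_right_inv
  set t := α * w
  have ht : 2 * t + π * β * t ^ 2 = α := by
    linear_combination α * (1 + w * (1 + π * s) - w) * hw - α * w ^ 2 * hs
  have h2 := cong_two_upper (⟨π ^ (e + 1) * α, 0, 0, 0⟩ : QOrd u π) ⟨0, 0, π ^ e, 0⟩
    ⟨0, 0, -π ^ e, 0⟩ ⟨π ^ (e + 1) * β, 0, 0, 0⟩ ⟨0, 0, t, 0⟩
  refine h2.trans ?_
  obtain ⟨z, hz⟩ := (hnd 1 (t * β) isUnit_one).exists_right_inv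
  have hzu : IsUnit z := IsUnit.of_mul_eq_one _ (by rw [mul_comm]; exact hz)
  have hzu' : IsUnit (algebraMap 𝒪[k] (QOrd u π) z) := hzu.map _
  have h3 := cong_two_scale (0 : QOrd u π) ⟨0, 0, π ^ e * (1 + π * (t * β)), 0⟩
    ⟨0, 0, -(π ^ e * (1 + π * (t * β))), 0⟩ ⟨π ^ (e + 1) * β, 0, 0, 0⟩ hzu'.unit
  have g2 : (!![(⟨π ^ (e + 1) * α, 0, 0, 0⟩ : QOrd u π) + ⟨0, 0, t, 0⟩ * ⟨0, 0, -π ^ e, 0⟩ +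
        ⟨0, 0, π ^ e, 0⟩ * star ⟨0, 0, t, 0⟩ +
        ⟨0, 0, t, 0⟩ * ⟨π ^ (e + 1) * β, 0, 0, 0⟩ * star ⟨0, 0, t, 0⟩,
      ⟨0, 0, π ^ e, 0⟩ + ⟨0, 0, t, 0⟩ * ⟨π ^ (e + 1) * β, 0, 0, 0⟩;
      ⟨0, 0, -π ^ e, 0⟩ + ⟨π ^ (e + 1) * β, 0, 0, 0⟩ * star ⟨0, 0, t, 0⟩,
      ⟨π ^ (e + 1) * β, 0, 0, 0⟩] : Matrix (Fin 2) (Fin 2) (QOrd u π)) =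
      !![(0 : QOrd u π), ⟨0, 0, π ^ e * (1 + π * (t * β)), 0⟩;
        ⟨0, 0, -(π ^ e * (1 + π * (t * β))), 0⟩, ⟨π ^ (e + 1) * β, 0, 0, 0⟩] := by
    congr 2
    · congr 1
      · rw [QuaternionAlgebra.ext_iff]
        simp
        linear_combination -π ^ (e + 1) * ht
      · congr 1
        rw [QuaternionAlgebra.ext_iff]
        simp
        ring
    · congr 2
      rw [QuaternionAlgebra.ext_iff]
      simp
      ring
  rw [g2]
  refine h3.trans ?_
  obtain ⟨d, hd⟩ := h2u.exists_right_inv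
  have h4 := cong_two_lower (0 : QOrd u π) ⟨0, 0, π ^ e, 0⟩
    ⟨0, 0, -π ^ e, 0⟩ ⟨π ^ (e + 1) * β, 0, 0, 0⟩ ⟨0, 0, -(d * β), 0⟩
  have g3 : (!![(hzu'.unit : QOrd u π) * 0 * star (hzu'.unit : QOrd u π),
      (hzu'.unit : QOrd u π) * ⟨0, 0, π ^ e * (1 + π * (t * β)), 0⟩;
      ⟨0, 0, -(π ^ e * (1 + π * (t * β))), 0⟩ * star (hzu'.unit : QOrd u π),
      ⟨π ^ (e + 1) * β, 0, 0, 0⟩] : Matrix (Fin 2) (Fin 2) (QOrd u π)) =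
      !![(0 : QOrd u π), ⟨0, 0, π ^ e, 0⟩; ⟨0, 0, -π ^ e, 0⟩, ⟨π ^ (e + 1) * β, 0, 0, 0⟩] := by
    rw [IsUnit.unit_spec, QuaternionAlgebra.algebraMap_eq]
    congr 2
    · congr 1
      · simp
      · congr 1
        rw [QuaternionAlgebra.ext_iff]
        simp
        linear_combination π ^ e * hz
    · congr 2
      rw [QuaternionAlgebra.ext_iff]
      simp
      linear_combination π ^ e * hz
  rw [g3]
  refine h4.trans ?_
  have g4 : (!![(0 : QOrd u π), ⟨0, 0, π ^ e, 0⟩ + 0 * star ⟨0, 0, -(d * β), 0⟩;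
      ⟨0, 0, -π ^ e, 0⟩ + ⟨0, 0, -(d * β), 0⟩ * 0,
      ⟨π ^ (e + 1) * β, 0, 0, 0⟩ + ⟨0, 0, -(d * β), 0⟩ * ⟨0, 0, π ^ e, 0⟩ +
        ⟨0, 0, -π ^ e, 0⟩ * star ⟨0, 0, -(d * β), 0⟩ +
        ⟨0, 0, -(d * β), 0⟩ * 0 * star ⟨0, 0, -(d * β), 0⟩] : Matrix (Fin 2) (Fin 2) (QOrd u π)) =
      !![(0 : QOrd u π), ⟨0, 0, π ^ e, 0⟩; -⟨0, 0, π ^ e, 0⟩, 0] := by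
    refine two_ext rfl (by simp) (by ext <;> simp) ?_
    rw [QuaternionAlgebra.ext_iff]
    simp
    linear_combination -π ^ (e + 1) * β * hd
  rw [g4]
  exact Cong.refl _

end Reduction

end

section

variable {k : Type*} [NontriviallyNormedField k] [IsUltrametricDist k] {u π : 𝒪[k]}

/-! ### Existence of the standard form -/

section Existence

variable [ProperSpace k] [CharZero k] [h : StandardPair u π]

theorem exists_cong_blockSum_even {n e : ℕ} {y : Matrix (Fin (n + 1)) (Fin (n + 1)) (QOrd u π)}
    (hy : yᴴ = y) (hr : EntriesIn (2 * e) y) {i : Fin (n + 1)}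
    (hi : y i i ∉ idealPow u π (2 * e + 1)) :
    ∃ y' : Matrix (Fin n) (Fin n) (QOrd u π), y'ᴴ = y' ∧ EntriesIn (2 * e) y' ∧
      Cong y (blockSum y' !![algebraMap 𝒪[k] (QOrd u π) (π ^ e)]) := by
  have hσ := cong_submatrix_perm y (Equiv.swap i (Fin.natAdd n (0 : Fin 1)))
  set z := y.submatrix (Equiv.swap i (Fin.natAdd n (0 : Fin 1)))
    (Equiv.swap i (Fin.natAdd n (0 : Fin 1))) with hz
  have hzi : z (Fin.natAdd n 0) (Fin.natAdd n 0) = y i i := by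
    simp only [hz, Matrix.submatrix_apply, Equiv.swap_apply_right]
  have hzr := hσ.entriesIn hr
  have hzh := hσ.isHermitian hy
  set w := z.submatrix finSumFinEquiv finSumFinEquiv with hw
  have hwz : w.submatrix finSumFinEquiv.symm finSumFinEquiv.symm = z := by
    rw [hw]; simp
  have hblock : w.toBlocks₂₂ = !![y i i] := by
    ext1 a b
    rw [Subsingleton.elim a 0, Subsingleton.elim b 0]
    simpa [Matrix.toBlocks₂₂, hw] using hzi
  have hst : star (y i i) = y i i := congrFun (congrFun hy i) i
  obtain ⟨y', h1, h2, h3⟩ := exists_split (r := 2 * e) (y := w) (by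
      rw [hw, Matrix.conjTranspose_submatrix, hzh]) (fun a b => hzr _ _)
      (A := !![algebraMap 𝒪[k] (QOrd u π) (π ^ e)])
      (by rw [hblock]; exact cong_even_block hst (hr i i) hi) (by
        intro x hx
        obtain ⟨c, hc⟩ := mem_idealPow_left.1 (hx 0)
        rw [primeElt_pow_two_mul] at hc
        refine ⟨fun _ => c, ?_⟩
        funext j
        rw [Subsingleton.elim j 0]
        simpa [Matrix.vecMul, dotProduct] using hc)
  refine ⟨y', h1, h2, hσ.trans ?_⟩
  rw [← hwz]
  exact h3.submatrix _

theorem exists_cong_blockSum_odd {n e : ℕ} {y : Matrix (Fin (n + 2)) (Fin (n + 2)) (QOrd u π)}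
    (hy : yᴴ = y) (hr : EntriesIn (2 * e + 1) y) {i j : Fin (n + 2)} (hne : i ≠ j)
    (hij : y i j ∉ idealPow u π (2 * e + 2)) :
    ∃ y' : Matrix (Fin n) (Fin n) (QOrd u π), y'ᴴ = y' ∧ EntriesIn (2 * e + 1) y' ∧
      Cong y (blockSum y' !![0, algebraMap 𝒪[k] (QOrd u π) (π ^ e) * primeElt u π;
          -(algebraMap 𝒪[k] (QOrd u π) (π ^ e) * primeElt u π), 0]) := by
  -- a permutation that moves the pivot to the last two positions
  obtain ⟨σ, hσ0, hσ1⟩ : ∃ σ : Equiv.Perm (Fin (n + 2)), σ (Fin.natAdd n (0 : Fin 2)) = i ∧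
      σ (Fin.natAdd n (1 : Fin 2)) = j := by
    set a : Fin (n + 2) := Fin.natAdd n (0 : Fin 2)
    set b : Fin (n + 2) := Fin.natAdd n (1 : Fin 2)
    have hab : a ≠ b := by
      intro hab; have := congrArg Fin.val hab; simp [a, b] at this
    set τ := Equiv.swap b j
    have hτ : τ b = j := Equiv.swap_apply_left b j
    refine ⟨(Equiv.swap a (τ.symm i)).trans τ, ?_, ?_⟩
    · simp
    · have h1 : τ.symm i ≠ b := by
        intro h1; rw [← h1] at hτ; simp at hτ; exact hne hτ
      rw [Equiv.trans_apply, Equiv.swap_apply_of_ne_of_ne hab.symm h1.symm, hτ]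
  have hσ := cong_submatrix_perm y σ
  set z := y.submatrix σ σ with hz
  have hzr := hσ.entriesIn hr
  have hzh := hσ.isHermitian hy
  set w := z.submatrix finSumFinEquiv finSumFinEquiv with hw
  have hwz : w.submatrix finSumFinEquiv.symm finSumFinEquiv.symm = z := by
    rw [hw]; simp
  have hst (a b) : star (y a b) = y b a := congrFun (congrFun hy b) a
  have hblock : w.toBlocks₂₂ = !![y i i, y i j; star (y i j), y j j] := by
    rw [hst]
    ext1 a b
    fin_cases a <;> fin_cases b <;> simp [Matrix.toBlocks₂₂, hw, hz, hσ0, hσ1]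
  obtain ⟨y', h1, h2, h3⟩ := exists_split (r := 2 * e + 1) (y := w) (by
      rw [hw, Matrix.conjTranspose_submatrix, hzh]) (fun a b => hzr _ _)
      (A := !![0, algebraMap 𝒪[k] (QOrd u π) (π ^ e) * primeElt u π;
          -(algebraMap 𝒪[k] (QOrd u π) (π ^ e) * primeElt u π), 0])
      (by rw [hblock]; exact cong_odd_block (hst i i) (hst j j) (hr i i) (hr j j) (hr i j) hij) (by
        intro x hx
        obtain ⟨c, hc⟩ := mem_idealPow_left.1 (hx 0)
        obtain ⟨d, hd⟩ := mem_idealPow_left.1 (hx 1)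
        rw [pow_succ, primeElt_pow_two_mul] at hc hd
        refine ⟨![d, -c], ?_⟩
        funext j
        fin_cases j
        · simpa [Matrix.vecMul, dotProduct, Fin.sum_univ_two] using hc
        · simpa [Matrix.vecMul, dotProduct, Fin.sum_univ_two] using hd)
  refine ⟨y', h1, h2, hσ.trans ?_⟩
  rw [← hwz]
  exact h3.submatrix _

/-- If the minimal valuation of the entries is even, it can be attained on the diagonal. -/
theorem exists_cong_diag {n e : ℕ} {y : Matrix (Fin n) (Fin n) (QOrd u π)}
    (hy : yᴴ = y) (hr : EntriesIn (2 * e) y) {i j : Fin n}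
    (hij : y i j ∉ idealPow u π (2 * e + 1)) :
    ∃ y' : Matrix (Fin n) (Fin n) (QOrd u π), Cong y y' ∧ ∃ l,
      y' l l ∉ idealPow u π (2 * e + 1) := by
  by_cases hd : ∃ l, y l l ∉ idealPow u π (2 * e + 1)
  · exact ⟨y, Cong.refl y, hd⟩
  push Not at hd
  have hne : i ≠ j := by rintro rfl; exact hij (hd i)
  obtain ⟨p, hp⟩ := exists_unit_of_mem (hr i j) hij
  have hst : star (y i j) = y j i := congrFun (congrFun hy j) i
  rw [primeElt_pow_two_mul] at hp
  set c : QOrd u π := star ((p⁻¹ : (QOrd u π)ˣ) : QOrd u π) with hc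
  have hpc : y i j * star c = algebraMap 𝒪[k] (QOrd u π) (π ^ e) := by
    rw [hp, hc, star_star, ← algebraMap_comm, mul_assoc, p.mul_inv, mul_one]
  have hcp : c * y j i = algebraMap 𝒪[k] (QOrd u π) (π ^ e) := by
    have := congrArg star hpc
    rwa [star_mul, star_star, star_algebraMap, hst] at this
  refine ⟨_, cong_single_add y hne c, i, ?_⟩
  have hval : ((1 + Matrix.single i j c : Matrix (Fin n) (Fin n) (QOrd u π)) * y *
        (1 + Matrix.single i j c : Matrix (Fin n) (Fin n) (QOrd u π))ᴴ) i i =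
      y i i + c * y j j * star c + algebraMap 𝒪[k] (QOrd u π) (2 * π ^ e) := by
    have : ((1 + Matrix.single i j c : Matrix (Fin n) (Fin n) (QOrd u π)) * y *
        (1 + Matrix.single i j c : Matrix (Fin n) (Fin n) (QOrd u π))ᴴ) i i =
      y i i + c * y j i + (y i j * star c + c * y j j * star c) := by
      simp [Matrix.mul_add, add_mul]
      abel
    rw [this, hpc, hcp, two_mul, map_add]
    abel
  rw [hval]
  intro hmem
  have h1 : y i i + c * y j j * star c ∈ idealPow u π (2 * e + 1) :=
    AddSubgroup.add_mem _ (hd i) (mul_mem_idealPow_left (mul_mem_idealPow_right (hd j) _) _)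
  have h2 := (AddSubgroup.add_mem_cancel_left _ h1).1 hmem
  rw [mem_idealPow_iff, QuaternionAlgebra.algebraMap_eq] at h2
  have e2 : (2 * e + 1 + 1) / 2 = e + 1 := by omega
  have h3 := h2.1.1
  rw [e2, pow_succ', mul_dvd_mul_iff_right (pow_ne_zero e (pi_ne_zero u π))] at h3
  exact (isUnit_iff u π).1 (isUnit_two u π) h3

/-- Every nondegenerate hermitian matrix over the maximal order is congruent to a standard one. -/
theorem exists_cong_piMat (n : ℕ) : ∀ (r : ℕ) (y : Matrix (Fin n) (Fin n) (QOrd u π)), yᴴ = y →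
    Nondeg y → EntriesIn r y →
    ∃ α ∈ lambdaPlus n, (∀ i, r ≤ α i) ∧ Cong (piMat u π α) y := by
  induction n using Nat.strong_induction_on with
  | _ n ih =>
    intro r y hy hnd hr
    rcases Nat.eq_zero_or_pos n with rfl | hn
    · refine ⟨Fin.elim0, ⟨fun i => i.elim0, fun i => i.elim0⟩, fun i => i.elim0, ?_⟩
      rw [Subsingleton.elim y (piMat u π Fin.elim0)]
      exact Cong.refl _
    -- the minimal valuation of the entries
    have hex : ∃ s, ¬ EntriesIn s y := by
      by_contra! hall
      have h0 : y = 0 := by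
        ext1 i j
        by_contra hne
        obtain ⟨s, hs⟩ := exists_not_mem_idealPow hne
        exact hs (hall s i j)
      have := hnd (fun _ => 1) (by rw [h0]; simp)
      exact one_ne_zero (congrFun this ⟨0, hn⟩)
    classical
    obtain ⟨s, hs, hs'⟩ : ∃ s, EntriesIn s y ∧ ¬ EntriesIn (s + 1) y := by
      have hmin := Nat.find_spec hex
      have hpos : Nat.find hex ≠ 0 := by
        intro h0
        rw [h0] at hmin
        exact hmin fun i j => by rw [idealPow_zero]; trivial
      obtain ⟨s, hs⟩ := Nat.exists_eq_succ_of_ne_zero hpos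
      refine ⟨s, ?_, by rwa [hs] at hmin⟩
      have := Nat.find_min hex (m := s) (by omega)
      exact not_not.1 this
    have hrs : r ≤ s := by
      by_contra hlt
      exact hs' fun i j => idealPow_anti (by omega) (hr i j)
    rw [EntriesIn] at hs'
    push Not at hs'
    obtain ⟨i, j, hij⟩ := hs'
    rcases Nat.even_or_odd' s with ⟨e, rfl | rfl⟩
    · obtain ⟨n, rfl⟩ : ∃ n', n = n' + 1 := ⟨n - 1, by omega⟩
      obtain ⟨z, hyz, l, hl⟩ := exists_cong_diag hy hs hij
      obtain ⟨y', h1, h2, h3⟩ := exists_cong_blockSum_even (hyz.isHermitian hy) (hyz.entriesIn hs) hl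
      have h4 := hyz.trans h3
      obtain ⟨α, hα, hα', hc⟩ := ih n (by omega) (2 * e) y' h1 (nondeg_of_blockSum (h4.nondeg hnd)) h2
      refine ⟨Fin.append α fun _ => 2 * e, (append_even_mem α e).2 ⟨hα, hα'⟩, ?_, ?_⟩
      · refine Fin.addCases (m := n) (n := 1) (fun i => ?_) (fun i => ?_)
        · rw [Fin.append_left]; exact hrs.trans (hα' i)
        · rw [Fin.append_right]; exact hrs
      · rw [piMat_append_even]
        exact (hc.blockSum (Cong.refl _)).trans h4.symm
    · have hne : i ≠ j := by
        rintro rfl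
        exact hij (mem_idealPow_succ_of_star_eq (congrFun (congrFun hy i) i) (hs i i))
      obtain ⟨n, rfl⟩ : ∃ n', n = n' + 2 := ⟨n - 2, by
        have h1 := i.isLt
        have h2 := j.isLt
        have h3 : (i : ℕ) ≠ j := fun hh => hne (Fin.ext hh)
        omega⟩
      obtain ⟨y', h1, h2, h3⟩ := exists_cong_blockSum_odd hy hs hne hij
      obtain ⟨α, hα, hα', hc⟩ := ih n (by omega) (2 * e + 1) y' h1
        (nondeg_of_blockSum (h3.nondeg hnd)) h2
      refine ⟨Fin.append α fun _ => 2 * e + 1, (append_odd_mem α e).2 ⟨hα, hα'⟩, ?_, ?_⟩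
      · refine Fin.addCases (m := n) (n := 2) (fun i => ?_) (fun i => ?_)
        · rw [Fin.append_left]; exact hrs.trans (hα' i)
        · rw [Fin.append_right]; exact hrs
      · rw [piMat_append_odd u π α e hα]
        exact (hc.blockSum (Cong.refl _)).trans h3.symm

end Existence

/-! ### Elementary divisors: uniqueness and openness of the orbits -/

section Uniqueness

/-- The vectors that `y` maps into `P ^ r`. Its index depends only on the congruence class of `y`,
and its definition only on `y` modulo `P ^ r`. -/
def kerMod {n : ℕ} (r : ℕ) (y : Matrix (Fin n) (Fin n) (QOrd u π)) :
    AddSubgroup (Fin n → QOrd u π) where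
  carrier := {v | ∀ i, y.mulVec v i ∈ idealPow u π r}
  zero_mem' := by intro i; simp
  add_mem' := by
    intro a b ha hb i
    rw [Matrix.mulVec_add]
    exact AddSubgroup.add_mem _ (ha i) (hb i)
  neg_mem' := by
    intro a ha i
    rw [Matrix.mulVec_neg]
    exact AddSubgroup.neg_mem _ (ha i)

theorem mem_kerMod {n r : ℕ} {y : Matrix (Fin n) (Fin n) (QOrd u π)} {v : Fin n → QOrd u π} :
    v ∈ kerMod r y ↔ ∀ i, y.mulVec v i ∈ idealPow u π r := Iff.rfl

theorem mulVec_mem_idealPow {r : ℕ} {ι κ : Type*} [Fintype κ] (A : Matrix ι κ (QOrd u π))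
    {v : κ → QOrd u π} (hv : ∀ i, v i ∈ idealPow u π r) (i : ι) :
    A.mulVec v i ∈ idealPow u π r :=
  idealPow_sum_mem _ fun j _ => mul_mem_idealPow_right (hv j) _

theorem mulVec_mem_idealPow' {r : ℕ} {ι κ : Type*} [Fintype κ] {A : Matrix ι κ (QOrd u π)}
    (hA : ∀ i j, A i j ∈ idealPow u π r) (v : κ → QOrd u π) (i : ι) :
    A.mulVec v i ∈ idealPow u π r :=
  idealPow_sum_mem _ fun j _ => mul_mem_idealPow_left (hA i j) _

theorem kerMod_congr {n r : ℕ} {y z : Matrix (Fin n) (Fin n) (QOrd u π)}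
    (hyz : EntriesIn r (z - y)) : kerMod r y = kerMod r z := by
  ext v
  rw [mem_kerMod, mem_kerMod]
  have : z.mulVec v = y.mulVec v + (z - y).mulVec v := by
    rw [Matrix.sub_mulVec]; abel
  rw [this]
  refine forall_congr' fun i => ?_
  exact (AddSubgroup.add_mem_cancel_right _ (mulVec_mem_idealPow' hyz v i)).symm

theorem Cong.index_kerMod {n r : ℕ} {y z : Matrix (Fin n) (Fin n) (QOrd u π)} (h : Cong y z) :
    (kerMod r z).index = (kerMod r y).index := by
  obtain ⟨g, rfl⟩ := h
  let f : (Fin n → QOrd u π) →+ (Fin n → QOrd u π) :=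
    { toFun := fun v => (g.val)ᴴ.mulVec v
      map_zero' := by simp
      map_add' := fun v w => Matrix.mulVec_add _ _ _ }
  have hf : Function.Surjective f := by
    intro v
    refine ⟨((g⁻¹).val)ᴴ.mulVec v, ?_⟩
    change (g.val)ᴴ.mulVec (((g⁻¹).val)ᴴ.mulVec v) = v
    rw [Matrix.mulVec_mulVec, ← Matrix.conjTranspose_mul, g.inv_mul]
    simp
  rw [← AddSubgroup.index_comap_of_surjective (kerMod r y) hf]
  congr 1
  ext v
  rw [AddSubgroup.mem_comap, mem_kerMod, mem_kerMod]
  change _ ↔ ∀ i, y.mulVec ((g.val)ᴴ.mulVec v) i ∈ idealPow u π r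
  rw [← Matrix.mulVec_mulVec, ← Matrix.mulVec_mulVec]
  constructor
  · intro hv i
    have := mulVec_mem_idealPow (g⁻¹).val hv i
    rwa [Matrix.mulVec_mulVec, g.inv_mul, Matrix.one_mulVec] at this
  · exact fun hv i => mulVec_mem_idealPow g.val hv i

theorem blockSum_mulVec {R : Type*} [Ring R] {n p : ℕ} (x : Matrix (Fin n) (Fin n) R)
    (y : Matrix (Fin p) (Fin p) R) (v : Fin (n + p) → R) :
    (blockSum x y).mulVec v = Fin.append (x.mulVec fun i => v (Fin.castAdd p i))
      (y.mulVec fun i => v (Fin.natAdd n i)) := by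
  rw [blockSum, Matrix.submatrix_mulVec_equiv]
  have : v ∘ finSumFinEquiv.symm.symm = Sum.elim (fun i => v (Fin.castAdd p i))
      (fun i => v (Fin.natAdd n i)) := by
    ext1 i; cases i <;> simp
  rw [this, Matrix.fromBlocks_mulVec]
  ext1 i
  refine Fin.addCases (fun i => ?_) (fun i => ?_) i <;> simp

theorem kerMod_blockSum {n p r : ℕ} {x : Matrix (Fin n) (Fin n) (QOrd u π)}
    {y : Matrix (Fin p) (Fin p) (QOrd u π)} {v : Fin (n + p) → QOrd u π} :
    v ∈ kerMod r (blockSum x y) ↔ (fun i => v (Fin.castAdd p i)) ∈ kerMod r x ∧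
      (fun i => v (Fin.natAdd n i)) ∈ kerMod r y := by
  simp only [mem_kerMod, blockSum_mulVec]
  constructor
  · intro hv
    exact ⟨fun i => by simpa using hv (Fin.castAdd p i), fun i => by simpa using hv (Fin.natAdd n i)⟩
  · rintro ⟨h1, h2⟩ i
    refine Fin.addCases (fun i => ?_) (fun i => ?_) i
    · simpa using h1 i
    · simpa using h2 i

theorem conjTranspose_blockSum {R : Type*} [Ring R] [StarRing R] {n p : ℕ}
    (x : Matrix (Fin n) (Fin n) R) (y : Matrix (Fin p) (Fin p) R) :
    (blockSum x y)ᴴ = blockSum xᴴ yᴴ := by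
  rw [blockSum, Matrix.conjTranspose_submatrix, Matrix.fromBlocks_conjTranspose]
  simp [blockSum]

theorem conjTranspose_piMat {n : ℕ} {α : Fin n → ℕ} (hα : α ∈ lambdaPlus n) :
    (piMat u π α)ᴴ = piMat u π α := by
  refine lambdaPlus_induction (motive := fun n α => (piMat u π α)ᴴ = piMat u π α) ?_ ?_ ?_ n α hα
  · intro α; exact Subsingleton.elim _ _
  · intro n α e _ _ ih
    rw [piMat_append_even, conjTranspose_blockSum, ih]
    congr 1
    ext1 i j
    rw [Subsingleton.elim i 0, Subsingleton.elim j 0]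
    simp
  · intro n α e hα _ ih
    rw [piMat_append_odd u π α e hα, conjTranspose_blockSum, ih]
    congr 1
    have hs : star (algebraMap 𝒪[k] (QOrd u π) (π ^ e) * primeElt u π) =
        -(algebraMap 𝒪[k] (QOrd u π) (π ^ e) * primeElt u π) := by
      rw [star_mul, star_algebraMap, star_primeElt, neg_mul, algebraMap_comm]
    generalize algebraMap 𝒪[k] (QOrd u π) (π ^ e) * primeElt u π = p at hs
    ext1 i j
    fin_cases i <;> fin_cases j <;> simp [hs]

variable [ProperSpace k] [CharZero k] [h : StandardPair u π]

theorem mem_kerMod_piMat {n : ℕ} {α : Fin n → ℕ} (hα : α ∈ lambdaPlus n) (r : ℕ)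
    (v : Fin n → QOrd u π) :
    v ∈ kerMod r (piMat u π α) ↔ ∀ i, v i ∈ idealPow u π (r - α i) := by
  have hpow (e : ℕ) : algebraMap 𝒪[k] (QOrd u π) (π ^ e) * primeElt u π =
      primeElt u π ^ (2 * e + 1) := by rw [pow_succ, primeElt_pow_two_mul]
  refine lambdaPlus_induction (motive := fun n α => ∀ v : Fin n → QOrd u π,
    v ∈ kerMod r (piMat u π α) ↔ ∀ i, v i ∈ idealPow u π (r - α i)) ?_ ?_ ?_ n α hα v
  · intro α v
    exact ⟨fun _ i => i.elim0, fun _ i => i.elim0⟩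
  · intro n α e _ _ ih v
    rw [piMat_append_even, kerMod_blockSum, ih]
    rw [Fin.forall_fin_add]
    simp only [Fin.append_left, Fin.append_right]
    refine and_congr_right' ?_
    rw [mem_kerMod]
    simp only [Fin.forall_fin_one, Matrix.mulVec, dotProduct, Finset.univ_unique,
      Finset.sum_singleton]
    rw [← primeElt_pow_mul_mem_iff' (r := 2 * e), primeElt_pow_two_mul]
    rfl
  · intro n α e hα _ ih v
    rw [piMat_append_odd u π α e hα, kerMod_blockSum, ih]
    rw [Fin.forall_fin_add]
    simp only [Fin.append_left, Fin.append_right]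
    refine and_congr_right' ?_
    rw [mem_kerMod, hpow]
    simp only [Fin.forall_fin_two, ← primeElt_pow_mul_mem_iff' (r := 2 * e + 1)]
    rw [and_comm]
    refine and_congr ?_ ?_
    · simp [Matrix.mulVec, dotProduct, Fin.sum_univ_two]
    · simp [Matrix.mulVec, dotProduct, Fin.sum_univ_two]

theorem index_kerMod_piMat {n : ℕ} {α : Fin n → ℕ} (hα : α ∈ lambdaPlus n) (r : ℕ) :
    (kerMod r (piMat u π α)).index = resCard k ^ (2 * ∑ i, (r - α i)) := by
  have : kerMod r (piMat u π α) = AddSubgroup.pi Set.univ fun i => idealPow u π (r - α i) := by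
    ext v
    rw [mem_kerMod_piMat hα, AddSubgroup.mem_pi]
    simp
  rw [this, AddSubgroup.index_pi]
  simp only [index_idealPow]
  rw [Finset.prod_pow_eq_pow_sum, Finset.mul_sum]

/-- The sums `∑ (r - αᵢ)⁺` determine a decreasing sequence. -/
theorem eq_of_sum_sub_eq {n : ℕ} {α β : Fin n → ℕ} (hα : Antitone α) (hβ : Antitone β) {R : ℕ}
    (hR : ∀ i, α i < R) (hs : ∀ r ≤ R, ∑ i, (r - α i) = ∑ i, (r - β i)) : α = β := by
  have hcard (γ : Fin n → ℕ) (r : ℕ) : ∑ i, (r + 1 - γ i) = ∑ i, (r - γ i) +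
      (Finset.univ.filter fun i => γ i ≤ r).card := by
    rw [Finset.card_filter, ← Finset.sum_add_distrib]
    refine Finset.sum_congr rfl fun i _ => ?_
    split_ifs <;> omega
  have hc (r : ℕ) (hr : r < R) : (Finset.univ.filter fun i => α i ≤ r).card =
      (Finset.univ.filter fun i => β i ≤ r).card := by
    have h1 := hs r hr.le
    have h2 := hs (r + 1) hr
    rw [hcard, hcard] at h2
    omega
  -- the sets `{i | γ i ≤ r}` are final segments, hence determined by their size
  have hmono (γ δ : Fin n → ℕ) (hγ : Antitone γ) (hδ : Antitone δ) (r : ℕ)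
      (hcd : (Finset.univ.filter fun i => γ i ≤ r).card =
        (Finset.univ.filter fun i => δ i ≤ r).card) (i : Fin n) (hi : γ i ≤ r) : δ i ≤ r := by
    by_contra hlt
    have h1 : (Finset.univ.filter fun i => δ i ≤ r) ⊆ Finset.Ioi i := by
      intro j hj
      rw [Finset.mem_filter] at hj
      rw [Finset.mem_Ioi]
      by_contra hji
      have := hδ (not_lt.1 hji)
      omega
    have h2 : Finset.Ici i ⊆ (Finset.univ.filter fun i => γ i ≤ r) := by
      intro j hj
      rw [Finset.mem_Ici] at hj
      rw [Finset.mem_filter]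
      exact ⟨Finset.mem_univ _, (hγ hj).trans hi⟩
    have h3 := Finset.card_le_card h1
    have h4 := Finset.card_le_card h2
    have h5 : (Finset.Ioi i).card < (Finset.Ici i).card := by
      refine Finset.card_lt_card ?_
      rw [Finset.ssubset_iff_of_subset (fun j hj => by
        rw [Finset.mem_Ioi] at hj; exact Finset.mem_Ici.2 hj.le)]
      exact ⟨i, by simp, by simp⟩
    omega
  ext i
  have h1 := hmono α β hα hβ (α i) (hc _ (hR i)) i le_rfl
  have h2 := hmono β α hβ hα (β i) (hc _ (h1.trans_lt (hR i))).symm i le_rfl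
  omega

theorem lambdaPlus_eq_of_cong {n : ℕ} {α β : Fin n → ℕ} (hα : α ∈ lambdaPlus n)
    (hβ : β ∈ lambdaPlus n) {R : ℕ} (hR : ∀ i, α i < R) {y : Matrix (Fin n) (Fin n) (QOrd u π)}
    (hy : Cong (piMat u π β) y) (hyR : EntriesIn R (y - piMat u π α)) : α = β := by
  refine eq_of_sum_sub_eq hα.1 hβ.1 hR fun r hr => ?_
  have h1 : (kerMod r (piMat u π α)).index = (kerMod r (piMat u π β)).index := by
    rw [← hy.index_kerMod, kerMod_congr (fun i j => idealPow_anti hr (hyR i j))]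
  rw [index_kerMod_piMat hα, index_kerMod_piMat hβ] at h1
  have := Nat.pow_right_injective (one_lt_resCard u π) h1
  omega

/-- Distinct sequences in `Λₙ⁺` give distinct orbits. -/
theorem piMat_cong_unique {n : ℕ} {α β : Fin n → ℕ} (hα : α ∈ lambdaPlus n)
    (hβ : β ∈ lambdaPlus n) (hc : Cong (piMat u π β) (piMat u π α)) : α = β := by
  refine lambdaPlus_eq_of_cong (R := ∑ i, α i + 1) hα hβ (fun i => ?_) hc ?_
  · have := Finset.single_le_sum (f := α) (fun i _ => Nat.zero_le _) (Finset.mem_univ i)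
    omega
  · intro i j; simp

/-- A hermitian matrix close to `π^α` is nondegenerate. -/
theorem nondeg_of_close {n : ℕ} {α : Fin n → ℕ} (hα : α ∈ lambdaPlus n) {R : ℕ}
    (hR : ∀ i, α i < R) {y : Matrix (Fin n) (Fin n) (QOrd u π)}
    (hyR : EntriesIn R (y - piMat u π α)) : Nondeg y := by
  intro v hv
  -- a nonzero solution could be divided by `Π` until it is nonzero modulo `P`
  have key : ∀ s, ∀ v : Fin n → QOrd u π, y.mulVec v = 0 → ∀ i, v i ∈ idealPow u π s := by
    intro s
    induction s with
    | zero => intro v _ i; rw [idealPow_zero]; trivial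
    | succ s ih =>
      intro v hv i
      have h1 : v ∈ kerMod R (piMat u π α) := by
        rw [kerMod_congr hyR, mem_kerMod, hv]
        intro i; simp
      rw [mem_kerMod_piMat hα] at h1
      have h2 : ∀ i, v i ∈ idealPow u π 1 := fun i =>
        idealPow_anti (by have := hR i; omega) (h1 i)
      choose w hw using fun i => mem_idealPow_left.1 (h2 i)
      have hyw : y.mulVec w = 0 := by
        funext i
        have h3 := congrFun hv i
        have h4 : y.mulVec v i = y.mulVec w i * primeElt u π := by
          simp only [Matrix.mulVec, dotProduct, Finset.sum_mul, ← hw, pow_one, mul_assoc]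
        rw [h4] at h3
        have h5 := congrArg star h3
        rw [star_mul, star_primeElt, Pi.zero_apply, star_zero, neg_mul, neg_eq_zero] at h5
        have h6 : star (y.mulVec w i) = 0 := primeElt_mul_cancel (by rw [h5, mul_zero])
        simpa using h6
      have h7 := ih w hyw i
      rw [← hw i]
      exact mul_mem_idealPow h7 (primeElt_pow_mem 1)
  funext i
  by_contra hne
  obtain ⟨s, hs⟩ := exists_not_mem_idealPow hne
  exact hs (key s v hv i)

/-- Hermitian matrices close to `π^α` lie in its orbit. -/
theorem cong_of_close {n : ℕ} {α : Fin n → ℕ} (hα : α ∈ lambdaPlus n) {R : ℕ}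
    (hR : ∀ i, α i < R) {y : Matrix (Fin n) (Fin n) (QOrd u π)} (hy : yᴴ = y)
    (hyR : EntriesIn R (y - piMat u π α)) : Cong (piMat u π α) y := by
  obtain ⟨β, hβ, -, hc⟩ := exists_cong_piMat n 0 y hy (nondeg_of_close hα hR hyR)
    (fun i j => by rw [idealPow_zero]; trivial)
  rwa [lambdaPlus_eq_of_cong hα hβ hR hc hyR]

end Uniqueness

end

section

variable {k : Type*} [NontriviallyNormedField k] [IsUltrametricDist k] {u π : 𝒪[k]}

/-! ### The reduced norm -/

section ReducedNorm

theorem toD_injective : Function.Injective (toD u π) := by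
  intro x y hxy
  have h1 := congrArg QuaternionAlgebra.re hxy
  have h2 := congrArg QuaternionAlgebra.imI hxy
  have h3 := congrArg QuaternionAlgebra.imJ hxy
  have h4 := congrArg QuaternionAlgebra.imK hxy
  ext1 <;> apply Subtype.ext <;> assumption

theorem toD_star (x : QOrd u π) : toD u π (star x) = star (toD u π x) := by
  ext <;> simp [toD]

theorem map_toD_conjTranspose {m n : ℕ} (x : Matrix (Fin m) (Fin n) (QOrd u π)) :
    xᴴ.map (toD u π) = (x.map (toD u π))ᴴ := by
  ext1 i j
  exact toD_star _

theorem map_toD_injective {m n : ℕ} :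
    Function.Injective fun x : Matrix (Fin m) (Fin n) (QOrd u π) => x.map (toD u π) := by
  intro x y hxy
  ext1 i j
  exact toD_injective (congrFun (congrFun hxy i) j)

/-- The inclusion `φ : D → M₂(k')` as a ring homomorphism. -/
noncomputable def splittingHom (u π : 𝒪[k]) : QAlg u π →+* Matrix (Fin 2) (Fin 2) (QuadExt u) where
  toFun := splitting
  map_one' := by
    ext i j <;> fin_cases i <;> fin_cases j <;>
      simp [splitting, QuadraticAlgebra.re_one, QuadraticAlgebra.im_one]
  map_mul' x y := by
    ext i j <;> fin_cases i <;> fin_cases j <;>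
      simp [splitting, Matrix.mul_apply, Fin.sum_univ_two] <;> ring
  map_zero' := by
    ext i j <;> fin_cases i <;> fin_cases j <;> simp [splitting]
  map_add' x y := by
    ext i j <;> fin_cases i <;> fin_cases j <;> simp [splitting] <;> ring

theorem splittingHom_injective : Function.Injective (splittingHom u π) := by
  intro x y hxy
  have h0 := congrFun (congrFun hxy 0) 0
  have h1 := congrFun (congrFun hxy 1) 0
  simp only [splittingHom, splitting, RingHom.coe_mk, MonoidHom.coe_mk, OneHom.coe_mk,
    Matrix.of_apply, Matrix.cons_val', Matrix.cons_val_zero, Matrix.cons_val_one,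
    Matrix.cons_val_fin_one, QuadraticAlgebra.mk.injEq, neg_inj] at h0 h1
  ext1
  · exact h0.1
  · exact h0.2
  · exact h1.1
  · exact h1.2

instance instStablyFiniteQAlg : IsStablyFiniteRing (QAlg u π) :=
  IsStablyFiniteRing.of_injective (splittingHom u π) splittingHom_injective

instance instStablyFiniteQOrd : IsStablyFiniteRing (QOrd u π) :=
  IsStablyFiniteRing.of_injective (toD u π) toD_injective

theorem splittingMat_mul {n : ℕ} (A B : Matrix (Fin n) (Fin n) (QAlg u π)) :
    splittingMat (A * B) = splittingMat A * splittingMat B := by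
  ext1 p r
  have h1 : splitting ((A * B) p.1 r.1) =
      ∑ j, splittingHom u π (A p.1 j) * splittingHom u π (B j r.1) := by
    rw [Matrix.mul_apply]
    change splittingHom u π _ = _
    rw [map_sum]
    simp
  rw [Matrix.mul_apply, Fintype.sum_prod_type]
  simp only [splittingMat, Matrix.of_apply]
  rw [h1, Matrix.sum_apply]
  rfl

theorem splittingMat_injective {n : ℕ} :
    Function.Injective (splittingMat (u := u) (π := π) (n := n)) := by
  intro A B hAB
  ext1 i j
  apply splittingHom_injective
  ext1 a b
  exact congrFun (congrFun hAB (i, a)) (j, b)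

theorem splittingMat_zero {n : ℕ} :
    splittingMat (0 : Matrix (Fin n) (Fin n) (QAlg u π)) = 0 := by
  ext1 p r
  change splittingHom u π 0 _ _ = 0
  rw [map_zero]; rfl

theorem fact_not_isSquare (u π : 𝒪[k]) [h : StandardPair u π] :
    Fact (∀ r : k, r ^ 2 ≠ (u : k) + 0 * r) :=
  ⟨fun r hr => h.not_isSquare ⟨r, by rw [← pow_two, hr]; ring⟩⟩

theorem det_splitting (x : QAlg u π) : (splitting x).det =
    ⟨x.re ^ 2 - u * x.imI ^ 2 - π * (x.imJ ^ 2 - u * x.imK ^ 2), 0⟩ := by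
  rw [Matrix.det_fin_two]
  ext <;> simp [splitting] <;> ring

theorem det_splitting_star (x : QAlg u π) : (splitting (star x)).det = (splitting x).det := by
  rw [det_splitting, det_splitting]
  simp

theorem det_splittingMat_of_upper {n : ℕ} (A : Matrix (Fin n) (Fin n) (QAlg u π))
    (hA : ∀ i j, j < i → A i j = 0) :
    (splittingMat A).det = ∏ i, (splitting (A i i)).det := by
  have hB : (splittingMat A).BlockTriangular Prod.fst := by
    intro p r hpr
    simp only [splittingMat, Matrix.of_apply]
    rw [hA _ _ hpr]
    change splittingHom u π 0 _ _ = 0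
    rw [map_zero]; rfl
  rw [hB.det_fintype]
  refine Finset.prod_congr rfl fun i _ => ?_
  let e : Fin 2 ≃ {p : Fin n × Fin 2 // p.1 = i} :=
    { toFun := fun a => ⟨(i, a), rfl⟩
      invFun := fun p => p.1.2
      left_inv := fun a => rfl
      right_inv := by rintro ⟨⟨j, a⟩, rfl⟩; rfl }
  rw [← Matrix.det_submatrix_equiv_self e]
  rfl

theorem det_splittingMat_of_lower {n : ℕ} (A : Matrix (Fin n) (Fin n) (QAlg u π))
    (hA : ∀ i j, i < j → A i j = 0) :
    (splittingMat A).det = ∏ i, (splitting (A i i)).det := by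
  have hB : (splittingMat A)ᵀ.BlockTriangular Prod.fst := by
    intro p r hpr
    simp only [splittingMat, Matrix.of_apply, Matrix.transpose_apply]
    rw [hA _ _ hpr]
    change splittingHom u π 0 _ _ = 0
    rw [map_zero]; rfl
  rw [← Matrix.det_transpose, hB.det_fintype]
  refine Finset.prod_congr rfl fun i _ => ?_
  let e : Fin 2 ≃ {p : Fin n × Fin 2 // p.1 = i} :=
    { toFun := fun a => ⟨(i, a), rfl⟩
      invFun := fun p => p.1.2
      left_inv := fun a => rfl
      right_inv := by rintro ⟨⟨j, a⟩, rfl⟩; rfl }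
  rw [← Matrix.det_submatrix_equiv_self e, ← Matrix.det_transpose]
  rfl

/-- A matrix over `D` with nonzero reduced norm is invertible over `D`, since left multiplication by
it is an injective `k`-linear endomorphism of the finite-dimensional space `Mₙ(D)`. -/
theorem isUnit_of_redNorm_ne_zero [StandardPair u π] {n : ℕ} {A : Matrix (Fin n) (Fin n) (QAlg u π)}
    (hA : redNorm A ≠ 0) : IsUnit A := by
  have := fact_not_isSquare u π
  have hdet : (splittingMat A).det ≠ 0 := by
    intro h0; apply hA; rw [redNorm, h0]; rfl
  have hinj : Function.Injective (LinearMap.mulLeft k A) := by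
    rw [injective_iff_map_eq_zero]
    intro B hB
    rw [LinearMap.mulLeft_apply] at hB
    have h1 : splittingMat A * splittingMat B = 0 := by
      rw [← splittingMat_mul, hB, splittingMat_zero]
    have h2 : splittingMat B = 0 := by
      have h3 := congrArg ((splittingMat A).adjugate * ·) h1
      simp only [← Matrix.mul_assoc, Matrix.adjugate_mul, Matrix.mul_zero, Matrix.smul_mul,
        Matrix.one_mul] at h3
      exact (smul_eq_zero.1 h3).resolve_left hdet
    exact splittingMat_injective (h2.trans splittingMat_zero.symm)
  have hsurj := LinearMap.injective_iff_surjective.1 hinj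
  obtain ⟨B, hB⟩ := hsurj 1
  rw [LinearMap.mulLeft_apply] at hB
  exact IsUnit.of_mul_eq_one B hB

/-- The elements of `k'` with integral coordinates. -/
def quadInt (u : 𝒪[k]) : Subring (QuadExt u) where
  carrier := {z | z.re ∈ 𝒪[k] ∧ z.im ∈ 𝒪[k]}
  zero_mem' := by simp
  one_mem' := ⟨Subring.one_mem _, Subring.zero_mem _⟩
  add_mem' := by
    rintro a b ⟨h1, h2⟩ ⟨h3, h4⟩
    exact ⟨Subring.add_mem _ h1 h3, Subring.add_mem _ h2 h4⟩
  neg_mem' := by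
    rintro a ⟨h1, h2⟩
    exact ⟨Subring.neg_mem _ h1, Subring.neg_mem _ h2⟩
  mul_mem' := by
    rintro a b ⟨h1, h2⟩ ⟨h3, h4⟩
    have h5 : (a * b).re = a.re * b.re + u * a.im * b.im := by simp
    have h6 : (a * b).im = a.re * b.im + a.im * b.re := by simp
    refine ⟨?_, ?_⟩
    · rw [h5]
      exact Subring.add_mem _ (Subring.mul_mem _ h1 h3)
        (Subring.mul_mem _ (Subring.mul_mem _ u.2 h2) h4)
    · rw [h6]
      exact Subring.add_mem _ (Subring.mul_mem _ h1 h4) (Subring.mul_mem _ h2 h3)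

theorem norm_redNorm_le_one {n : ℕ} (Y : Matrix (Fin n) (Fin n) (QOrd u π)) :
    ‖redNorm (Y.map (toD u π))‖ ≤ 1 := by
  have hdet : (splittingMat (Y.map (toD u π))).det ∈ quadInt u := by
    rw [Matrix.det_apply]
    refine Subring.sum_mem _ fun σ _ => ?_
    rw [Units.smul_def, zsmul_eq_mul]
    refine Subring.mul_mem _ (intCast_mem _ _) (Subring.prod_mem _ fun p _ => ?_)
    obtain ⟨i, a⟩ := p
    obtain ⟨j, b⟩ := σ (i, a)
    change splitting (toD u π _) _ _ ∈ _
    fin_cases a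
    · fin_cases b
      · exact ⟨Subtype.prop _, Subtype.prop _⟩
      · exact ⟨Subtype.prop _, Subring.neg_mem _ (Subtype.prop _)⟩
    · fin_cases b
      · exact ⟨Subring.mul_mem _ (Subtype.prop _) π.2, Subring.mul_mem _ (Subtype.prop _) π.2⟩
      · exact ⟨Subtype.prop _, Subring.neg_mem _ (Subtype.prop _)⟩
  exact Valued.integer.mem_iff.1 hdet.1

end ReducedNorm

/-! ### Leading minors -/

section Minors

/-- The reduced norm of the upper left block of size `i + 1`. -/
noncomputable def minorNorm {n : ℕ} (Y : Matrix (Fin n) (Fin n) (QOrd u π)) (i : Fin n) : k :=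
  redNorm (block (Y.map (toD u π)) i)

theorem norm_minorNorm_le_one {n : ℕ} (Y : Matrix (Fin n) (Fin n) (QOrd u π)) (i : Fin n) :
    ‖minorNorm Y i‖ ≤ 1 := norm_redNorm_le_one (block Y i)

theorem isUnit_of_minorNorm_ne_zero [StandardPair u π] {n : ℕ}
    {Y : Matrix (Fin n) (Fin n) (QOrd u π)} (hY : ∀ i, minorNorm Y i ≠ 0) :
    IsUnit (Y.map (toD u π)) := by
  rcases n with _ | n
  · exact isUnit_of_subsingleton _
  · exact isUnit_of_redNorm_ne_zero (hY (Fin.last n))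

open Classical in
theorem absPow_map_toD [StandardPair u π] {n : ℕ} (s : Fin n → ℂ)
    (Y : Matrix (Fin n) (Fin n) (QOrd u π)) :
    absPow s (Y.map (toD u π)) = if Yᴴ = Y ∧ ∀ i, minorNorm Y i ≠ 0 then
      ∏ i, ((Real.sqrt ‖minorNorm Y i‖ : ℝ) : ℂ) ^ s i else 0 := by
  have : Y.map (toD u π) ∈ hermOp u π n ↔ Yᴴ = Y ∧ ∀ i, minorNorm Y i ≠ 0 := by
    rw [hermOp, hermSpace]
    constructor
    · rintro ⟨⟨-, h1⟩, h2⟩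
      rw [← map_toD_conjTranspose] at h1
      exact ⟨map_toD_injective h1, h2⟩
    · rintro ⟨h1, h2⟩
      refine ⟨⟨isUnit_of_minorNorm_ne_zero h2, ?_⟩, h2⟩
      rw [← map_toD_conjTranspose, h1]
  rw [absPow]
  simp only [this]
  rfl

theorem norm_absPow_le_one [StandardPair u π] {n : ℕ} {s : Fin n → ℂ} (hs : ∀ i, 0 ≤ (s i).re)
    (Y : Matrix (Fin n) (Fin n) (QOrd u π)) : ‖absPow s (Y.map (toD u π))‖ ≤ 1 := by
  classical
  rw [absPow_map_toD]
  split_ifs with h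
  · rw [norm_prod]
    refine Finset.prod_le_one (fun i _ => norm_nonneg _) fun i _ => ?_
    have hpos : 0 < Real.sqrt ‖minorNorm Y i‖ := Real.sqrt_pos.2 (norm_pos_iff.2 (h.2 i))
    rw [Complex.norm_cpow_eq_rpow_re_of_pos hpos]
    refine Real.rpow_le_one hpos.le ?_ (hs i)
    exact Real.sqrt_le_one.2 (norm_minorNorm_le_one Y i)
  · simp

theorem sum_eq_sum_castLE {M : Type*} [AddCommMonoid M] {n : ℕ} (i : Fin n) (f : Fin n → M)
    (hf : ∀ t, i < t → f t = 0) :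
    ∑ t, f t = ∑ t : Fin (i + 1), f (Fin.castLE i.isLt t) := by
  symm
  refine Fintype.sum_of_injective (Fin.castLE i.isLt) (Fin.castLE_injective _) _ _ (fun t ht => ?_)
    fun t => rfl
  refine hf t ?_
  by_contra hlt
  refine ht ⟨⟨t, ?_⟩, rfl⟩
  rw [not_lt, Fin.le_def] at hlt
  omega

theorem block_mul_upper {R : Type*} [Ring R] {n : ℕ} (A H : Matrix (Fin n) (Fin n) R)
    (hH : ∀ i j, j < i → H i j = 0) (i : Fin n) : block (A * H) i = block A i * block H i := by
  ext1 p r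
  simp only [block, Matrix.submatrix_apply, Matrix.mul_apply]
  refine sum_eq_sum_castLE i _ fun t ht => ?_
  rw [hH t _ (lt_of_le_of_lt ?_ ht), mul_zero]
  rw [Fin.le_def]
  have := r.isLt
  simp; omega

theorem block_conjTranspose {R : Type*} [Ring R] [StarRing R] {n : ℕ}
    (A : Matrix (Fin n) (Fin n) R) (i : Fin n) : block Aᴴ i = (block A i)ᴴ := rfl

theorem block_mul_lower {R : Type*} [Ring R] [StarRing R] {n : ℕ} (A H : Matrix (Fin n) (Fin n) R)
    (hH : ∀ i j, j < i → H i j = 0) (i : Fin n) :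
    block (Hᴴ * A) i = (block H i)ᴴ * block A i := by
  have := congrArg Matrix.conjTranspose (block_mul_upper Aᴴ H hH i)
  rw [← block_conjTranspose, Matrix.conjTranspose_mul, Matrix.conjTranspose_mul,
    ← block_conjTranspose, Matrix.conjTranspose_conjTranspose, block_conjTranspose,
    block_conjTranspose, Matrix.conjTranspose_conjTranspose] at this
  exact this

/-- The leading minors of `Hᴴ Y H` for upper triangular `H`. -/
theorem minorNorm_conj_upper {n : ℕ} (Y H : Matrix (Fin n) (Fin n) (QOrd u π))
    (hH : ∀ i j, j < i → H i j = 0) (i : Fin n) (c : k)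
    (hc : ∏ l, (splitting (block (H.map (toD u π)) i l l)).det = ⟨c, 0⟩) :
    minorNorm (Hᴴ * Y * H) i = c ^ 2 * minorNorm Y i := by
  have hup : ∀ i j, j < i → H.map (toD u π) i j = 0 := by
    intro i j hij; simp [hH i j hij]
  have hbup : ∀ p r, r < p → block (H.map (toD u π)) i p r = 0 := fun p r hpr => hup _ _ hpr
  have h1 : (Hᴴ * Y * H).map (toD u π) =
      (H.map (toD u π))ᴴ * (Y.map (toD u π) * H.map (toD u π)) := by
    rw [Matrix.map_mul, Matrix.map_mul, map_toD_conjTranspose, Matrix.mul_assoc]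
  rw [minorNorm, h1, block_mul_lower _ _ hup, block_mul_upper _ _ hup, redNorm, splittingMat_mul,
    splittingMat_mul, Matrix.det_mul, Matrix.det_mul, det_splittingMat_of_upper _ hbup,
    det_splittingMat_of_lower _ (fun p r hpr => by
      rw [Matrix.conjTranspose_apply, hbup _ _ hpr, star_zero])]
  simp only [Matrix.conjTranspose_apply, det_splitting_star]
  rw [hc, minorNorm, redNorm]
  simp
  ring

end Minors

/-! ### Continuity of the leading minors -/

section Continuity

noncomputable instance instTopQuad (u : 𝒪[k]) : TopologicalSpace (QuadExt u) :=
  TopologicalSpace.induced (QuadraticAlgebra.equivProd (u : k) 0) inferInstance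

theorem continuous_quad_iff {α : Type*} [TopologicalSpace α] {f : α → QuadExt u} :
    Continuous f ↔ (Continuous fun a => (f a).re) ∧ Continuous fun a => (f a).im := by
  rw [continuous_induced_rng]
  exact continuous_prodMk

instance instTopRingQuad (u : 𝒪[k]) : IsTopologicalRing (QuadExt u) := by
  obtain ⟨c0, c1⟩ := continuous_quad_iff.1 (continuous_id (X := QuadExt u))
  simp only [id] at c0 c1
  refine { continuous_add := ?_, continuous_mul := ?_, continuous_neg := ?_ }
  · refine continuous_quad_iff.2 ⟨?_, ?_⟩ <;> simp only [QuadraticAlgebra.re_add,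
      QuadraticAlgebra.im_add] <;> fun_prop
  · refine continuous_quad_iff.2 ⟨?_, ?_⟩ <;> simp only [QuadraticAlgebra.re_mul,
      QuadraticAlgebra.im_mul] <;> fun_prop
  · refine continuous_quad_iff.2 ⟨?_, ?_⟩ <;> simp only [QuadraticAlgebra.re_neg,
      QuadraticAlgebra.im_neg] <;> fun_prop

theorem continuous_redNorm {n : ℕ} :
    Continuous fun Y : Matrix (Fin n) (Fin n) (QOrd u π) => redNorm (Y.map (toD u π)) := by
  obtain ⟨c0, c1, c2, c3⟩ := continuous_coords u π
  have hmat : Continuous fun Y : Matrix (Fin n) (Fin n) (QOrd u π) =>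
      splittingMat (Y.map (toD u π)) := by
    refine continuous_matrix fun p r => ?_
    obtain ⟨i, a⟩ := p
    obtain ⟨j, b⟩ := r
    have hij : Continuous fun Y : Matrix (Fin n) (Fin n) (QOrd u π) => Y i j :=
      continuous_id.matrix_elem i j
    have d0 := continuous_subtype_val.comp (c0.comp hij)
    have d1 := continuous_subtype_val.comp (c1.comp hij)
    have d2 := continuous_subtype_val.comp (c2.comp hij)
    have d3 := continuous_subtype_val.comp (c3.comp hij)
    change Continuous fun Y : Matrix (Fin n) (Fin n) (QOrd u π) => splitting (toD u π (Y i j)) a b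
    fin_cases a <;> fin_cases b
    · exact continuous_quad_iff.2 ⟨d0, d1⟩
    · exact continuous_quad_iff.2 ⟨d2.mul continuous_const, d3.mul continuous_const⟩
    · exact continuous_quad_iff.2 ⟨d2, d3.neg⟩
    · exact continuous_quad_iff.2 ⟨d0, d1.neg⟩
  exact (continuous_quad_iff.1 hmat.matrix_det).1

theorem continuous_minorNorm {n : ℕ} (i : Fin n) :
    Continuous fun Y : Matrix (Fin n) (Fin n) (QOrd u π) => minorNorm Y i :=
  continuous_redNorm.comp (continuous_id.matrix_submatrix _ _)

end Continuity

end

section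

/-! ### Haar measures on compact groups -/

section Haar

/-- If the averages of `F` over the orbits in `S` of a measure-preserving family of maps are all
equal to `c`, then the integral of `F` over `S` is the volume of `S` times `c`. -/
theorem setIntegral_eq_of_average {K Y E : Type*} [MeasurableSpace K] [MeasurableSpace Y]
    [NormedAddCommGroup E] [NormedSpace ℝ E] [CompleteSpace E]
    (κ : Measure K) [IsProbabilityMeasure κ] (ν : Measure Y) [IsFiniteMeasure ν]
    {T : K → Y → Y} (hT : Measurable (Function.uncurry T)) (hpres : ∀ g, MeasurePreserving (T g) ν ν)
    {S : Set Y} (hS : MeasurableSet S) (hTS : ∀ g y, T g y ∈ S ↔ y ∈ S) {F : Y → E}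
    (hF : StronglyMeasurable F) {C : ℝ} (hb : ∀ y, ‖F y‖ ≤ C) {c : E}
    (hc : ∀ y ∈ S, ∫ g, F (T g y) ∂κ = c) : ∫ y in S, F y ∂ν = ν.real S • c := by
  have h1 (g : K) : ∫ y in S, F (T g y) ∂ν = ∫ y in S, F y ∂ν := by
    have hpre : T g ⁻¹' S = S := by ext y; exact hTS g y
    have := (hpres g).restrict_preimage hS
    rw [hpre] at this
    rw [← this.map_eq, integral_map this.measurable.aemeasurable hF.aestronglyMeasurable, this.map_eq]
  have hint : Integrable (Function.uncurry fun g y => F (T g y)) (κ.prod (ν.restrict S)) := by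
    refine Integrable.of_bound (hF.comp_measurable hT).aestronglyMeasurable C ?_
    exact Eventually.of_forall fun p => hb _
  calc ∫ y in S, F y ∂ν = ∫ g, (∫ y in S, F (T g y) ∂ν) ∂κ := by
        simp only [h1, integral_const, probReal_univ, one_smul]
    _ = ∫ y in S, (∫ g, F (T g y) ∂κ) ∂ν := integral_integral_swap hint
    _ = ∫ y in S, c ∂ν := setIntegral_congr_fun hS hc
    _ = _ := by rw [setIntegral_const]

variable {G : Type*} [AddCommGroup G] [TopologicalSpace G] [IsTopologicalAddGroup G]
  [CompactSpace G] [T2Space G] [MeasurableSpace G] [BorelSpace G] (μ : Measure G)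
  [μ.IsAddHaarMeasure] [IsProbabilityMeasure μ]

theorem measurePreserving_of_surjective (f : G →+ G) (hf : Continuous f)
    (hs : Function.Surjective f) : MeasurePreserving f μ μ :=
  AddMonoidHom.measurePreserving hf hs rfl

theorem measureReal_addSubgroup (H : AddSubgroup G) (hm : MeasurableSet (H : Set G))
    (hi : H.index ≠ 0) : μ.real (H : Set G) = (H.index : ℝ)⁻¹ := by
  have : H.FiniteIndex := ⟨hi⟩
  have h1 := AddSubgroup.index_mul_measure H hm μ
  have h2 := congrArg ENNReal.toReal h1
  rw [ENNReal.toReal_mul, measure_univ] at h2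
  simp only [ENNReal.toReal_natCast, ENNReal.toReal_one] at h2
  rw [measureReal_def]
  exact eq_inv_of_mul_eq_one_right h2

/-- Change of variables along an injective endomorphism of finite index. -/
theorem setIntegral_image {E : Type*} [NormedAddCommGroup E] [NormedSpace ℝ E]
    (f : G →+ G) (hf : Continuous f) (hinj : Function.Injective f) (hi : f.range.index ≠ 0)
    (S : Set G) (F : G → E) :
    ∫ y in f '' S, F y ∂μ = (f.range.index : ℝ)⁻¹ • ∫ x in S, F (f x) ∂μ := by
  have hemb : MeasurableEmbedding f := (hf.isClosedEmbedding hinj).measurableEmbedding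
  have : (Measure.comap f μ).IsAddLeftInvariant := Measure.IsAddLeftInvariant.comap μ hemb
  have hfin : IsFiniteMeasure (Measure.comap f μ) := by
    refine ⟨?_⟩
    rw [Measure.comap_apply _ hinj (fun s hs => hemb.measurableSet_image.2 hs) _ MeasurableSet.univ]
    exact measure_lt_top _ _
  have hsm := Measure.isAddInvariant_eq_smul_of_compactSpace (Measure.comap f μ) μ
  have hval : (Measure.comap f μ).real Set.univ = (f.range.index : ℝ)⁻¹ := by
    rw [measureReal_def, Measure.comap_apply _ hinj
      (fun s hs => hemb.measurableSet_image.2 hs) _ MeasurableSet.univ, ← measureReal_def,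
      Set.image_univ, ← AddMonoidHom.coe_range]
    refine measureReal_addSubgroup μ _ ?_ hi
    rw [AddMonoidHom.coe_range]
    exact hemb.measurableSet_range
  set c := (Measure.comap f μ).addHaarScalarFactor μ
  have hc : (c : ℝ) = (f.range.index : ℝ)⁻¹ := by
    rw [← hval, hsm]
    simp [measureReal_def]
  have h1 : Measure.map f (Measure.comap f μ) = μ.restrict (Set.range f) := hemb.map_comap μ
  have h2 : ∫ y in f '' S, F y ∂μ = ∫ y in f '' S, F y ∂(Measure.map f (Measure.comap f μ)) := by
    rw [h1, Measure.restrict_restrict_of_subset (Set.image_subset_range f S)]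
  rw [h2, hemb.setIntegral_map, Set.preimage_image_eq _ hinj, hsm, Measure.restrict_smul,
    integral_smul_nnreal_measure, ← hc]
  rfl

/-- Sets invariant under an open subgroup are clopen. -/
theorem isClopen_of_add_mem {H : AddSubgroup G} (hH : IsOpen (H : Set G)) {S : Set G}
    (hS : ∀ x ∈ S, ∀ h ∈ H, x + h ∈ S) : IsClopen S := by
  have key : ∀ S : Set G, (∀ x ∈ S, ∀ h ∈ H, x + h ∈ S) → IsOpen S := by
    intro S hS
    rw [isOpen_iff_mem_nhds]
    intro x hx
    have h1 : (fun y => y - x) ⁻¹' (H : Set G) ∈ 𝓝 x := by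
      refine (continuous_id.sub continuous_const).continuousAt.preimage_mem_nhds ?_
      simpa using hH.mem_nhds H.zero_mem
    refine mem_of_superset h1 fun y hy => ?_
    have := hS x hx _ hy
    simpa using this
  refine ⟨⟨key _ fun x hx h hh hmem => hx ?_⟩, key _ hS⟩
  have := hS _ hmem (-h) (H.neg_mem hh)
  simpa using this

end Haar

variable {k : Type*} [NontriviallyNormedField k] [IsUltrametricDist k] {u π : 𝒪[k]}

/-! ### Measures on matrices and on the maximal compact group -/

section Spaces

noncomputable instance instMeasMat (u π : 𝒪[k]) (m n : ℕ) :
    MeasurableSpace (Matrix (Fin m) (Fin n) (QOrd u π)) := borel _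

instance instBorelMat (u π : 𝒪[k]) (m n : ℕ) :
    BorelSpace (Matrix (Fin m) (Fin n) (QOrd u π)) := ⟨rfl⟩

instance instSecondCountableQOrd [ProperSpace k] : SecondCountableTopology (QOrd u π) :=
  (coordHomeo u π).secondCountableTopology

instance instCompactRectMat [ProperSpace k] (m n : ℕ) :
    CompactSpace (Matrix (Fin m) (Fin n) (QOrd u π)) :=
  inferInstanceAs (CompactSpace (Fin m → Fin n → QOrd u π))

instance instT2RectMat (m n : ℕ) : T2Space (Matrix (Fin m) (Fin n) (QOrd u π)) :=
  inferInstanceAs (T2Space (Fin m → Fin n → QOrd u π))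

instance instSecondCountableMat [ProperSpace k] (m n : ℕ) :
    SecondCountableTopology (Matrix (Fin m) (Fin n) (QOrd u π)) :=
  inferInstanceAs (SecondCountableTopology (Fin m → Fin n → QOrd u π))

instance instSecondCountableK [ProperSpace k] (n : ℕ) :
    SecondCountableTopology (maxCompact u π n) :=
  have : SecondCountableTopology (Matrix (Fin n) (Fin n) (QOrd u π))ᵐᵒᵖ :=
    MulOpposite.opHomeomorph.symm.secondCountableTopology
  Units.isEmbedding_embedProduct.secondCountableTopology

/-- The normalized additive Haar measure on `m × n` matrices over the maximal order. -/
noncomputable def vol [ProperSpace k] (u π : 𝒪[k]) (m n : ℕ) :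
    Measure (Matrix (Fin m) (Fin n) (QOrd u π)) := Measure.addHaarMeasure ⊤

instance instHaarVol [ProperSpace k] (m n : ℕ) : (vol u π m n).IsAddHaarMeasure := by
  unfold vol; infer_instance

instance instProbVol [ProperSpace k] (m n : ℕ) : IsProbabilityMeasure (vol u π m n) :=
  ⟨Measure.addHaarMeasure_self⟩

instance instHaarHaarK [ProperSpace k] (n : ℕ) : (haarK u π n).IsHaarMeasure := by
  unfold haarK; infer_instance

instance instProbHaarK [ProperSpace k] (n : ℕ) : IsProbabilityMeasure (haarK u π n) :=
  ⟨Measure.haarMeasure_self⟩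

instance instRightHaarK [ProperSpace k] (n : ℕ) : (haarK u π n).IsMulRightInvariant := by
  refine ⟨fun g => ?_⟩
  have : IsProbabilityMeasure (Measure.map (· * g) (haarK u π n)) :=
    Measure.isProbabilityMeasure_map (measurable_mul_const g).aemeasurable
  exact Measure.isHaarMeasure_eq_of_isProbabilityMeasure _ _

variable [ProperSpace k] [h : StandardPair u π]

theorem index_idealPow_ne_zero (r : ℕ) : (idealPow u π r).index ≠ 0 := by
  rw [index_idealPow]
  exact pow_ne_zero _ (by have := one_lt_resCard u π; omega)

theorem isOpen_idealPow (r : ℕ) : IsOpen (idealPow u π r : Set (QOrd u π)) := by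
  have hcl : IsClosed (idealPow u π r : Set (QOrd u π)) := by
    rw [idealPow, AddMonoidHom.coe_range]
    exact (isCompact_range (by exact continuous_const.mul continuous_id)).isClosed
  have : (idealPow u π r).FiniteIndex := ⟨index_idealPow_ne_zero r⟩
  exact AddSubgroup.isOpen_of_isClosed_of_finiteIndex _ hcl

/-- The additive group of matrices with entries in `P ^ r`. -/
def matIdeal (u π : 𝒪[k]) (m n r : ℕ) : AddSubgroup (Matrix (Fin m) (Fin n) (QOrd u π)) where
  carrier := {x | EntriesIn r x}
  zero_mem' := fun _ _ => AddSubgroup.zero_mem _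
  add_mem' := fun ha hb => ha.add hb
  neg_mem' := fun ha i j => AddSubgroup.neg_mem _ (ha i j)

theorem mem_matIdeal {m n r : ℕ} {x : Matrix (Fin m) (Fin n) (QOrd u π)} :
    x ∈ matIdeal u π m n r ↔ EntriesIn r x := Iff.rfl

theorem isOpen_matIdeal (m n r : ℕ) :
    IsOpen (matIdeal u π m n r : Set (Matrix (Fin m) (Fin n) (QOrd u π))) := by
  have : (matIdeal u π m n r : Set (Matrix (Fin m) (Fin n) (QOrd u π))) =
      ⋂ i, ⋂ j, (fun x => x i j) ⁻¹' (idealPow u π r : Set (QOrd u π)) := by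
    ext x; simp [mem_matIdeal, EntriesIn]
  rw [this]
  exact isOpen_iInter_of_finite fun i => isOpen_iInter_of_finite fun j =>
    (isOpen_idealPow r).preimage (continuous_id.matrix_elem i j)

theorem index_matIdeal (m n r : ℕ) :
    (matIdeal u π m n r).index = resCard k ^ (2 * r * m * n) := by
  have h2 : (AddSubgroup.pi Set.univ fun _ : Fin m => AddSubgroup.pi Set.univ
      fun _ : Fin n => idealPow u π r).index = resCard k ^ (2 * r * m * n) := by
    rw [AddSubgroup.index_pi]
    simp only [AddSubgroup.index_pi, index_idealPow, Finset.prod_const, Finset.card_univ,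
      Fintype.card_fin]
    rw [← pow_mul, ← pow_mul]
    ring
  rw [← h2]
  refine congrArg (AddSubgroup.index (G := Fin m → Fin n → QOrd u π)) ?_
  refine AddSubgroup.ext fun x => ⟨fun hx => ?_, fun hx => ?_⟩
  · exact fun i _ j _ => hx i j
  · exact fun i j => hx i trivial j trivial

end Spaces

/-! ### Independence modulo `P` and primitive matrices -/

section Indep

/-- The first `j` columns of `x` are right linearly independent modulo `P`. -/
def IndepMod {m n : ℕ} (j : ℕ) (x : Matrix (Fin m) (Fin n) (QOrd u π)) : Prop :=
  ∀ c : Fin n → QOrd u π, (∀ i : Fin n, j ≤ (i : ℕ) → c i = 0) →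
    (∀ t, x.mulVec c t ∈ idealPow u π 1) → ∀ i, c i ∈ idealPow u π 1

/-- The identity matrix with column `j` replaced by `a + Π eⱼ`. -/
noncomputable def colMat {n : ℕ} (j : Fin n) (a : Fin n → QOrd u π) :
    Matrix (Fin n) (Fin n) (QOrd u π) :=
  Matrix.of fun i l => if l = j then a i + (if i = j then primeElt u π else 0)
    else if i = l then 1 else 0

theorem mul_colMat_apply {m n : ℕ} (x : Matrix (Fin m) (Fin n) (QOrd u π)) (j : Fin n)
    (a : Fin n → QOrd u π) (t : Fin m) (l : Fin n) :
    (x * colMat j a) t l = if l = j then x.mulVec a t + x t j * primeElt u π else x t l := by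
  rw [Matrix.mul_apply]
  by_cases hl : l = j
  · simp only [colMat, Matrix.of_apply, hl, if_true, mul_add, Finset.sum_add_distrib, mul_ite,
      mul_zero, Finset.sum_ite_eq', Finset.mem_univ]
    rfl
  · simp [colMat, hl]

theorem indepMod_congr {m n j : ℕ} {x y : Matrix (Fin m) (Fin n) (QOrd u π)}
    (hxy : ∀ t (l : Fin n), (l : ℕ) < j → x t l = y t l) (hx : IndepMod j x) : IndepMod j y := by
  intro c hc hm
  refine hx c hc fun t => ?_
  have : x.mulVec c t = y.mulVec c t := by
    simp only [Matrix.mulVec, dotProduct]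
    refine Finset.sum_congr rfl fun l _ => ?_
    by_cases hl : (l : ℕ) < j
    · rw [hxy t l hl]
    · rw [hc l (not_lt.1 hl), mul_zero, mul_zero]
  rw [this]
  exact hm t

theorem indepMod_mono {m n i j : ℕ} (hij : i ≤ j) {x : Matrix (Fin m) (Fin n) (QOrd u π)}
    (hx : IndepMod j x) : IndepMod i x := fun c hc hm =>
  hx c (fun l hl => hc l (hij.trans hl)) hm

theorem indepMod_zero {m n : ℕ} (x : Matrix (Fin m) (Fin n) (QOrd u π)) : IndepMod 0 x :=
  fun c hc _ i => by rw [hc i (Nat.zero_le _)]; exact AddSubgroup.zero_mem _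

theorem IndepMod.add {m n j : ℕ} {x y : Matrix (Fin m) (Fin n) (QOrd u π)} (hx : IndepMod j x)
    (hy : EntriesIn 1 y) : IndepMod j (x + y) := by
  intro c hc hm
  refine hx c hc fun t => ?_
  have := hm t
  rw [Matrix.add_mulVec] at this
  exact (AddSubgroup.add_mem_cancel_right _ (mulVec_mem_idealPow' hy c t)).1 this

variable [ProperSpace k] [h : StandardPair u π]

theorem isClopen_indepMod (m n j : ℕ) :
    IsClopen {x : Matrix (Fin m) (Fin n) (QOrd u π) | IndepMod j x} :=
  isClopen_of_add_mem (isOpen_matIdeal m n 1) fun _ hx _ hy => hx.add hy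

theorem measurableSet_indepMod (m n j : ℕ) :
    MeasurableSet {x : Matrix (Fin m) (Fin n) (QOrd u π) | IndepMod j x} :=
  (isClopen_indepMod m n j).isOpen.measurableSet

/-- If the first `j` columns are independent modulo `P` but the first `j + 1` are not, then column
`j` is a combination of the previous ones modulo `P`. -/
theorem exists_combination {m n : ℕ} {j : Fin n} {x : Matrix (Fin m) (Fin n) (QOrd u π)}
    (hx : IndepMod j x) (hx' : ¬ IndepMod (j + 1) x) :
    ∃ b : Fin n → QOrd u π, (∀ i, j ≤ i → b i = 0) ∧
      ∀ t, x t j - x.mulVec b t ∈ idealPow u π 1 := by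
  rw [IndepMod] at hx'
  push Not at hx'
  obtain ⟨c, hc, hm, i, hi⟩ := hx'
  set c' : Fin n → QOrd u π := fun l => if l = j then 0 else c l with hc'
  have hc'0 : ∀ l : Fin n, (j : ℕ) ≤ l → c' l = 0 := by
    intro l hl
    by_cases hlj : l = j
    · simp [hc', hlj]
    · have : (l : ℕ) ≠ j := fun hh => hlj (Fin.ext hh)
      simp only [hc', if_neg hlj]
      exact hc l (by omega)
  have hsplit (t : Fin m) : x.mulVec c t = x.mulVec c' t + x t j * c j := by
    have h1 : c = c' + Pi.single j (c j) := by
      ext1 l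
      by_cases hlj : l = j
      · subst hlj; simp [hc']
      · simp [hc', hlj]
    conv_lhs => rw [h1, Matrix.mulVec_add]
    simp
  have hcj : IsUnit (c j) := by
    rw [isUnit_iff_not_mem]
    intro hmem
    have h2 := hx c' hc'0 fun t => by
      have := hm t
      rw [hsplit t] at this
      exact (AddSubgroup.add_mem_cancel_right _ (mul_mem_idealPow_right hmem _)).1 this
    refine hi ?_
    by_cases hij : i = j
    · rw [hij]; exact hmem
    · have := h2 i
      simpa [hc', hij] using this
  obtain ⟨d, hd⟩ := hcj
  refine ⟨fun l => -(c' l * (d⁻¹ : (QOrd u π)ˣ)), fun l hl => ?_, fun t => ?_⟩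
  · simp [hc'0 l hl]
  · have h3 : x t j - x.mulVec (fun l => -(c' l * (d⁻¹ : (QOrd u π)ˣ))) t =
        x.mulVec c t * (d⁻¹ : (QOrd u π)ˣ) := by
      rw [hsplit t, ← hd, add_mul, mul_assoc, d.mul_inv, mul_one]
      simp only [Matrix.mulVec, dotProduct, mul_neg, Finset.sum_neg_distrib, Finset.sum_mul,
        mul_assoc]
      abel
    rw [h3]
    exact mul_mem_idealPow_left (hm t) _

end Indep

end

section

variable {k : Type*} [NontriviallyNormedField k] [IsUltrametricDist k] {u π : 𝒪[k]}
variable [ProperSpace k] [h : StandardPair u π]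

/-! ### Column operations -/

section ColumnOperations

/-- Right multiplication by a fixed matrix. -/
noncomputable def mulRightHom (m : ℕ) {n : ℕ} (H : Matrix (Fin n) (Fin n) (QOrd u π)) :
    Matrix (Fin m) (Fin n) (QOrd u π) →+ Matrix (Fin m) (Fin n) (QOrd u π) where
  toFun x := x * H
  map_zero' := by simp
  map_add' x y := Matrix.add_mul x y H

theorem continuous_mulRightHom (m : ℕ) {n : ℕ} (H : Matrix (Fin n) (Fin n) (QOrd u π)) :
    Continuous (mulRightHom m H) :=
  continuous_id.matrix_mul continuous_const

theorem mulVec_congr_of_lt {m n : ℕ} {j : Fin n} {x y : Matrix (Fin m) (Fin n) (QOrd u π)}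
    (hxy : ∀ t (l : Fin n), l < j → x t l = y t l) {a : Fin n → QOrd u π}
    (ha : ∀ i, j ≤ i → a i = 0) (t : Fin m) : x.mulVec a t = y.mulVec a t := by
  simp only [Matrix.mulVec, dotProduct]
  refine Finset.sum_congr rfl fun l _ => ?_
  by_cases hl : l < j
  · rw [hxy t l hl]
  · rw [ha l (not_lt.1 hl), mul_zero, mul_zero]

theorem mulRightHom_colMat_injective (m : ℕ) {n : ℕ} (j : Fin n) {a : Fin n → QOrd u π}
    (ha : ∀ i, j ≤ i → a i = 0) : Function.Injective (mulRightHom m (colMat j a)) := by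
  intro x y hxy
  have hent (t : Fin m) (l : Fin n) : (x * colMat j a) t l = (y * colMat j a) t l :=
    congrFun (congrFun hxy t) l
  simp only [mul_colMat_apply] at hent
  have hne (t : Fin m) (l : Fin n) (hl : l ≠ j) : x t l = y t l := by
    simpa [hl] using hent t l
  ext1 t l
  by_cases hl : l = j
  · subst hl
    have h1 := hent t l
    rw [if_pos rfl, if_pos rfl, mulVec_congr_of_lt (fun t l' hl' => hne t l' hl'.ne) ha t] at h1
    have h2 := congrArg star (add_left_cancel h1)
    rw [star_mul, star_mul, star_primeElt, neg_mul, neg_mul, neg_inj] at h2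
    exact star_injective (primeElt_mul_cancel h2)
  · exact hne t l hl

theorem replaceCol_mul_colMat {m n : ℕ} {j : Fin n} {a : Fin n → QOrd u π}
    (ha : ∀ i, j ≤ i → a i = 0) {x : Matrix (Fin m) (Fin n) (QOrd u π)} {w : Fin m → QOrd u π}
    (hw : ∀ t, w t * primeElt u π ^ 1 = x t j - x.mulVec a t) :
    (Matrix.of fun t l => if l = j then w t else x t l) * colMat j a = x := by
  ext1 t l
  rw [mul_colMat_apply]
  by_cases hl : l = j
  · subst hl
    have h1 := mulVec_congr_of_lt (x := Matrix.of fun t l' => if l' = l then w t else x t l')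
      (y := x) (fun t l' hl' => by simp [hl'.ne]) ha t
    have h2 := hw t
    rw [pow_one] at h2
    rw [if_pos rfl, h1, Matrix.of_apply, if_pos rfl, h2]
    abel
  · simp [hl]

theorem index_range_colMat (m : ℕ) {n : ℕ} (j : Fin n) {a : Fin n → QOrd u π}
    (ha : ∀ i, j ≤ i → a i = 0) :
    (mulRightHom m (colMat j a)).range.index = resCard k ^ (2 * m) := by
  let f : Matrix (Fin m) (Fin n) (QOrd u π) →+ (Fin m → QOrd u π) :=
    { toFun := fun x t => x t j - x.mulVec a t
      map_zero' := by funext t; simp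
      map_add' := fun x y => by
        funext t
        rw [Matrix.add_mulVec]
        simp only [Matrix.add_apply, Pi.add_apply]
        abel }
  have hf : Function.Surjective f := by
    intro w
    refine ⟨Matrix.of fun t l => if l = j then w t else 0, ?_⟩
    funext t
    simp [f, Matrix.mulVec, dotProduct, ha j le_rfl]
  have hr : (mulRightHom m (colMat j a)).range =
      (AddSubgroup.pi Set.univ fun _ : Fin m => idealPow u π 1).comap f := by
    ext x
    rw [AddMonoidHom.mem_range, AddSubgroup.mem_comap, AddSubgroup.mem_pi]
    constructor
    · rintro ⟨y, rfl⟩ t -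
      change (y * colMat j a) t j - (y * colMat j a).mulVec a t ∈ _
      have h1 : (y * colMat j a).mulVec a t = y.mulVec a t :=
        mulVec_congr_of_lt (fun t l hl => by rw [mul_colMat_apply, if_neg hl.ne]) ha t
      rw [h1, mul_colMat_apply, if_pos rfl, add_sub_cancel_left]
      exact mem_idealPow_left.2 ⟨y t j, by rw [pow_one]⟩
    · intro hx
      choose w hw using fun t => mem_idealPow_left.1 (hx t trivial)
      exact ⟨_, replaceCol_mul_colMat ha hw⟩
  rw [hr, AddSubgroup.index_comap_of_surjective _ hf, AddSubgroup.index_pi]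
  simp only [index_idealPow, Finset.prod_const, Finset.card_univ, Fintype.card_fin]
  rw [← pow_mul]

/-- Representatives in the maximal order of a vector over `O / P`, extended by zero. -/
noncomputable def liftVec {n : ℕ} (j : Fin n) (a : Fin j → QOrd u π ⧸ idealPow u π 1) (i : Fin n) :
    QOrd u π :=
  if hi : (i : ℕ) < j then (a ⟨i, hi⟩).out else 0

theorem liftVec_of_le {n : ℕ} (j : Fin n) (a : Fin j → QOrd u π ⧸ idealPow u π 1) (i : Fin n)
    (hi : j ≤ i) : liftVec j a i = 0 := by
  rw [liftVec, dif_neg (by rw [Fin.le_def] at hi; omega)]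

theorem mk_liftVec {n : ℕ} (j : Fin n) (a : Fin j → QOrd u π ⧸ idealPow u π 1) (i : Fin n)
    (hi : (i : ℕ) < j) :
    (QuotientAddGroup.mk (liftVec j a i) : QOrd u π ⧸ idealPow u π 1) = a ⟨i, hi⟩ := by
  rw [liftVec, dif_pos hi]
  exact QuotientAddGroup.out_eq' _

theorem sub_mem_of_mk_eq {r : ℕ} {a b : QOrd u π}
    (hab : (QuotientAddGroup.mk a : QOrd u π ⧸ idealPow u π r) = QuotientAddGroup.mk b) :
    b - a ∈ idealPow u π r := by
  have := QuotientAddGroup.eq.1 hab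
  rwa [neg_add_eq_sub] at this

theorem mk_eq_of_sub_mem {r : ℕ} {a b : QOrd u π} (hab : b - a ∈ idealPow u π r) :
    (QuotientAddGroup.mk a : QOrd u π ⧸ idealPow u π r) = QuotientAddGroup.mk b := by
  rw [QuotientAddGroup.eq, neg_add_eq_sub]
  exact hab

theorem indepMod_mul_colMat {m n : ℕ} {j : Fin n} {a : Fin n → QOrd u π}
    {x : Matrix (Fin m) (Fin n) (QOrd u π)} (hx : IndepMod j x) :
    IndepMod j (x * colMat j a) :=
  indepMod_congr (fun t l hl => by
    rw [mul_colMat_apply, if_neg (fun hh => by rw [hh] at hl; exact lt_irrefl _ hl)]) hx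

/-- The matrices whose first `j` but not `j + 1` columns are independent modulo `P`. -/
theorem indepMod_diff_eq (m : ℕ) {n : ℕ} (j : Fin n) :
    {x : Matrix (Fin m) (Fin n) (QOrd u π) | IndepMod j x} \ {x | IndepMod (j + 1) x} =
      ⋃ a : Fin j → QOrd u π ⧸ idealPow u π 1,
        mulRightHom m (colMat j (liftVec j a)) '' {x | IndepMod j x} := by
  ext x
  simp only [Set.mem_sdiff, Set.mem_iUnion, Set.mem_image]
  constructor
  · rintro ⟨hx, hx'⟩
    obtain ⟨b, hb0, hb⟩ := exists_combination hx hx'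
    set a : Fin j → QOrd u π ⧸ idealPow u π 1 :=
      fun i => QuotientAddGroup.mk (b (Fin.castLE j.isLt.le i)) with ha
    have hdiff (i : Fin n) : b i - liftVec j a i ∈ idealPow u π 1 := by
      by_cases hi : (i : ℕ) < j
      · exact sub_mem_of_mk_eq (mk_liftVec j a i hi)
      · rw [hb0 i (Fin.le_def.2 (not_lt.1 hi)), liftVec_of_le j a i (Fin.le_def.2 (not_lt.1 hi)),
          sub_zero]
        exact AddSubgroup.zero_mem _
    have h1 (t : Fin m) : x t j - x.mulVec (liftVec j a) t ∈ idealPow u π 1 := by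
      have h2 : x t j - x.mulVec (liftVec j a) t =
          (x t j - x.mulVec b t) + x.mulVec (b - liftVec j a) t := by
        rw [Matrix.mulVec_sub, Pi.sub_apply]; abel
      rw [h2]
      exact AddSubgroup.add_mem _ (hb t) (mulVec_mem_idealPow x hdiff t)
    choose w hw using fun t => mem_idealPow_left.1 (h1 t)
    refine ⟨a, Matrix.of fun t l => if l = j then w t else x t l, ?_, ?_⟩
    · refine indepMod_congr (fun t l hl => ?_) hx
      rw [Matrix.of_apply, if_neg (fun hh => by rw [hh] at hl; exact lt_irrefl _ hl)]
    · exact replaceCol_mul_colMat (liftVec_of_le j a) hw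
  · rintro ⟨a, y, hy, rfl⟩
    refine ⟨indepMod_mul_colMat hy, fun hx => ?_⟩
    -- column `j` minus the combination given by `a` is divisible by `Π`
    set b := liftVec j a
    have hb0 : ∀ i, j ≤ i → b i = 0 := liftVec_of_le j a
    have h1 := hx (Pi.single j 1 - b) (fun i hi => ?_) (fun t => ?_) j
    · rw [Pi.sub_apply, hb0 j le_rfl, Pi.single_eq_same, sub_zero] at h1
      exact isUnit_iff_not_mem.1 isUnit_one h1
    · have hij : i ≠ j := fun hh => by rw [hh] at hi; omega
      rw [Pi.sub_apply, hb0 i (Fin.le_def.2 (by omega)), Pi.single_eq_of_ne hij, sub_zero]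
    · change (y * colMat j b).mulVec _ t ∈ _
      have h2 : (y * colMat j b).mulVec b t = y.mulVec b t :=
        mulVec_congr_of_lt (fun t l hl => by rw [mul_colMat_apply, if_neg hl.ne]) hb0 t
      rw [Matrix.mulVec_sub, Pi.sub_apply, h2, Matrix.mulVec_single_one]
      simp only [Matrix.col_apply]
      rw [mul_colMat_apply, if_pos rfl, add_sub_cancel_left]
      exact mem_idealPow_left.2 ⟨y t j, by rw [pow_one]⟩

theorem indepMod_image_disjoint (m : ℕ) {n : ℕ} (j : Fin n) :
    Pairwise (Function.onFun Disjoint fun a : Fin j → QOrd u π ⧸ idealPow u π 1 =>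
      mulRightHom m (colMat j (liftVec j a)) '' {x | IndepMod j x}) := by
  intro a b hab
  rw [Function.onFun, Set.disjoint_left]
  rintro _ ⟨x, hx, rfl⟩ ⟨y, hy, hxy⟩
  refine hab ?_
  have hent (t : Fin m) (l : Fin n) : (y * colMat j (liftVec j b)) t l =
      (x * colMat j (liftVec j a)) t l := congrFun (congrFun hxy t) l
  simp only [mul_colMat_apply] at hent
  have hne (t : Fin m) (l : Fin n) (hl : l < j) : y t l = x t l := by
    simpa [hl.ne] using hent t l
  have h1 := hx (liftVec j a - liftVec j b) (fun i hi => by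
    rw [Pi.sub_apply, liftVec_of_le j a i (Fin.le_def.2 hi), liftVec_of_le j b i (Fin.le_def.2 hi),
      sub_zero]) (fun t => by
    have h2 := hent t j
    rw [if_pos rfl, if_pos rfl, mulVec_congr_of_lt hne (liftVec_of_le j b) t] at h2
    have h3 : x.mulVec (liftVec j a - liftVec j b) t = (y t j - x t j) * primeElt u π := by
      rw [Matrix.mulVec_sub, Pi.sub_apply, sub_mul]
      exact sub_eq_sub_iff_add_eq_add.2 (by rw [← h2, add_comm])
    rw [h3]
    exact mem_idealPow_left.2 ⟨_, by rw [pow_one]⟩)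
  funext i
  have h2 := h1 (Fin.castLE j.isLt.le i)
  have e1 := mk_liftVec j a (Fin.castLE j.isLt.le i) i.isLt
  have e2 := mk_liftVec j b (Fin.castLE j.isLt.le i) i.isLt
  exact e1.symm.trans ((mk_eq_of_sub_mem h2).symm.trans e2)

theorem card_residueVec (j : ℕ) :
    Nat.card (Fin j → QOrd u π ⧸ idealPow u π 1) = resCard k ^ (2 * j) := by
  rw [Nat.card_fun, Nat.card_fin, ← AddSubgroup.index, index_idealPow, ← pow_mul]

instance finite_residueQuot : Finite (QOrd u π ⧸ idealPow u π 1) :=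
  Nat.finite_of_card_ne_zero (index_idealPow_ne_zero 1)

/-- For a function that is multiplied by `c` under the column operations that replace column `j` by
its multiple by `Π` plus a combination of the previous columns, passing from `j` to `j + 1`
independent columns multiplies the integral by `1 - q ^ (2 j - 2 m) c`. -/
theorem setIntegral_indepMod_succ {m n : ℕ} (j : Fin n) {F : Matrix (Fin m) (Fin n) (QOrd u π) → ℂ}
    (hF : Integrable F (vol u π m n)) {c : ℂ}
    (hc : ∀ a : Fin n → QOrd u π, (∀ i, j ≤ i → a i = 0) → ∀ x, F (x * colMat j a) = c * F x) :
    ∫ x in {x | IndepMod (j + 1) x}, F x ∂vol u π m n =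
      (1 - (resCard k : ℂ) ^ (2 * (j : ℤ) - 2 * (m : ℤ)) * c) *
        ∫ x in {x | IndepMod j x}, F x ∂vol u π m n := by
  have hq : (resCard k : ℂ) ≠ 0 := by
    have := one_lt_resCard u π
    exact_mod_cast (by omega : resCard k ≠ 0)
  have hsub : {x : Matrix (Fin m) (Fin n) (QOrd u π) | IndepMod (j + 1) x} ⊆ {x | IndepMod j x} :=
    fun x hx => indepMod_mono (Nat.le_succ _) hx
  have h1 := setIntegral_sdiff (measurableSet_indepMod m n (j + 1)) hF.integrableOn hsub
    (μ := vol u π m n) (f := F)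
  have hidx (a : Fin j → QOrd u π ⧸ idealPow u π 1) :
      (mulRightHom m (colMat j (liftVec j a))).range.index = resCard k ^ (2 * m) :=
    index_range_colMat m j (liftVec_of_le j a)
  have himg (a : Fin j → QOrd u π ⧸ idealPow u π 1) :
      ∫ x in mulRightHom m (colMat j (liftVec j a)) '' {x | IndepMod j x}, F x ∂vol u π m n =
        ((resCard k : ℂ) ^ (2 * m))⁻¹ * (c * ∫ x in {x | IndepMod j x}, F x ∂vol u π m n) := by
    rw [setIntegral_image (vol u π m n) _ (continuous_mulRightHom m _)
      (mulRightHom_colMat_injective m j (liftVec_of_le j a))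
      (by rw [hidx]; exact pow_ne_zero _ (by exact_mod_cast hq)), hidx]
    have h2 (x : Matrix (Fin m) (Fin n) (QOrd u π)) :
        F (mulRightHom m (colMat j (liftVec j a)) x) = c * F x := hc _ (liftVec_of_le j a) x
    simp only [h2]
    rw [integral_const_mul, Complex.real_smul]
    push_cast
    rfl
  have := Fintype.ofFinite (Fin j → QOrd u π ⧸ idealPow u π 1)
  rw [indepMod_diff_eq, integral_iUnion_fintype (fun a => by
      exact ((continuous_mulRightHom m _).isClosedEmbedding
        (mulRightHom_colMat_injective m j (liftVec_of_le j a))).measurableEmbedding.measurableSet_image.2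
        (measurableSet_indepMod m n j)) (indepMod_image_disjoint m j) (fun a => hF.integrableOn)] at h1
  simp only [himg, Finset.sum_const, Finset.card_univ, nsmul_eq_mul] at h1
  have hcard : (Fintype.card (Fin j → QOrd u π ⧸ idealPow u π 1) : ℂ) =
      (resCard k : ℂ) ^ (2 * (j : ℕ)) := by
    rw [← Nat.card_eq_fintype_card, card_residueVec]
    push_cast; rfl
  rw [hcard] at h1
  have hz : (resCard k : ℂ) ^ (2 * (j : ℤ) - 2 * (m : ℤ)) =
      (resCard k : ℂ) ^ (2 * (j : ℕ)) * ((resCard k : ℂ) ^ (2 * m))⁻¹ := by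
    rw [zpow_sub₀ hq, div_eq_mul_inv]
    norm_cast
  rw [hz]
  linear_combination h1

/-- The integral over the matrices whose columns are independent modulo `P`, for a function that is
homogeneous under the column operations: an Euler factor for each column. -/
theorem setIntegral_indepMod {m n : ℕ} {F : Matrix (Fin m) (Fin n) (QOrd u π) → ℂ}
    (hF : Integrable F (vol u π m n)) {c : Fin n → ℂ}
    (hc : ∀ j, ∀ a : Fin n → QOrd u π, (∀ i, j ≤ i → a i = 0) →
      ∀ x, F (x * colMat j a) = c j * F x) :
    ∫ x in {x | IndepMod n x}, F x ∂vol u π m n =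
      (∏ j : Fin n, (1 - (resCard k : ℂ) ^ (2 * (j : ℤ) - 2 * (m : ℤ)) * c j)) *
        ∫ x, F x ∂vol u π m n := by
  have key : ∀ j (hj : j ≤ n), ∫ x in {x | IndepMod j x}, F x ∂vol u π m n =
      (∏ i : Fin j, (1 - (resCard k : ℂ) ^ (2 * (i : ℤ) - 2 * (m : ℤ)) * c (Fin.castLE hj i))) *
        ∫ x, F x ∂vol u π m n := by
    intro j
    induction j with
    | zero =>
      intro _
      have : {x : Matrix (Fin m) (Fin n) (QOrd u π) | IndepMod 0 x} = Set.univ :=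
        Set.eq_univ_of_forall indepMod_zero
      rw [this]; simp
    | succ j ih =>
      intro hj
      rw [setIntegral_indepMod_succ ⟨j, hj⟩ hF (hc ⟨j, hj⟩), ih (by omega), Fin.prod_univ_castSucc]
      have : Fin.castLE hj (Fin.last j) = ⟨j, hj⟩ := rfl
      rw [this]
      simp only [Fin.val_castSucc, Fin.val_last]
      have h2 (i : Fin j) : Fin.castLE hj (Fin.castSucc i) = Fin.castLE (by omega) i := rfl
      simp only [h2]
      ring
  exact key n le_rfl

/-- The volume of the primitive matrices: the case of a constant function. -/
theorem measureReal_indepMod (m n : ℕ) :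
    (((vol u π m n).real {x | IndepMod n x} : ℝ) : ℂ) =
      ∏ j : Fin n, (1 - (resCard k : ℂ) ^ (2 * (j : ℤ) - 2 * (m : ℤ))) := by
  have h1 := setIntegral_indepMod (u := u) (π := π) (m := m) (n := n) (F := fun _ => (1 : ℂ))
    (integrable_const 1) (c := fun _ => 1) (fun _ _ _ _ => by simp)
  rw [setIntegral_const] at h1
  simpa using h1

end ColumnOperations

/-! ### Primitive matrices are independent modulo `P` -/

section Primitive

theorem EntriesIn.mul {l m n r s : ℕ} {x : Matrix (Fin l) (Fin m) (QOrd u π)}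
    {y : Matrix (Fin m) (Fin n) (QOrd u π)} (hx : EntriesIn r x) (hy : EntriesIn s y) :
    EntriesIn (r + s) (x * y) := by
  intro i j
  rw [Matrix.mul_apply]
  exact idealPow_sum_mem _ fun t _ => mul_mem_idealPow (hx i t) (hy t j)

theorem isUnit_one_add {m : ℕ} {p : Matrix (Fin m) (Fin m) (QOrd u π)} (hp : EntriesIn 1 p) :
    IsUnit (1 + p) := by
  -- by Nakayama's lemma, left multiplication by `1 + p` is surjective on column vectors
  let L : (Fin m → QOrd u π) →ₗ[𝒪[k]] (Fin m → QOrd u π) :=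
    { toFun := fun v => (1 + p).mulVec v
      map_add' := fun v w => Matrix.mulVec_add _ v w
      map_smul' := fun r v => Matrix.mulVec_smul _ r v }
  have hL : LinearMap.range L = ⊤ := by
    rw [eq_top_iff]
    refine Submodule.le_of_le_smul_of_le_jacobson_bot (I := IsLocalRing.maximalIdeal 𝒪[k])
      Module.Finite.fg_top (by rw [IsLocalRing.jacobson_eq_maximalIdeal ⊥ bot_ne_top]) ?_
    intro v _
    have h1 : (1 + p).mulVec (v - p.mulVec v) + p.mulVec (p.mulVec v) = v := by
      rw [Matrix.mulVec_sub, Matrix.add_mulVec, Matrix.add_mulVec, Matrix.one_mulVec,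
        Matrix.one_mulVec]
      abel
    have h2 : ∀ i, p.mulVec (p.mulVec v) i ∈ idealPow u π 2 := by
      intro i
      rw [Matrix.mulVec_mulVec]
      exact mulVec_mem_idealPow' (hp.mul hp) v i
    choose w hw using fun i => mem_idealPow.1 (h2 i)
    have h3 : p.mulVec (p.mulVec v) = π • w := by
      funext i
      rw [Pi.smul_apply, Algebra.smul_def, ← hw i]
      have := primeElt_pow_two_mul (u := u) (π := π) 1
      rw [mul_one, pow_one] at this
      rw [this]
    have h4 : π ∈ IsLocalRing.maximalIdeal 𝒪[k] :=
      (IsLocalRing.mem_maximalIdeal _).2 h.irreducible.not_isUnit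
    rw [h3] at h1
    exact Submodule.mem_sup.2
      ⟨(1 + p).mulVec (v - p.mulVec v), ⟨v - p.mulVec v, rfl⟩, π • w,
        Submodule.smul_mem_smul h4 trivial, h1⟩
  have hs : ∀ l : Fin m, ∃ v, (1 + p).mulVec v = Pi.single l 1 := fun l =>
    LinearMap.range_eq_top.1 hL (Pi.single l 1)
  choose v hv using hs
  refine IsUnit.of_mul_eq_one (Matrix.of fun i l => v l i) ?_
  ext1 i l
  have := congrFun (hv l) i
  rw [Matrix.one_apply]
  rw [Pi.single_apply] at this
  rw [← this]
  rfl

theorem indepMod_square_isUnit {m : ℕ} {z : Matrix (Fin m) (Fin m) (QOrd u π)}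
    (hz : IndepMod m z) : IsUnit z := by
  let f : (Fin m → QOrd u π ⧸ idealPow u π 1) → (Fin m → QOrd u π ⧸ idealPow u π 1) :=
    fun a t => QuotientAddGroup.mk (z.mulVec (fun i => (a i).out) t)
  have hinj : Function.Injective f := by
    intro a b hab
    have h1 := hz (fun i => (b i).out - (a i).out)
      (fun i hi => absurd i.isLt (not_lt.2 hi)) (fun t => by
        have h2 := sub_mem_of_mk_eq (congrFun hab t)
        have h3 : (fun i => (b i).out - (a i).out) =
          (fun i => (b i).out) - fun i => (a i).out := rfl
        rw [h3, Matrix.mulVec_sub]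
        exact h2)
    funext i
    rw [← QuotientAddGroup.out_eq' (a i), ← QuotientAddGroup.out_eq' (b i)]
    exact mk_eq_of_sub_mem (h1 i)
  have hsurj := Finite.surjective_of_injective hinj
  choose v hv using fun l : Fin m => hsurj fun i => QuotientAddGroup.mk (if i = l then 1 else 0)
  set V : Matrix (Fin m) (Fin m) (QOrd u π) := Matrix.of fun i l => (v l i).out
  have hV : EntriesIn 1 (z * V - 1) := by
    intro i l
    have h1 := sub_mem_of_mk_eq (congrFun (hv l) i)
    have h2 := AddSubgroup.neg_mem _ h1
    rw [neg_sub] at h2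
    rw [Matrix.sub_apply, Matrix.one_apply]
    exact h2
  have h1 := isUnit_one_add hV
  rw [add_sub_cancel] at h1
  obtain ⟨w, hw⟩ := h1
  refine IsUnit.of_mul_eq_one (V * (w⁻¹).val) ?_
  rw [← Matrix.mul_assoc, ← hw, w.mul_inv]

/-- A column can be added to `j < m` independent ones, by counting residue classes. -/
theorem exists_indepMod_succ {m : ℕ} {j : Fin m} {x : Matrix (Fin m) (Fin m) (QOrd u π)}
    (hx : IndepMod j x) : ∃ y : Matrix (Fin m) (Fin m) (QOrd u π),
      (∀ t, ∀ l < j, y t l = x t l) ∧ IndepMod (j + 1) y := by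
  by_contra! hall
  let f : (Fin j → QOrd u π ⧸ idealPow u π 1) → (Fin m → QOrd u π ⧸ idealPow u π 1) :=
    fun a t => QuotientAddGroup.mk (x.mulVec (liftVec j a) t)
  have hsurj : Function.Surjective f := by
    intro w
    set y : Matrix (Fin m) (Fin m) (QOrd u π) :=
      Matrix.of fun t l => if l = j then (w t).out else x t l with hy
    have hyx : ∀ t, ∀ l < j, y t l = x t l := fun t l hl => by simp [hy, hl.ne]
    have hyj : IndepMod j y := indepMod_congr (fun t l hl => (hyx t l (Fin.lt_def.2 hl)).symm) hx
    obtain ⟨b, hb0, hb⟩ := exists_combination hyj (hall y hyx)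
    refine ⟨fun i => QuotientAddGroup.mk (b (Fin.castLE j.isLt.le i)), ?_⟩
    set a : Fin j → QOrd u π ⧸ idealPow u π 1 :=
      fun i => QuotientAddGroup.mk (b (Fin.castLE j.isLt.le i)) with ha
    funext t
    have hdiff (i : Fin m) : b i - liftVec j a i ∈ idealPow u π 1 := by
      by_cases hi : (i : ℕ) < j
      · exact sub_mem_of_mk_eq (mk_liftVec j a i hi)
      · rw [hb0 i (Fin.le_def.2 (not_lt.1 hi)), liftVec_of_le j a i (Fin.le_def.2 (not_lt.1 hi)),
          sub_zero]
        exact AddSubgroup.zero_mem _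
    rw [← QuotientAddGroup.out_eq' (w t)]
    refine mk_eq_of_sub_mem ?_
    have h1 := hb t
    have h2 : y t j = (w t).out := by simp [hy]
    rw [h2, mulVec_congr_of_lt hyx hb0 t] at h1
    have h3 : (w t).out - x.mulVec (liftVec j a) t =
        ((w t).out - x.mulVec b t) + x.mulVec (b - liftVec j a) t := by
      rw [Matrix.mulVec_sub, Pi.sub_apply]; abel
    rw [h3]
    exact AddSubgroup.add_mem _ h1 (mulVec_mem_idealPow x hdiff t)
  have h1 := Nat.card_le_card_of_surjective f hsurj
  rw [card_residueVec, card_residueVec] at h1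
  have h2 := Nat.pow_lt_pow_right (one_lt_resCard u π) (show 2 * (j : ℕ) < 2 * m by omega)
  omega

/-- The first `n` columns of the identity matrix of size `m`. -/
noncomputable def firstCols (u π : 𝒪[k]) (m n : ℕ) : Matrix (Fin m) (Fin n) (QOrd u π) :=
  Matrix.of fun (i : Fin m) (j : Fin n) => if (i : ℕ) = j then (1 : QOrd u π) else 0

theorem mul_firstCols {m n l : ℕ} (hmn : n ≤ m) (g : Matrix (Fin l) (Fin m) (QOrd u π)) (t : Fin l)
    (i : Fin n) : (g * firstCols u π m n) t i = g t (Fin.castLE hmn i) := by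
  rw [Matrix.mul_apply, Finset.sum_eq_single (Fin.castLE hmn i)]
  · simp [firstCols]
  · intro b _ hb
    have : (b : ℕ) ≠ i := fun hh => hb (Fin.ext hh)
    simp [firstCols, this]
  · simp

theorem isPrimitive_iff_indepMod {m n : ℕ} (hmn : n ≤ m) (x : Matrix (Fin m) (Fin n) (QOrd u π)) :
    IsPrimitive x ↔ IndepMod n x := by
  constructor
  · rintro ⟨g, rfl⟩ c - hm i
    change ∀ t, (g.val * firstCols u π m n).mulVec c t ∈ _ at hm
    rw [← Matrix.mulVec_mulVec] at hm
    have h1 := mulVec_mem_idealPow (g⁻¹).val hm (Fin.castLE hmn i)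
    rw [Matrix.mulVec_mulVec, g.inv_mul, Matrix.one_mulVec] at h1
    have h2 : (firstCols u π m n).mulVec c (Fin.castLE hmn i) = c i := by
      rw [Matrix.mulVec, dotProduct, Finset.sum_eq_single i]
      · simp [firstCols]
      · intro b _ hb
        have : (i : ℕ) ≠ b := fun hh => hb (Fin.ext hh.symm)
        simp [firstCols, this]
      · simp
    rwa [h2] at h1
  · intro hx
    have key : ∀ j, n ≤ j → j ≤ m → ∃ z : Matrix (Fin m) (Fin m) (QOrd u π),
        (∀ t (l : Fin n), z t (Fin.castLE hmn l) = x t l) ∧ IndepMod j z := by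
      intro j hj
      induction j, hj using Nat.le_induction with
      | base =>
        intro _
        refine ⟨Matrix.of fun t l => if hl : (l : ℕ) < n then x t ⟨l, hl⟩ else 0, ?_, ?_⟩
        · intro t l; simp
        · intro c hc hm
          have h1 := hx (fun l => c (Fin.castLE hmn l)) (fun l hl => absurd l.isLt (not_lt.2 hl))
            (fun t => by
              have h2 := hm t
              convert h2 using 1
              simp only [Matrix.mulVec, dotProduct]
              refine Fintype.sum_of_injective (Fin.castLE hmn) (Fin.castLE_injective _) _ _
                (fun l hl => ?_) fun l => by simp
              rw [hc l, mul_zero]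
              by_contra hlt
              exact hl ⟨⟨l, not_le.1 hlt⟩, rfl⟩)
          intro i
          by_cases hi : (i : ℕ) < n
          · exact h1 ⟨i, hi⟩
          · rw [hc i (not_lt.1 hi)]; exact AddSubgroup.zero_mem _
      | succ j hj ih =>
        intro hjm
        obtain ⟨z, hz, hzj⟩ := ih (by omega)
        obtain ⟨y, hy, hyj⟩ := exists_indepMod_succ (j := ⟨j, hjm⟩) hzj
        refine ⟨y, fun t l => ?_, hyj⟩
        rw [hy t _ (Fin.lt_def.2 (by have := l.isLt; simp; omega)), hz]
    obtain ⟨z, hz, hzm⟩ := key m hmn le_rfl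
    obtain ⟨g, rfl⟩ := indepMod_square_isUnit hzm
    refine ⟨g, ?_⟩
    ext1 t l
    exact ((mul_firstCols hmn g.val t l).trans (hz t l)).symm

end Primitive

end

section

/-! ### Degenerate matrices form a null set -/

section NullSet

/-- A set that meets every progression `u + N z` in a finite set is null, by Poincaré recurrence. -/
theorem measure_eq_zero_of_finite_progression {G : Type*} [AddCommGroup G] [MeasurableSpace G]
    [MeasurableAdd G] (μ : Measure G) [IsFiniteMeasure μ] [μ.IsAddRightInvariant] {S : Set G}
    (hS : MeasurableSet S) (z : G) (hfin : ∀ u, {N : ℕ | u + N • z ∈ S}.Finite) : μ S = 0 := by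
  have hcons := (measurePreserving_add_right μ z).conservative
  have hrec := hcons.ae_mem_imp_frequently_image_mem hS.nullMeasurableSet
  have hiter (N : ℕ) (u : G) : (fun x => x + z)^[N] u = u + N • z := by
    simp
  rw [measure_eq_zero_iff_ae_notMem]
  filter_upwards [hrec] with u hu huS
  have h1 := hu huS
  rw [Nat.frequently_atTop_iff_infinite] at h1
  refine h1 ?_
  simpa only [hiter] using hfin u

/-- If `φ (det C) ≠ 0` then `φ (det (A + N B + N² C))` vanishes only for finitely many `N`: up to a
power of `N` it is a polynomial in `1 / N` with constant coefficient `φ (det C)`. -/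
theorem finite_det_progression {F R ι : Type*} [Field F] [CharZero F] [CommRing R] [Algebra F R]
    (φ : R →ₗ[F] F) [Fintype ι] [DecidableEq ι] (A B C : Matrix ι ι R) (hC : φ C.det ≠ 0) :
    {N : ℕ | φ (A + N • B + (N ^ 2) • C).det = 0}.Finite := by
  classical
  set p : Polynomial R := ((Polynomial.X ^ 2 : Polynomial R) • A.map Polynomial.C +
    (Polynomial.X : Polynomial R) • B.map Polynomial.C + C.map Polynomial.C).det with hp
  have hpe (τ : R) : p.eval τ = (τ ^ 2 • A + τ • B + C).det := by
    rw [hp, ← Polynomial.coe_evalRingHom, RingHom.map_det]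
    congr 1
    ext i j
    simp only [RingHom.mapMatrix_apply, Matrix.map_apply, Matrix.add_apply, Matrix.smul_apply,
      smul_eq_mul, map_add, Polynomial.coe_evalRingHom, Polynomial.eval_mul, Polynomial.eval_pow,
      Polynomial.eval_X, Polynomial.eval_C]
  set q : Polynomial F := ∑ i ∈ Finset.range (p.natDegree + 1),
    Polynomial.monomial i (φ (p.coeff i)) with hq
  have hqe (t : F) : q.eval t = φ (p.eval (algebraMap F R t)) := by
    rw [hq, Polynomial.eval_finsetSum, Polynomial.eval_eq_sum_range, map_sum]
    refine Finset.sum_congr rfl fun i _ => ?_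
    rw [Polynomial.eval_monomial, ← map_pow, mul_comm (p.coeff i), ← Algebra.smul_def, map_smul,
      smul_eq_mul, mul_comm]
  have hq0 : q ≠ 0 := by
    intro h0
    have := hqe 0
    rw [h0, hpe] at this
    simp at this
    exact hC this.symm
  have hinj : Function.Injective fun N : ℕ => ((N : F))⁻¹ := fun a b hab =>
    Nat.cast_injective (inv_injective hab)
  refine ((Set.finite_singleton 0).union
    ((q.roots.toFinset.finite_toSet).preimage hinj.injOn)).subset ?_
  intro N hN
  rcases Nat.eq_zero_or_pos N with h0 | hpos
  · exact Or.inl h0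
  right
  rw [Set.mem_preimage, Finset.mem_coe, Multiset.mem_toFinset, Polynomial.mem_roots hq0,
    Polynomial.IsRoot.def, hqe, hpe]
  have hNF : (N : F) ≠ 0 := by exact_mod_cast hpos.ne'
  set τ := algebraMap F R (N : F)⁻¹ with hτ
  have hNτ : (N : R) * τ = 1 := by
    rw [hτ, ← map_natCast (algebraMap F R), ← map_mul, mul_inv_cancel₀ hNF, map_one]
  have h1 : A + N • B + (N ^ 2) • C = ((N : R) ^ 2) • (τ ^ 2 • A + τ • B + C) := by
    rw [smul_add, smul_add, smul_smul, smul_smul, ← mul_pow, hNτ, one_pow, one_smul,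
      pow_two (N : R), mul_assoc, hNτ, mul_one, ← pow_two, ← Nat.cast_pow]
    congr 1
    · congr 1
      exact (Nat.cast_smul_eq_nsmul R N B).symm
    · exact (Nat.cast_smul_eq_nsmul R _ C).symm
  have h2 : φ (A + N • B + (N ^ 2) • C).det = 0 := hN
  rw [h1, Matrix.det_smul, ← map_natCast (algebraMap F R), ← map_pow, ← map_pow,
    ← Algebra.smul_def, map_smul, smul_eq_zero] at h2
  exact h2.resolve_left (pow_ne_zero _ (pow_ne_zero _ hNF))

variable {k : Type*} [NontriviallyNormedField k] [IsUltrametricDist k] {u π : 𝒪[k]}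

/-- The image in `M₂ᵢ₊₂(k')` of the upper left block of size `i + 1`. -/
noncomputable def blockSplitting (u π : 𝒪[k]) {n : ℕ} (i : Fin n) :
    Matrix (Fin n) (Fin n) (QOrd u π) →+
      Matrix (Fin (i + 1) × Fin 2) (Fin (i + 1) × Fin 2) (QuadExt u) where
  toFun Y := splittingMat (block (Y.map (toD u π)) i)
  map_zero' := by
    ext1 p r
    change splittingHom u π (toD u π 0) _ _ = 0
    rw [map_zero, map_zero]; rfl
  map_add' Y Z := by
    ext1 p r
    change splittingHom u π (toD u π (_ + _)) _ _ = _
    rw [map_add, map_add]; rfl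

/-- The first coordinate of an element of `k'`. -/
noncomputable def quadRe (u : 𝒪[k]) : QuadExt u →ₗ[k] k where
  toFun z := z.re
  map_add' _ _ := rfl
  map_smul' _ _ := rfl

theorem finite_minorNorm_progression [CharZero k] {m n : ℕ} (x : Matrix (Fin m) (Fin m) (QOrd u π))
    (i : Fin n) {z : Matrix (Fin m) (Fin n) (QOrd u π)} (hz : minorNorm (zᴴ * x * z) i ≠ 0)
    (y : Matrix (Fin m) (Fin n) (QOrd u π)) :
    {N : ℕ | minorNorm ((y + N • z)ᴴ * x * (y + N • z)) i = 0}.Finite := by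
  have h1 := finite_det_progression (quadRe u) (blockSplitting u π i (yᴴ * x * y))
    (blockSplitting u π i (yᴴ * x * z + zᴴ * x * y)) (blockSplitting u π i (zᴴ * x * z)) hz
  convert h1 using 3 with N
  have h2 : (y + N • z)ᴴ * x * (y + N • z) =
      yᴴ * x * y + N • (yᴴ * x * z + zᴴ * x * y) + N ^ 2 • (zᴴ * x * z) := by
    rw [Matrix.conjTranspose_add, Matrix.conjTranspose_nsmul]
    simp only [Matrix.add_mul, Matrix.mul_add, Matrix.smul_mul, Matrix.mul_smul,
      smul_add, smul_smul, pow_two]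
    abel
  rw [h2, ← map_nsmul, ← map_nsmul, ← map_add, ← map_add]
  rfl

instance instContinuousStarQOrd : ContinuousStar (QOrd u π) := by
  obtain ⟨c0, c1, c2, c3⟩ := continuous_coords u π
  refine ⟨continuous_of_coords ?_ ?_ ?_ ?_⟩
  · simpa using c0
  · simp only [QuaternionAlgebra.imI_star]; exact c1.neg
  · simp only [QuaternionAlgebra.imJ_star]; exact c2.neg
  · simp only [QuaternionAlgebra.imK_star]; exact c3.neg

theorem continuous_gram {m n : ℕ} (x : Matrix (Fin m) (Fin m) (QOrd u π)) :
    Continuous fun y : Matrix (Fin m) (Fin n) (QOrd u π) => yᴴ * x * y :=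
  ((Continuous.matrix_conjTranspose continuous_id).matrix_mul continuous_const).matrix_mul
    continuous_id

theorem measure_minorNorm_eq_zero [ProperSpace k] [CharZero k] {m n : ℕ}
    (x : Matrix (Fin m) (Fin m) (QOrd u π)) (i : Fin n) {z : Matrix (Fin m) (Fin n) (QOrd u π)}
    (hz : minorNorm (zᴴ * x * z) i ≠ 0) :
    vol u π m n {y | minorNorm (yᴴ * x * y) i = 0} = 0 := by
  refine measure_eq_zero_of_finite_progression _ ?_ z fun y => finite_minorNorm_progression x i hz y
  have h1 : Continuous fun y : Matrix (Fin m) (Fin n) (QOrd u π) => minorNorm (yᴴ * x * y) i :=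
    (continuous_minorNorm i).comp (continuous_gram x)
  exact (isClosed_singleton.preimage h1).measurableSet

/-! ### Diagonalisation over the field -/

/-- `x` is the Gram matrix of a form that has an orthogonal basis in the lattice with nonzero
values. -/
def Diagonalizable {n : ℕ} (x : Matrix (Fin n) (Fin n) (QOrd u π)) : Prop :=
  ∃ (Z : Matrix (Fin n) (Fin n) (QOrd u π)) (d : Fin n → 𝒪[k]), (∀ i, d i ≠ 0) ∧
    Zᴴ * x * Z = Matrix.diagonal fun i => algebraMap 𝒪[k] (QOrd u π) (d i)

theorem Diagonalizable.blockSum {n p : ℕ} {x : Matrix (Fin n) (Fin n) (QOrd u π)}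
    {y : Matrix (Fin p) (Fin p) (QOrd u π)} (hx : Diagonalizable x) (hy : Diagonalizable y) :
    Diagonalizable (blockSum x y) := by
  obtain ⟨Z, d, hd, hZ⟩ := hx
  obtain ⟨W, e, he, hW⟩ := hy
  refine ⟨QuatHerm.blockSum Z W, Fin.append d e, fun i => ?_, ?_⟩
  · induction i using Fin.addCases with
    | left i => simpa using hd i
    | right i => simpa using he i
  · rw [conjTranspose_blockSum]
    simp only [QuatHerm.blockSum]
    rw [Matrix.submatrix_mul_equiv, Matrix.submatrix_mul_equiv, Matrix.fromBlocks_multiply,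
      Matrix.fromBlocks_multiply]
    simp only [Matrix.mul_zero, Matrix.zero_mul, add_zero, zero_add, hZ, hW]
    ext1 i j
    induction i using Fin.addCases with
    | left i =>
      induction j using Fin.addCases with
      | left j => simp [Matrix.diagonal_apply]
      | right j => simp [Matrix.diagonal_apply, Fin.ext_iff]; omega
    | right i =>
      induction j using Fin.addCases with
      | left j => simp [Matrix.diagonal_apply, Fin.ext_iff]; omega
      | right j => simp [Matrix.diagonal_apply, Fin.ext_iff]

theorem diagonalizable_odd_block [StandardPair u π] [ProperSpace k] (e : ℕ) :
    Diagonalizable !![0, algebraMap 𝒪[k] (QOrd u π) (π ^ e) * primeElt u π;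
      -(algebraMap 𝒪[k] (QOrd u π) (π ^ e) * primeElt u π), 0] := by
  have h2 : (2 : 𝒪[k]) ≠ 0 := (isUnit_two u π).ne_zero
  have hne : (2 : 𝒪[k]) * π ^ (e + 1) ≠ 0 := mul_ne_zero h2 (pow_ne_zero _ (pi_ne_zero u π))
  refine ⟨!![1, 1; primeElt u π, -primeElt u π], ![2 * π ^ (e + 1), -(2 * π ^ (e + 1))], ?_, ?_⟩
  · intro i
    fin_cases i
    · exact hne
    · exact neg_ne_zero.2 hne
  · have h3 : algebraMap 𝒪[k] (QOrd u π) (2 * π ^ (e + 1)) =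
        2 * (algebraMap 𝒪[k] (QOrd u π) (π ^ e) * algebraMap 𝒪[k] (QOrd u π) π) := by
      rw [map_mul, pow_succ, map_mul, map_ofNat]
    have h4 : primeElt u π * (algebraMap 𝒪[k] (QOrd u π) (π ^ e) * primeElt u π) =
        algebraMap 𝒪[k] (QOrd u π) (π ^ e) * algebraMap 𝒪[k] (QOrd u π) π := by
      rw [← mul_assoc, ← algebraMap_comm, mul_assoc, primeElt_mul_self]
    have h5 : (fun i => algebraMap 𝒪[k] (QOrd u π) (![2 * π ^ (e + 1), -(2 * π ^ (e + 1))] i)) =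
        ![algebraMap 𝒪[k] (QOrd u π) (2 * π ^ (e + 1)),
          -algebraMap 𝒪[k] (QOrd u π) (2 * π ^ (e + 1))] := by
      funext i
      fin_cases i
      · rfl
      · exact map_neg _ _
    rw [h5, h3]
    have h6 := primeElt_mul_self (u := u) (π := π)
    clear h2 h3 h5 hne
    generalize algebraMap 𝒪[k] (QOrd u π) (π ^ e) = c at *
    generalize algebraMap 𝒪[k] (QOrd u π) π = a at *
    ext1 i j
    fin_cases i <;> fin_cases j <;>
      simp [Matrix.mul_apply, Fin.sum_univ_two, star_primeElt, mul_assoc, h4, h6, two_mul,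
        add_comm]

theorem diagonalizable_piMat [StandardPair u π] [ProperSpace k] (n : ℕ) (α : Fin n → ℕ)
    (hα : α ∈ lambdaPlus n) : Diagonalizable (piMat u π α) := by
  refine lambdaPlus_induction (motive := fun n α => Diagonalizable (piMat u π α)) ?_ ?_ ?_ n α hα
  · intro α
    exact ⟨1, Fin.elim0, fun i => i.elim0, by ext1 i; exact i.elim0⟩
  · intro n α e _ _ hd
    rw [piMat_append_even]
    refine hd.blockSum ⟨1, fun _ => π ^ e, fun _ => pow_ne_zero _ (pi_ne_zero u π), ?_⟩
    ext1 i j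
    rw [Subsingleton.elim i 0, Subsingleton.elim j 0]
    simp
  · intro n α e hα _ hd
    rw [piMat_append_odd u π α e hα]
    exact hd.blockSum (diagonalizable_odd_block e)

theorem Diagonalizable.exists_minorNorm_ne_zero {m n : ℕ} (hmn : n ≤ m)
    {x : Matrix (Fin m) (Fin m) (QOrd u π)} (hx : Diagonalizable x) (i : Fin n) :
    ∃ z : Matrix (Fin m) (Fin n) (QOrd u π), minorNorm (zᴴ * x * z) i ≠ 0 := by
  obtain ⟨Z, d, hd, hZ⟩ := hx
  refine ⟨Z.submatrix id (Fin.castLE hmn), ?_⟩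
  have h1 : (Z.submatrix id (Fin.castLE hmn))ᴴ * x * Z.submatrix id (Fin.castLE hmn) =
      Matrix.diagonal fun i => algebraMap 𝒪[k] (QOrd u π) (d (Fin.castLE hmn i)) := by
    have h2 : (Z.submatrix id (Fin.castLE hmn))ᴴ * x * Z.submatrix id (Fin.castLE hmn) =
        (Zᴴ * x * Z).submatrix (Fin.castLE hmn) (Fin.castLE hmn) := rfl
    rw [h2, hZ, Matrix.submatrix_diagonal _ _ (Fin.castLE_injective hmn)]
    rfl
  rw [h1, minorNorm, redNorm, det_splittingMat_of_upper]
  · have h3 (l : Fin (i + 1)) : (splitting (block ((Matrix.diagonal fun i =>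
        algebraMap 𝒪[k] (QOrd u π) (d (Fin.castLE hmn i))).map (toD u π)) i l l)).det =
        algebraMap k (QuadExt u) ((d (Fin.castLE hmn (Fin.castLE i.isLt l)) : k) ^ 2) := by
      have h4 : block ((Matrix.diagonal fun i =>
        algebraMap 𝒪[k] (QOrd u π) (d (Fin.castLE hmn i))).map (toD u π)) i l l =
        toD u π (algebraMap 𝒪[k] (QOrd u π) (d (Fin.castLE hmn (Fin.castLE i.isLt l)))) := by
        simp [block]
      rw [h4, det_splitting]
      rw [QuadraticAlgebra.algebraMap_eq]
      simp [toD]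
    simp only [h3]
    rw [← map_prod]
    change (∏ l : Fin (i + 1), (d (Fin.castLE hmn (Fin.castLE i.isLt l)) : k) ^ 2) ≠ 0
    refine Finset.prod_ne_zero_iff.2 fun l _ => pow_ne_zero _ ?_
    exact fun h0 => hd _ (Subtype.ext h0)
  · intro a b hab
    have : Fin.castLE i.isLt a ≠ Fin.castLE i.isLt b := fun hh =>
      hab.ne' (Fin.castLE_injective _ hh)
    simp [block, Matrix.diagonal_apply_ne _ this]

/-- For almost all `y` all leading minors of `yᴴ π^ξ y` are nonzero. -/
theorem ae_minorNorm_ne_zero [ProperSpace k] [CharZero k] [StandardPair u π] {m n : ℕ}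
    (hmn : n ≤ m) {ξ : Fin m → ℕ} (hξ : ξ ∈ lambdaPlus m) :
    ∀ᵐ y ∂vol u π m n, ∀ i, minorNorm (yᴴ * piMat u π ξ * y) i ≠ 0 := by
  rw [ae_all_iff]
  intro i
  obtain ⟨z, hz⟩ := (diagonalizable_piMat (u := u) (π := π) m ξ hξ).exists_minorNorm_ne_zero hmn i
  have := measure_minorNorm_eq_zero (u := u) (π := π) (piMat u π ξ) i hz
  rw [measure_eq_zero_iff_ae_notMem] at this
  exact this

end NullSet

end

section

variable {k : Type*} [NontriviallyNormedField k] [IsUltrametricDist k] {u π : 𝒪[k]}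

/-! ### Averages over the orbits -/

section Orbits

variable [ProperSpace k] [StandardPair u π]

theorem continuous_conj_left {n : ℕ} (B : Matrix (Fin n) (Fin n) (QOrd u π)) :
    Continuous fun g : maxCompact u π n => g.val * B * (g.val)ᴴ :=
  (Units.continuous_val.matrix_mul continuous_const).matrix_mul
    Units.continuous_val.matrix_conjTranspose

theorem measurableSet_cong {n : ℕ} (B : Matrix (Fin n) (Fin n) (QOrd u π)) :
    MeasurableSet {y | Cong B y} := by
  have h1 : {y | Cong B y} = Set.range fun g : maxCompact u π n => g.val * B * (g.val)ᴴ := by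
    ext y
    exact exists_congr fun g => eq_comm
  rw [h1]
  exact (isCompact_range (continuous_conj_left B)).isClosed.measurableSet

theorem Cong.congr_right {n : ℕ} {B y z : Matrix (Fin n) (Fin n) (QOrd u π)} (hyz : Cong y z) :
    Cong B z ↔ Cong B y := ⟨fun hz => hz.trans hyz.symm, fun hy => hy.trans hyz⟩

/-- Integrals over a set that `Φ` maps equivariantly to the orbit of `B`. -/
theorem setIntegral_orbit {n : ℕ} {Y E : Type*} [MeasurableSpace Y] [NormedAddCommGroup E]
    [NormedSpace ℝ E] [CompleteSpace E] (ν : Measure Y) [IsFiniteMeasure ν]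
    {T : maxCompact u π n → Y → Y} (hT : Measurable (Function.uncurry T))
    (hpres : ∀ g, MeasurePreserving (T g) ν ν) {Φ : Y → Matrix (Fin n) (Fin n) (QOrd u π)}
    (hΦ : Measurable Φ) (hΦT : ∀ g y, Φ (T g y) = g.val * Φ y * (g.val)ᴴ) {S : Set Y}
    (hS : MeasurableSet S) (hTS : ∀ g y, T g y ∈ S ↔ y ∈ S)
    {B : Matrix (Fin n) (Fin n) (QOrd u π)} (hB : ∀ y ∈ S, Cong B (Φ y))
    {f : Matrix (Fin n) (Fin n) (QOrd u π) → E} (hf : StronglyMeasurable f) {C : ℝ}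
    (hb : ∀ y, ‖f y‖ ≤ C) :
    ∫ y in S, f (Φ y) ∂ν = ν.real S • ∫ g, f (g.val * B * (g.val)ᴴ) ∂haarK u π n := by
  refine setIntegral_eq_of_average (haarK u π n) ν hT hpres hS hTS (hf.comp_measurable hΦ)
    (fun y => hb _) fun y hy => ?_
  obtain ⟨g₀, hg₀⟩ := hB y hy
  have h1 (g : maxCompact u π n) : f (Φ (T g y)) =
      (fun g : maxCompact u π n => f (g.val * B * (g.val)ᴴ)) (g * g₀) := by
    simp only [hΦT, hg₀, Units.val_mul, Matrix.conjTranspose_mul, Matrix.mul_assoc]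
  refine (integral_congr_ae (Eventually.of_forall h1)).trans ?_
  exact integral_mul_right_eq_self (fun g : maxCompact u π n => f (g.val * B * (g.val)ᴴ)) g₀

/-- The action of `Kₙ` on `m × n` matrices by `u ↦ u gᴴ`. -/
noncomputable def rightAct (m : ℕ) {n : ℕ} (g : maxCompact u π n)
    (x : Matrix (Fin m) (Fin n) (QOrd u π)) : Matrix (Fin m) (Fin n) (QOrd u π) :=
  x * (g.val)ᴴ

theorem measurable_rightAct (m n : ℕ) :
    Measurable (Function.uncurry (rightAct (u := u) (π := π) (n := n) m)) := by
  have h1 : Continuous fun p : maxCompact u π n × Matrix (Fin m) (Fin n) (QOrd u π) =>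
      p.2 * (p.1.val)ᴴ :=
    continuous_snd.matrix_mul (Units.continuous_val.comp continuous_fst).matrix_conjTranspose
  exact h1.measurable

theorem mul_conjTranspose_cancel {n : ℕ} (g : maxCompact u π n) :
    ((g⁻¹).val)ᴴ * (g.val)ᴴ = 1 := by
  rw [← Matrix.conjTranspose_mul, g.mul_inv, Matrix.conjTranspose_one]

theorem measurePreserving_rightAct (m : ℕ) {n : ℕ} (g : maxCompact u π n) :
    MeasurePreserving (rightAct m g) (vol u π m n) (vol u π m n) := by
  refine measurePreserving_of_surjective (vol u π m n) (mulRightHom m (g.val)ᴴ)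
    (continuous_mulRightHom m _) fun x => ⟨x * ((g⁻¹).val)ᴴ, ?_⟩
  change x * ((g⁻¹).val)ᴴ * (g.val)ᴴ = x
  rw [Matrix.mul_assoc, mul_conjTranspose_cancel, Matrix.mul_one]

theorem gram_rightAct {m n : ℕ} (A : Matrix (Fin m) (Fin m) (QOrd u π)) (g : maxCompact u π n)
    (x : Matrix (Fin m) (Fin n) (QOrd u π)) :
    (rightAct m g x)ᴴ * A * rightAct m g x = g.val * (xᴴ * A * x) * (g.val)ᴴ := by
  simp [rightAct, Matrix.conjTranspose_mul, Matrix.mul_assoc]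

/-- The integral over the part of `W` that is mapped to the orbit of `B` by `x ↦ xᴴ A x`. -/
theorem setIntegral_gram {m n : ℕ} {E : Type*} [NormedAddCommGroup E]
    [NormedSpace ℝ E] [CompleteSpace E] (A : Matrix (Fin m) (Fin m) (QOrd u π))
    (B : Matrix (Fin n) (Fin n) (QOrd u π)) {W : Set (Matrix (Fin m) (Fin n) (QOrd u π))}
    (hW : MeasurableSet W) (hTW : ∀ g x, rightAct m g x ∈ W ↔ x ∈ W)
    {f : Matrix (Fin n) (Fin n) (QOrd u π) → E} (hf : StronglyMeasurable f) {C : ℝ}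
    (hb : ∀ y, ‖f y‖ ≤ C) :
    ∫ x in W ∩ {x | Cong B (xᴴ * A * x)}, f (xᴴ * A * x) ∂vol u π m n =
      (vol u π m n).real (W ∩ {x | Cong B (xᴴ * A * x)}) •
        ∫ g, f (g.val * B * (g.val)ᴴ) ∂haarK u π n := by
  refine setIntegral_orbit (vol u π m n) (measurable_rightAct m n) (measurePreserving_rightAct m)
    (Φ := fun x => xᴴ * A * x) (continuous_gram A).measurable (gram_rightAct A)
    (hW.inter ((continuous_gram A).measurable (measurableSet_cong B))) (fun g x => ?_)
    (fun x hx => hx.2) hf hb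
  refine and_congr (hTW g x) ?_
  change Cong B ((rightAct m g x)ᴴ * A * rightAct m g x) ↔ _
  rw [gram_rightAct]
  exact Cong.congr_right ⟨g, rfl⟩

/-- The part of an invariant set that is mapped to `D`. -/
theorem measureReal_orbit {n : ℕ} {Y : Type*} [MeasurableSpace Y] (ν : Measure Y)
    [IsFiniteMeasure ν] {T : maxCompact u π n → Y → Y} (hT : Measurable (Function.uncurry T))
    (hpres : ∀ g, MeasurePreserving (T g) ν ν) {Φ : Y → Matrix (Fin n) (Fin n) (QOrd u π)}
    (hΦ : Measurable Φ) (hΦT : ∀ g y, Φ (T g y) = g.val * Φ y * (g.val)ᴴ) {S : Set Y}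
    (hS : MeasurableSet S) (hTS : ∀ g y, T g y ∈ S ↔ y ∈ S)
    {B : Matrix (Fin n) (Fin n) (QOrd u π)} (hB : ∀ y ∈ S, Cong B (Φ y))
    {D : Set (Matrix (Fin n) (Fin n) (QOrd u π))} (hD : MeasurableSet D) :
    ν.real (S ∩ Φ ⁻¹' D) =
      ν.real S * (haarK u π n).real {g | g.val * B * (g.val)ᴴ ∈ D} := by
  have h1 := setIntegral_orbit ν hT hpres hΦ hΦT hS hTS hB
    (f := D.indicator fun _ => (1 : ℝ)) (stronglyMeasurable_const.indicator hD) (C := 1)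
    (fun y => by
      by_cases hy : y ∈ D
      · simp [hy]
      · simp [hy])
  have h2 : ∫ y in S, D.indicator (fun _ => (1 : ℝ)) (Φ y) ∂ν = ν.real (S ∩ Φ ⁻¹' D) := by
    have h3 : (fun y => D.indicator (fun _ => (1 : ℝ)) (Φ y)) =
        (Φ ⁻¹' D).indicator fun _ => (1 : ℝ) := rfl
    rw [h3, setIntegral_indicator (hΦ hD), setIntegral_const, smul_eq_mul, mul_one]
  have h4 : ∫ g, D.indicator (fun _ => (1 : ℝ)) (g.val * B * (g.val)ᴴ) ∂haarK u π n =
      (haarK u π n).real {g | g.val * B * (g.val)ᴴ ∈ D} := by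
    have h3 : (fun g : maxCompact u π n =>
        D.indicator (fun _ => (1 : ℝ)) (g.val * B * (g.val)ᴴ)) =
        ((fun g : maxCompact u π n => g.val * B * (g.val)ᴴ) ⁻¹' D).indicator fun _ => (1 : ℝ) := rfl
    rw [h3, integral_indicator ((continuous_conj_left B).measurable hD), setIntegral_const,
      smul_eq_mul, mul_one]
    rfl
  rw [← h2, h1, h4, smul_eq_mul]

end Orbits

/-! ### The group of hermitian matrices -/

section Hermitian

/-- The additive group of hermitian matrices over the maximal order. -/
def hermGroup (u π : 𝒪[k]) (n : ℕ) : AddSubgroup (Matrix (Fin n) (Fin n) (QOrd u π)) where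
  carrier := {y | yᴴ = y}
  zero_mem' := Matrix.conjTranspose_zero
  add_mem' := fun {a b} (ha : aᴴ = a) (hb : bᴴ = b) => by
    change (a + b)ᴴ = a + b
    rw [Matrix.conjTranspose_add, ha, hb]
  neg_mem' := fun {a} (ha : aᴴ = a) => by
    change (-a)ᴴ = -a
    rw [Matrix.conjTranspose_neg, ha]

theorem isClosed_hermGroup (n : ℕ) :
    IsClosed (hermGroup u π n : Set (Matrix (Fin n) (Fin n) (QOrd u π))) :=
  isClosed_eq (Continuous.matrix_conjTranspose continuous_id) continuous_id

instance instCompactHerm [ProperSpace k] (n : ℕ) : CompactSpace (hermGroup u π n) :=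
  isCompact_iff_compactSpace.1 (isClosed_hermGroup n).isCompact

/-- The normalized Haar measure on the group of hermitian matrices. -/
noncomputable def hermVol [ProperSpace k] (u π : 𝒪[k]) (n : ℕ) : Measure (hermGroup u π n) :=
  Measure.addHaarMeasure ⊤

instance instHaarHermVol [ProperSpace k] (n : ℕ) : (hermVol u π n).IsAddHaarMeasure := by
  unfold hermVol; infer_instance

instance instProbHermVol [ProperSpace k] (n : ℕ) : IsProbabilityMeasure (hermVol u π n) :=
  ⟨Measure.addHaarMeasure_self⟩

/-- The action `y ↦ g y gᴴ` on hermitian matrices. -/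
noncomputable def conjHom {n : ℕ} (g : maxCompact u π n) : hermGroup u π n →+ hermGroup u π n where
  toFun y := ⟨g.val * y.val * (g.val)ᴴ, by
    have hy : (y.val)ᴴ = y.val := y.2
    change (_)ᴴ = _
    simp [Matrix.conjTranspose_mul, hy, Matrix.mul_assoc]⟩
  map_zero' := Subtype.ext (by simp)
  map_add' a b := Subtype.ext (by simp [Matrix.mul_add, Matrix.add_mul])

theorem continuous_uncurry_conjHom [ProperSpace k] (n : ℕ) : Continuous (Function.uncurry
    fun (g : maxCompact u π n) (y : hermGroup u π n) => conjHom g y) := by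
  have h1 : Continuous fun p : maxCompact u π n × hermGroup u π n => p.1.val :=
    Units.continuous_val.comp continuous_fst
  have h2 : Continuous fun p : maxCompact u π n × hermGroup u π n => p.2.val :=
    continuous_subtype_val.comp continuous_snd
  exact ((h1.matrix_mul h2).matrix_mul h1.matrix_conjTranspose).subtype_mk _

theorem measurePreserving_conjHom [ProperSpace k] [StandardPair u π] {n : ℕ} (g : maxCompact u π n) :
    MeasurePreserving (conjHom g) (hermVol u π n) (hermVol u π n) := by
  have hc : Continuous (conjHom g) :=
    ((continuous_const.matrix_mul continuous_subtype_val).matrix_mul continuous_const).subtype_mk _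
  refine measurePreserving_of_surjective _ _ hc fun y => ⟨conjHom g⁻¹ y, Subtype.ext ?_⟩
  change g.val * ((g⁻¹).val * y.val * ((g⁻¹).val)ᴴ) * (g.val)ᴴ = y.val
  rw [Matrix.mul_assoc, Matrix.mul_assoc, Matrix.mul_assoc, mul_conjTranspose_cancel,
    Matrix.mul_one, ← Matrix.mul_assoc, g.mul_inv, Matrix.one_mul]

/-- The hermitian matrices with entries in `P ^ r`. -/
noncomputable def hermIdeal (u π : 𝒪[k]) (n r : ℕ) : AddSubgroup (hermGroup u π n) :=
  (matIdeal u π n n r).comap (hermGroup u π n).subtype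

theorem mem_hermIdeal {n r : ℕ} {y : hermGroup u π n} :
    y ∈ hermIdeal u π n r ↔ EntriesIn r y.val := Iff.rfl

theorem index_span_pow [ProperSpace k] [StandardPair u π] (l : ℕ) :
    (Ideal.span {π ^ l}).toAddSubgroup.index = resCard k ^ l := by
  have hm : IsLocalRing.maximalIdeal 𝒪[k] = Ideal.span {π} :=
    (StandardPair.irreducible u).maximalIdeal_eq
  have := instDVR (k := k)
  have h1 : Submodule.cardQuot (IsLocalRing.maximalIdeal 𝒪[k] ^ l) =
      Submodule.cardQuot (IsLocalRing.maximalIdeal 𝒪[k]) ^ l :=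
    cardQuot_pow_of_prime (by rw [hm]; simpa using pi_ne_zero u π)
  rw [hm, Ideal.span_singleton_pow] at h1
  rw [← hm] at h1
  exact h1

theorem index_pi_dep {ι : Type*} [Fintype ι] {G : ι → Type*} [∀ i, AddGroup (G i)]
    (H : ∀ i, AddSubgroup (G i)) : (AddSubgroup.pi Set.univ H).index = ∏ i, (H i).index := by
  simp_rw [AddSubgroup.index, ← Nat.card_pi]
  refine Nat.card_congr
    ((Quotient.congrRight fun x y => ?_).trans (Setoid.piQuotientEquiv _).symm)
  rw [QuotientAddGroup.leftRel_apply, AddSubgroup.mem_pi]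
  simp only [Set.mem_univ, forall_const]
  exact forall_congr' fun i => QuotientAddGroup.leftRel_apply.symm

/-- Each of the `n (n - 1) / 2` entries above the diagonal is arbitrary and contributes
`q ^ (2 (2 l + 1))`; each diagonal entry lies in the ring of integers, where `P ^ (2 l + 1)` cuts
out the ideal generated by `π ^ (l + 1)`. -/
theorem index_hermIdeal [ProperSpace k] [CharZero k] [StandardPair u π] (n l : ℕ) :
    (hermIdeal u π n (2 * l + 1)).index =
      resCard k ^ ((2 * l + 1) * (n * (n - 1)) + (l + 1) * n) := by
  let f : hermGroup u π n →+ (∀ i : Fin n, (Fin i → QOrd u π) × 𝒪[k]) :=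
    { toFun := fun y i => (fun j => y.val (Fin.castLE i.isLt.le j) i, (y.val i i).re)
      map_zero' := rfl
      map_add' := fun _ _ => rfl }
  have hf : Function.Surjective f := by
    intro w
    let y : Matrix (Fin n) (Fin n) (QOrd u π) := Matrix.of fun a b =>
      if hab : a < b then (w b).1 ⟨a, hab⟩ else if hba : b < a then star ((w a).1 ⟨b, hba⟩)
        else algebraMap 𝒪[k] (QOrd u π) (w a).2
    have hy : yᴴ = y := by
      ext1 a b
      rw [Matrix.conjTranspose_apply]
      rcases lt_trichotomy a b with hab | hab | hab
      · simp [y, hab, hab.not_gt]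
      · subst hab
        simp [y]
      · simp [y, hab, hab.not_gt]
    refine ⟨⟨y, hy⟩, ?_⟩
    funext i
    refine Prod.ext ?_ ?_
    · funext j
      have : Fin.castLE i.isLt.le j < i := Fin.lt_def.2 j.isLt
      change y _ _ = _
      simp [y, this]
    · change (y i i).re = _
      simp [y]
  have hc : hermIdeal u π n (2 * l + 1) = (AddSubgroup.pi Set.univ fun i : Fin n =>
      (AddSubgroup.pi Set.univ fun _ : Fin i => idealPow u π (2 * l + 1)).prod
        (Ideal.span {π ^ (l + 1)}).toAddSubgroup).comap f := by
    ext y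
    rw [mem_hermIdeal, AddSubgroup.mem_comap, AddSubgroup.mem_pi]
    have hstar (a b : Fin n) : star (y.val b a) = y.val a b := congrFun (congrFun y.2 a) b
    have hdiag (i : Fin n) : y.val i i ∈ idealPow u π (2 * l + 1) ↔ π ^ (l + 1) ∣ (y.val i i).re := by
      have h1 := eq_algebraMap_of_star_eq (hstar i i)
      have h2 : (2 * l + 1 + 1) / 2 = l + 1 := by omega
      rw [mem_idealPow_iff, h2]
      constructor
      · exact fun hh => hh.1.1
      · intro hh
        refine ⟨⟨hh, ?_⟩, ?_, ?_⟩ <;> rw [h1] <;> simp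
    constructor
    · intro hy i _
      rw [AddSubgroup.mem_prod, AddSubgroup.mem_pi]
      exact ⟨fun j _ => hy _ _, Ideal.mem_span_singleton.2 ((hdiag i).1 (hy i i))⟩
    · intro hy a b
      rcases lt_trichotomy a b with hab | hab | hab
      · exact (hy b trivial).1 ⟨a, hab⟩ trivial
      · subst hab
        exact (hdiag a).2 (Ideal.mem_span_singleton.1 (hy a trivial).2)
      · rw [← hstar]
        exact star_mem_idealPow ((hy a trivial).1 ⟨b, hab⟩ trivial)
  rw [hc, AddSubgroup.index_comap_of_surjective _ hf, index_pi_dep]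
  simp only [AddSubgroup.index_prod, AddSubgroup.index_pi, index_idealPow, index_span_pow (u := u),
    Finset.prod_const, Finset.card_univ, Fintype.card_fin]
  simp only [← pow_mul, ← pow_add]
  rw [Finset.prod_pow_eq_pow_sum, Finset.sum_add_distrib, Finset.sum_const, Finset.card_univ,
    Fintype.card_fin, ← Finset.mul_sum, Fin.sum_univ_eq_sum_range (fun i => i) n]
  have := Finset.sum_range_id_mul_two n
  congr 1
  rw [← this, smul_eq_mul]
  ring

end Hermitian

end

section

variable {k : Type*} [NontriviallyNormedField k] [IsUltrametricDist k] {u π : 𝒪[k]}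
variable [ProperSpace k] [h : StandardPair u π]

/-! ### Local densities -/

section Densities

theorem reduction_eq_iff {m n l : ℕ} {x y : Matrix (Fin m) (Fin n) (QOrd u π)} :
    reduction l x = reduction l y ↔ y - x ∈ matIdeal u π m n (2 * l) := by
  constructor
  · intro hxy i j
    exact sub_mem_of_mk_eq (congrFun (congrFun hxy i) j)
  · intro hxy
    ext1 i j
    exact mk_eq_of_sub_mem (hxy i j)

instance finite_quotIdealPow (r : ℕ) : Finite (QOrd u π ⧸ idealPow u π r) :=
  Nat.finite_of_card_ne_zero (index_idealPow_ne_zero r)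

/-- The volume of a union of residue classes modulo `P ^ (2 l)`. -/
theorem measureReal_eq_ncard {m n : ℕ} (l : ℕ) {S : Set (Matrix (Fin m) (Fin n) (QOrd u π))}
    (hS : ∀ x ∈ S, ∀ y ∈ matIdeal u π m n (2 * l), x + y ∈ S) :
    (vol u π m n).real S =
      (reduction l '' S).ncard * ((resCard k : ℝ) ^ (2 * (2 * l) * m * n))⁻¹ := by
  have hfin : (reduction l '' S).Finite := by
    have : Finite (Matrix (Fin m) (Fin n) (QOrd u π ⧸ idealPow u π (2 * l))) :=
      inferInstanceAs (Finite (Fin m → Fin n → _))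
    exact Set.toFinite _
  have hH := (isOpen_matIdeal (u := u) (π := π) m n (2 * l)).measurableSet
  have hfib (x : Matrix (Fin m) (Fin n) (QOrd u π)) :
      reduction l ⁻¹' {reduction l x} = (fun y => y + -x) ⁻¹' (matIdeal u π m n (2 * l) : Set _) := by
    ext y
    rw [Set.mem_preimage, Set.mem_singleton_iff, eq_comm, reduction_eq_iff, sub_eq_add_neg]
    rfl
  have hvol (x : Matrix (Fin m) (Fin n) (QOrd u π)) :
      (vol u π m n).real (reduction l ⁻¹' {reduction l x}) =
        ((resCard k : ℝ) ^ (2 * (2 * l) * m * n))⁻¹ := by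
    rw [hfib, measureReal_def, measure_preimage_add_right, ← measureReal_def,
      measureReal_addSubgroup _ _ hH, index_matIdeal]
    · push_cast; rfl
    · rw [index_matIdeal]
      exact pow_ne_zero _ (by have := one_lt_resCard u π; omega)
  have hU : S = ⋃ c ∈ hfin.toFinset, reduction l ⁻¹' {c} := by
    ext y
    simp only [Set.mem_iUnion, Set.Finite.mem_toFinset, Set.mem_preimage, Set.mem_singleton_iff,
      exists_prop, exists_eq_right', Set.mem_image]
    constructor
    · exact fun hy => ⟨y, hy, rfl⟩
    · rintro ⟨x, hx, hxy⟩
      have := hS x hx _ (reduction_eq_iff.1 hxy)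
      rwa [add_sub_cancel] at this
  rw [Set.ncard_eq_toFinset_card _ hfin]
  conv_lhs => rw [hU]
  rw [measureReal_biUnion_finset]
  · rw [Finset.sum_congr rfl (g := fun _ => ((resCard k : ℝ) ^ (2 * (2 * l) * m * n))⁻¹)]
    · rw [Finset.sum_const, nsmul_eq_mul]
    · intro c hc
      obtain ⟨x, -, rfl⟩ := hfin.mem_toFinset.1 hc
      exact hvol x
  · intro a _ b _ hab
    exact Disjoint.preimage _ (by simpa using hab)
  · intro c hc
    obtain ⟨x, -, rfl⟩ := hfin.mem_toFinset.1 hc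
    rw [hfib]
    exact measurable_add_const _ hH

theorem Represents.add {m n l : ℕ} {B : Matrix (Fin n) (Fin n) (QOrd u π)}
    {A : Matrix (Fin m) (Fin m) (QOrd u π)} {x y : Matrix (Fin m) (Fin n) (QOrd u π)}
    (hx : Represents B A l x) (hy : EntriesIn (2 * l) y) : Represents B A l (x + y) := by
  have hy' : EntriesIn (2 * l - 1) y := fun i j => idealPow_anti (by omega) (hy i j)
  have h1 : (x + y)ᴴ * A * (x + y) - B =
      (xᴴ * A * x - B) + ((xᴴ * A) * y + yᴴ * (A * (x + y))) := by
    simp only [Matrix.conjTranspose_add, Matrix.add_mul, Matrix.mul_add, Matrix.mul_assoc]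
    abel
  intro i j
  rw [h1]
  exact AddSubgroup.add_mem _ (hx i j) (AddSubgroup.add_mem _ (hy'.mul_left _ i j)
    (hy'.conjTranspose.mul_right _ i j))

theorem conjTranspose_gram {m n : ℕ} {A : Matrix (Fin m) (Fin m) (QOrd u π)} (hA : Aᴴ = A)
    (x : Matrix (Fin m) (Fin n) (QOrd u π)) : (xᴴ * A * x)ᴴ = xᴴ * A * x := by
  simp [Matrix.conjTranspose_mul, hA, Matrix.mul_assoc]

variable [CharZero k]

/-- The orbit of `π^α` in the group of hermitian matrices. -/
def hermOrbit (u π : 𝒪[k]) {n : ℕ} (α : Fin n → ℕ) : Set (hermGroup u π n) :=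
  {y | Cong (piMat u π α) y.val}

theorem measurableSet_entriesIn_sub {n r : ℕ} (B : Matrix (Fin n) (Fin n) (QOrd u π)) :
    MeasurableSet {y : Matrix (Fin n) (Fin n) (QOrd u π) | EntriesIn r (y - B)} := by
  have : {y : Matrix (Fin n) (Fin n) (QOrd u π) | EntriesIn r (y - B)} =
      (fun y => y + -B) ⁻¹' (matIdeal u π n n r : Set _) := by
    ext y; rw [Set.mem_preimage, ← sub_eq_add_neg]; rfl
  rw [this]
  exact measurable_add_const _ (isOpen_matIdeal _ _ _).measurableSet

/-- The volume of a small residue class of `π^α` among the hermitian matrices. -/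
theorem inv_index_hermIdeal {n : ℕ} {α : Fin n → ℕ} (hα : α ∈ lambdaPlus n) {l : ℕ}
    (hl : ∀ i, α i < 2 * l + 1) :
    ((hermIdeal u π n (2 * l + 1)).index : ℝ)⁻¹ = (hermVol u π n).real (hermOrbit u π α) *
      (haarK u π n).real {g | g.val * piMat u π α * (g.val)ᴴ ∈
        {y | EntriesIn (2 * l + 1) (y - piMat u π α)}} := by
  have hB : (piMat u π α)ᴴ = piMat u π α := conjTranspose_piMat hα
  have h2 := measureReal_orbit (hermVol u π n) (continuous_uncurry_conjHom n).measurable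
    measurePreserving_conjHom (Φ := Subtype.val) measurable_subtype_coe (fun _ _ => rfl)
    (S := hermOrbit u π α) (measurable_subtype_coe (measurableSet_cong _))
    (fun g y => Cong.congr_right ⟨g, rfl⟩) (fun y hy => hy)
    (measurableSet_entriesIn_sub (r := 2 * l + 1) (piMat u π α))
  have hHm : MeasurableSet (hermIdeal u π n (2 * l + 1) : Set (hermGroup u π n)) :=
    measurable_subtype_coe (isOpen_matIdeal n n (2 * l + 1)).measurableSet
  rw [← h2, ← measureReal_addSubgroup (hermVol u π n) _ hHm]
  · have h4 : hermOrbit u π α ∩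
        Subtype.val ⁻¹' {y | EntriesIn (2 * l + 1) (y - piMat u π α)} =
        (fun y => y + -(⟨piMat u π α, hB⟩ : hermGroup u π n)) ⁻¹'
        (hermIdeal u π n (2 * l + 1) : Set (hermGroup u π n)) := by
      ext y
      have h5 : y + -(⟨piMat u π α, hB⟩ : hermGroup u π n) ∈ hermIdeal u π n (2 * l + 1) ↔
          EntriesIn (2 * l + 1) (y.val - piMat u π α) := by
        rw [← sub_eq_add_neg]; rfl
      constructor
      · exact fun hy => h5.2 hy.2
      · exact fun hy => ⟨cong_of_close hα hl y.2 (h5.1 hy), h5.1 hy⟩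
    rw [h4, measureReal_def, measureReal_def, measure_preimage_add_right]
  · rw [index_hermIdeal]
    exact pow_ne_zero _ (by have := one_lt_resCard u π; omega)

theorem measureReal_hermOrbit_ne_zero {n : ℕ} {α : Fin n → ℕ} (hα : α ∈ lambdaPlus n) :
    (hermVol u π n).real (hermOrbit u π α) ≠ 0 := by
  have h1 := inv_index_hermIdeal (u := u) (π := π) hα (l := ∑ i, α i) (fun i => by
    have := Finset.single_le_sum (f := α) (fun i _ => Nat.zero_le _) (Finset.mem_univ i)
    omega)
  refine left_ne_zero_of_mul (h1.symm.trans_ne (inv_ne_zero ?_))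
  rw [index_hermIdeal]
  have := one_lt_resCard u π
  exact_mod_cast pow_ne_zero _ (by omega)

/-- The counting quotient for the representations in `W` is constant from the level on at which the
orbit of `π^α` contains its whole residue class. -/
theorem ncard_div_densityNorm {m n : ℕ} {A : Matrix (Fin m) (Fin m) (QOrd u π)} (hA : Aᴴ = A)
    {α : Fin n → ℕ} (hα : α ∈ lambdaPlus n) {W : Set (Matrix (Fin m) (Fin n) (QOrd u π))}
    (hW : MeasurableSet W) (hTW : ∀ g x, rightAct m g x ∈ W ↔ x ∈ W)
    (hW1 : ∀ x ∈ W, ∀ y, EntriesIn 1 y → x + y ∈ W) {l : ℕ} (hl : ∀ i, α i < 2 * l + 1) :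
    ((reduction (l + 1) '' (W ∩ {x | Represents (piMat u π α) A (l + 1) x})).ncard : ℝ) /
        densityNorm k m n (l + 1) =
      (vol u π m n).real (W ∩ {x | Cong (piMat u π α) (xᴴ * A * x)}) /
        (hermVol u π n).real (hermOrbit u π α) := by
  set B := piMat u π α with hBdef
  set D : Set (Matrix (Fin n) (Fin n) (QOrd u π)) := {y | EntriesIn (2 * l + 1) (y - B)} with hDdef
  have hD : MeasurableSet D := measurableSet_entriesIn_sub B
  set σ := (haarK u π n).real {g | g.val * B * (g.val)ᴴ ∈ D} with hσ
  -- the volume of the representations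
  have h1 : (vol u π m n).real (W ∩ {x | Represents B A (l + 1) x}) =
      (vol u π m n).real (W ∩ {x | Cong B (xᴴ * A * x)}) * σ := by
    have h2 := measureReal_orbit (vol u π m n) (measurable_rightAct m n)
      (measurePreserving_rightAct m) (Φ := fun x => xᴴ * A * x) (continuous_gram A).measurable
      (gram_rightAct A) (S := W ∩ {x | Cong B (xᴴ * A * x)})
      (hW.inter ((continuous_gram A).measurable (measurableSet_cong B)))
      (fun g x => by
        refine and_congr (hTW g x) ?_
        change Cong B ((rightAct m g x)ᴴ * A * rightAct m g x) ↔ _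
        rw [gram_rightAct]
        exact Cong.congr_right ⟨g, rfl⟩) (fun x hx => hx.2) hD
    rw [← h2]
    congr 1
    ext x
    constructor
    · exact fun hx => ⟨⟨hx.1, cong_of_close hα hl (conjTranspose_gram hA x) hx.2⟩, hx.2⟩
    · exact fun hx => ⟨hx.1.1, hx.2⟩
  have h3 := inv_index_hermIdeal (u := u) (π := π) hα hl
  rw [← hBdef, ← hDdef, ← hσ] at h3
  have h6 := measureReal_eq_ncard (l + 1) (S := W ∩ {x | Represents B A (l + 1) x})
    (fun x hx y hy => ⟨hW1 x hx.1 y fun i j => idealPow_anti (by omega) (hy i j), hx.2.add hy⟩)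
  rw [h1] at h6
  rw [index_hermIdeal] at h3
  have hq : (resCard k : ℝ) ≠ 0 := by
    have := one_lt_resCard u π
    exact_mod_cast (by omega : resCard k ≠ 0)
  have hnorm : densityNorm k m n (l + 1) = (resCard k : ℝ) ^ (2 * (2 * (l + 1)) * m * n) *
      ((resCard k : ℝ) ^ ((2 * l + 1) * (n * (n - 1)) + (l + 1) * n))⁻¹ := by
    rw [densityNorm, ← zpow_natCast, ← zpow_natCast, ← zpow_neg, ← zpow_add₀ hq]
    congr 1
    rcases n with _ | n
    · simp
    · push_cast
      ring
  push_cast at h3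
  rw [hnorm, h3]
  have hne : (hermVol u π n).real (hermOrbit u π α) * σ ≠ 0 := by
    rw [← h3]
    exact inv_ne_zero (pow_ne_zero _ hq)
  have hq' : (resCard k : ℝ) ^ (2 * (2 * (l + 1)) * m * n) ≠ 0 := pow_ne_zero _ hq
  rw [eq_mul_inv_iff_mul_eq₀ hq'] at h6
  rw [← h6]
  have h7 := left_ne_zero_of_mul hne
  have h8 := right_ne_zero_of_mul hne
  field_simp

theorem tendsto_ncard_div {m n : ℕ} {A : Matrix (Fin m) (Fin m) (QOrd u π)} (hA : Aᴴ = A)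
    {α : Fin n → ℕ} (hα : α ∈ lambdaPlus n) {W : Set (Matrix (Fin m) (Fin n) (QOrd u π))}
    (hW : MeasurableSet W) (hTW : ∀ g x, rightAct m g x ∈ W ↔ x ∈ W)
    (hW1 : ∀ x ∈ W, ∀ y, EntriesIn 1 y → x + y ∈ W) :
    Tendsto (fun l => ((reduction l '' (W ∩ {x | Represents (piMat u π α) A l x})).ncard : ℝ) /
        densityNorm k m n l) atTop
      (𝓝 ((vol u π m n).real (W ∩ {x | Cong (piMat u π α) (xᴴ * A * x)}) /
        (hermVol u π n).real (hermOrbit u π α))) := by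
  refine tendsto_atTop_of_eventually_const (i₀ := ∑ i, α i + 1) fun l hl => ?_
  obtain ⟨l, rfl⟩ : ∃ l', l = l' + 1 := ⟨l - 1, by omega⟩
  refine ncard_div_densityNorm hA hα hW hTW hW1 fun i => ?_
  have := Finset.single_le_sum (f := α) (fun i _ => Nat.zero_le _) (Finset.mem_univ i)
  omega

theorem tendsto_densityRatio {m n : ℕ} {A : Matrix (Fin m) (Fin m) (QOrd u π)} (hA : Aᴴ = A)
    {α : Fin n → ℕ} (hα : α ∈ lambdaPlus n) :
    Tendsto (densityRatio (piMat u π α) A) atTop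
      (𝓝 ((vol u π m n).real {x | Cong (piMat u π α) (xᴴ * A * x)} /
        (hermVol u π n).real (hermOrbit u π α))) := by
  have h1 := tendsto_ncard_div hA hα MeasurableSet.univ (fun _ _ => Iff.rfl)
    (fun _ _ _ _ => trivial)
  simp only [Set.univ_inter] at h1
  exact h1

theorem indepMod_rightAct {m n : ℕ} (g : maxCompact u π n)
    {x : Matrix (Fin m) (Fin n) (QOrd u π)} (hx : IndepMod n x) : IndepMod n (rightAct m g x) := by
  intro c _ hm
  have h1 := hx ((g.val)ᴴ.mulVec c) (fun i hi => absurd i.isLt (not_lt.2 hi)) (fun t => by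
    rw [Matrix.mulVec_mulVec]; exact hm t)
  intro i
  have h2 := mulVec_mem_idealPow ((g⁻¹).val)ᴴ h1 i
  rwa [Matrix.mulVec_mulVec, mul_conjTranspose_cancel, Matrix.one_mulVec] at h2

theorem indepMod_rightAct_iff {m n : ℕ} (g : maxCompact u π n)
    (x : Matrix (Fin m) (Fin n) (QOrd u π)) : IndepMod n (rightAct m g x) ↔ IndepMod n x := by
  refine ⟨fun hx => ?_, indepMod_rightAct g⟩
  have h1 := indepMod_rightAct g⁻¹ hx
  have h2 : rightAct m g⁻¹ (rightAct m g x) = x := by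
    rw [rightAct, rightAct, Matrix.mul_assoc, ← Matrix.conjTranspose_mul, g.inv_mul,
      Matrix.conjTranspose_one, Matrix.mul_one]
  rwa [h2] at h1

theorem tendsto_densityRatioPr {m n : ℕ} (hmn : n ≤ m) {A : Matrix (Fin m) (Fin m) (QOrd u π)}
    (hA : Aᴴ = A) {α : Fin n → ℕ} (hα : α ∈ lambdaPlus n) :
    Tendsto (densityRatioPr (piMat u π α) A) atTop
      (𝓝 ((vol u π m n).real ({x | IndepMod n x} ∩ {x | Cong (piMat u π α) (xᴴ * A * x)}) /
        (hermVol u π n).real (hermOrbit u π α))) := by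
  have h1 := tendsto_ncard_div hA hα (measurableSet_indepMod m n n) indepMod_rightAct_iff
    (fun _ hx _ hy => hx.add hy)
  have h2 : densityRatioPr (piMat u π α) A = fun l =>
      ((reduction l '' ({x | IndepMod n x} ∩ {x | Represents (piMat u π α) A l x})).ncard : ℝ) /
        densityNorm k m n l := by
    funext l
    rw [densityRatioPr, repCountPr]
    simp only [isPrimitive_iff_indepMod hmn]
    rfl
  rw [h2]
  exact h1

/-- Matrices whose Gram matrix with respect to `π^α` is in the orbit of `π^α` are invertible: the
vectors that the two matrices map into `P ^ r` have the same index, so `x` is surjective modulo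
`P`. -/
theorem isUnit_of_cong_gram {n : ℕ} {α : Fin n → ℕ} (hα : α ∈ lambdaPlus n)
    {x : Matrix (Fin n) (Fin n) (QOrd u π)}
    (hx : Cong (piMat u π α) (xᴴ * piMat u π α * x)) : IsUnit x := by
  set B := piMat u π α
  set r := ∑ i, α i + 1
  have hr (i : Fin n) : α i + 1 ≤ r := by
    have := Finset.single_le_sum (f := α) (fun i _ => Nat.zero_le _) (Finset.mem_univ i)
    omega
  let f : (Fin n → QOrd u π) →+ (Fin n → QOrd u π) :=
    { toFun := fun v => x.mulVec v
      map_zero' := by simp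
      map_add' := fun v w => Matrix.mulVec_add _ _ _ }
  have hne : (kerMod r B).index ≠ 0 := by
    rw [index_kerMod_piMat hα]
    exact pow_ne_zero _ (by have := one_lt_resCard u π; omega)
  have h1 : (kerMod r B).comap f ≤ kerMod r (xᴴ * B * x) := by
    intro v hv i
    have h2 : ∀ i, B.mulVec (x.mulVec v) i ∈ idealPow u π r := hv
    rw [← Matrix.mulVec_mulVec, ← Matrix.mulVec_mulVec]
    exact mulVec_mem_idealPow xᴴ h2 i
  have h3 : (kerMod r B).relIndex f.range = (kerMod r B).index := by
    refine le_antisymm (Nat.le_of_dvd (Nat.pos_of_ne_zero hne)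
      (AddSubgroup.relIndex_dvd_index_of_normal _ _)) ?_
    have h4 := AddSubgroup.index_comap (kerMod r B) f
    rw [← h4, ← hx.index_kerMod]
    refine Nat.le_of_dvd (Nat.pos_of_ne_zero ?_) (AddSubgroup.index_dvd_of_le h1)
    rw [h4]
    intro h0
    have := AddSubgroup.relIndex_dvd_index_of_normal (kerMod r B) f.range
    rw [h0] at this
    exact hne (Nat.eq_zero_of_zero_dvd this)
  have h5 : f.range ⊔ kerMod r B = ⊤ := by
    rw [← AddSubgroup.index_eq_one]
    have h6 := AddSubgroup.relIndex_mul_index (le_sup_right : kerMod r B ≤ f.range ⊔ kerMod r B)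
    rw [AddSubgroup.relIndex_sup_right, h3] at h6
    exact Nat.eq_of_mul_eq_mul_left (Nat.pos_of_ne_zero hne) (h6.trans (mul_one _).symm)
  have h7 : ∀ w : Fin n → QOrd u π, ∃ v, ∀ i, w i - x.mulVec v i ∈ idealPow u π 1 := by
    intro w
    have hw : w ∈ f.range ⊔ kerMod r B := by rw [h5]; trivial
    obtain ⟨_, ⟨v, rfl⟩, z, hz, rfl⟩ := AddSubgroup.mem_sup.1 hw
    refine ⟨v, fun i => ?_⟩
    have h8 := (mem_kerMod_piMat hα r z).1 hz i
    have h9 : (f v + z) i - x.mulVec v i = z i := by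
      change x.mulVec v i + z i - x.mulVec v i = z i
      abel
    rw [h9]
    exact idealPow_anti (by have := hr i; omega) h8
  choose v hv using fun l : Fin n => h7 (Pi.single l 1)
  set V : Matrix (Fin n) (Fin n) (QOrd u π) := Matrix.of fun i l => v l i
  have hV : EntriesIn 1 (x * V - 1) := by
    intro i l
    have h10 := AddSubgroup.neg_mem _ (hv l i)
    rw [neg_sub, Pi.single_apply] at h10
    rw [Matrix.sub_apply, Matrix.one_apply]
    exact h10
  have h11 := isUnit_one_add hV
  rw [add_sub_cancel] at h11
  obtain ⟨w, hw⟩ := h11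
  refine IsUnit.of_mul_eq_one (V * (w⁻¹).val) ?_
  rw [← Matrix.mul_assoc, ← hw, w.mul_inv]

theorem cong_gram_iff_indepMod {n : ℕ} {α : Fin n → ℕ} (hα : α ∈ lambdaPlus n)
    (x : Matrix (Fin n) (Fin n) (QOrd u π)) :
    Cong (piMat u π α) (xᴴ * piMat u π α * x) ↔ IndepMod n x := by
  constructor
  · intro hx
    obtain ⟨g, rfl⟩ := isUnit_of_cong_gram hα hx
    intro c _ hm i
    have h1 := mulVec_mem_idealPow (g⁻¹).val hm i
    rwa [Matrix.mulVec_mulVec, g.inv_mul, Matrix.one_mulVec] at h1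
  · intro hx
    obtain ⟨g, rfl⟩ := indepMod_square_isUnit hx
    exact ⟨star g, by simp [Matrix.star_eq_conjTranspose]⟩

theorem tendsto_densityRatio_self {n : ℕ} {α : Fin n → ℕ} (hα : α ∈ lambdaPlus n) :
    Tendsto (densityRatio (piMat u π α) (piMat u π α)) atTop
      (𝓝 ((vol u π n n).real {x | IndepMod n x} / (hermVol u π n).real (hermOrbit u π α))) := by
  have h1 := tendsto_densityRatio (m := n) (conjTranspose_piMat (u := u) (π := π) hα) hα
  simpa only [cong_gram_iff_indepMod hα] using h1

/-- `w_m(q⁻²) / w_{m - n}(q⁻²)` is the volume of the primitive matrices. -/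
theorem measureReal_indepMod_mul_wPoly {m n : ℕ} (hmn : n ≤ m) :
    (((vol u π m n).real {x | IndepMod n x} : ℝ) : ℂ) *
        wPoly (m - n) ((resCard k : ℂ) ^ (-2 : ℤ)) =
      wPoly m ((resCard k : ℂ) ^ (-2 : ℤ)) := by
  rw [measureReal_indepMod]
  have hq : (resCard k : ℂ) ≠ 0 := by
    have := one_lt_resCard u π
    exact_mod_cast (by omega : resCard k ≠ 0)
  induction n with
  | zero => simp
  | succ n ih =>
    rw [← ih (by omega), Fin.prod_univ_castSucc]
    obtain ⟨p, rfl⟩ : ∃ p, m = n + 1 + p := ⟨m - (n + 1), by omega⟩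
    have h1 : n + 1 + p - n = p + 1 := by omega
    have h2 : n + 1 + p - (n + 1) = p := by omega
    have h3 : wPoly (p + 1) ((resCard k : ℂ) ^ (-2 : ℤ)) =
        wPoly p ((resCard k : ℂ) ^ (-2 : ℤ)) * (1 - ((resCard k : ℂ) ^ (-2 : ℤ)) ^ (p + 1)) := by
      rw [wPoly, wPoly, Finset.prod_Icc_succ_top (by omega)]
    have h4 : (resCard k : ℂ) ^ (2 * ((Fin.last n : Fin (n + 1)) : ℤ) - 2 * ((n + 1 + p : ℕ) : ℤ)) =
        ((resCard k : ℂ) ^ (-2 : ℤ)) ^ (p + 1) := by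
      rw [← zpow_natCast, ← zpow_mul]
      congr 1
      simp
      ring
    rw [h1, h2, h3, h4]
    simp only [Fin.val_castSucc]
    ring

theorem wPoly_ne_zero (u π : 𝒪[k]) [StandardPair u π] (m : ℕ) : wPoly m ((resCard k : ℂ) ^ (-2 : ℤ)) ≠ 0 := by
  rw [wPoly]
  refine Finset.prod_ne_zero_iff.2 fun i hi => ?_
  have hq := one_lt_resCard u π
  have hi := (Finset.mem_Icc.1 hi).1
  rw [sub_ne_zero]
  intro h0
  rw [zpow_neg, inv_pow] at h0
  have h1 : ((resCard k : ℂ) ^ (2 : ℤ)) ^ i = 1 := inv_eq_one.1 h0.symm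
  have h2 : resCard k ^ (2 * i) = 1 := by
    rw [pow_mul]
    exact_mod_cast h1
  have := Nat.one_lt_pow (show 2 * i ≠ 0 by omega) hq
  omega

end Densities

end

section

variable {k : Type*} [NontriviallyNormedField k] [IsUltrametricDist k] {u π : 𝒪[k]}
variable [ProperSpace k] [h : StandardPair u π]

/-! ### Spherical functions as integrals over matrices -/

section Spherical

theorem stronglyMeasurable_absPow {n : ℕ} (s : Fin n → ℂ) :
    StronglyMeasurable fun Y : Matrix (Fin n) (Fin n) (QOrd u π) =>
      absPow s (Y.map (toD u π)) := by
  classical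
  simp only [absPow_map_toD]
  refine Measurable.stronglyMeasurable (Measurable.ite ?_ ?_ measurable_const)
  · refine MeasurableSet.inter ?_ ?_
    · exact (isClosed_hermGroup n).measurableSet
    · have : {Y : Matrix (Fin n) (Fin n) (QOrd u π) | ∀ i, minorNorm Y i ≠ 0} =
          ⋂ i, {Y | minorNorm Y i = 0}ᶜ := by
        ext Y; simp
      change MeasurableSet {Y : Matrix (Fin n) (Fin n) (QOrd u π) | ∀ i, minorNorm Y i ≠ 0}
      rw [this]
      exact MeasurableSet.iInter fun i =>
        (isClosed_singleton.preimage (continuous_minorNorm i)).measurableSet.compl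
  · refine Finset.measurable_fun_prod _ fun i _ => Measurable.pow_const ?_ _
    exact Complex.measurable_ofReal.comp
      (Real.continuous_sqrt.comp (continuous_minorNorm i).norm).measurable

theorem act_map_toD {n : ℕ} (g : maxCompact u π n) (Y : Matrix (Fin n) (Fin n) (QOrd u π)) :
    act g (Y.map (toD u π)) = (g.val * Y * (g.val)ᴴ).map (toD u π) := by
  rw [act, Matrix.map_mul, Matrix.map_mul, map_toD_conjTranspose]

theorem sphericalConverges_map_toD {n : ℕ} {s : Fin n → ℂ} (hs : ∀ i, 0 ≤ (s i).re)
    (Y : Matrix (Fin n) (Fin n) (QOrd u π)) : SphericalConverges (Y.map (toD u π)) s := by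
  rw [SphericalConverges]
  simp only [act_map_toD]
  refine Integrable.of_bound (C := 1) ?_ (Eventually.of_forall fun g => norm_absPow_le_one hs _)
  exact ((stronglyMeasurable_absPow s).comp_measurable
    (continuous_conj_left Y).measurable).aestronglyMeasurable

theorem stronglyMeasurable_absPow_gram {m n : ℕ} (A : Matrix (Fin m) (Fin m) (QOrd u π))
    (s : Fin n → ℂ) : StronglyMeasurable fun x : Matrix (Fin m) (Fin n) (QOrd u π) =>
      absPow s ((xᴴ * A * x).map (toD u π)) :=
  (stronglyMeasurable_absPow s).comp_measurable (continuous_gram A).measurable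

theorem integrable_absPow_gram {m n : ℕ} (A : Matrix (Fin m) (Fin m) (QOrd u π))
    {s : Fin n → ℂ} (hs : ∀ i, 0 ≤ (s i).re) :
    Integrable (fun x => absPow s ((xᴴ * A * x).map (toD u π))) (vol u π m n) :=
  Integrable.of_bound (C := 1) (stronglyMeasurable_absPow_gram A s).aestronglyMeasurable
    (Eventually.of_forall fun _ => norm_absPow_le_one hs _)

theorem nondeg_of_isUnit_map {n : ℕ} {Y : Matrix (Fin n) (Fin n) (QOrd u π)}
    (hY : IsUnit (Y.map (toD u π))) : Nondeg Y := by
  intro v hv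
  obtain ⟨g, hg⟩ := hY
  have h1 : (Y.map (toD u π)).mulVec (fun i => toD u π (v i)) = 0 := by
    funext i
    have := congrArg (toD u π) (congrFun hv i)
    simpa [Matrix.mulVec, dotProduct, map_sum] using this
  have h2 : (g⁻¹).val.mulVec ((Y.map (toD u π)).mulVec fun i => toD u π (v i)) = 0 := by
    rw [h1, Matrix.mulVec_zero]
  rw [← hg, Matrix.mulVec_mulVec, g.inv_mul, Matrix.one_mulVec] at h2
  funext i
  have h3 := congrFun h2 i
  exact toD_injective (h3.trans (map_zero _).symm)

variable [CharZero k]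

theorem exists_cong_of_absPow_ne_zero {n : ℕ} {s : Fin n → ℂ}
    {Y : Matrix (Fin n) (Fin n) (QOrd u π)} (hY : absPow s (Y.map (toD u π)) ≠ 0) :
    ∃ α ∈ lambdaPlus n, Cong (piMat u π α) Y := by
  classical
  rw [absPow_map_toD, ne_eq, ite_eq_right_iff, not_forall] at hY
  obtain ⟨⟨h1, h2⟩, -⟩ := hY
  obtain ⟨α, hα, -, hc⟩ := exists_cong_piMat n 0 Y h1
    (nondeg_of_isUnit_map (isUnit_of_minorNorm_ne_zero h2))
    (fun i j => by rw [idealPow_zero]; trivial)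
  exact ⟨α, hα, hc⟩

/-- The decomposition of an integral over an invariant set according to the orbits of the Gram
matrices. -/
theorem hasSum_setIntegral_gram {m n : ℕ} (A : Matrix (Fin m) (Fin m) (QOrd u π))
    {s : Fin n → ℂ} (hs : ∀ i, 0 ≤ (s i).re) {W : Set (Matrix (Fin m) (Fin n) (QOrd u π))}
    (hW : MeasurableSet W) (hTW : ∀ g x, rightAct m g x ∈ W ↔ x ∈ W) :
    HasSum (fun α : lambdaPlus n =>
        (((vol u π m n).real (W ∩ {x | Cong (piMat u π α.1) (xᴴ * A * x)}) : ℝ) : ℂ) *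
          sphericalFn (piMatD u π α.1) s)
      (∫ x in W, absPow s ((xᴴ * A * x).map (toD u π)) ∂vol u π m n) := by
  have hmeas (α : lambdaPlus n) :
      MeasurableSet (W ∩ {x | Cong (piMat u π α.1) (xᴴ * A * x)}) :=
    hW.inter ((continuous_gram A).measurable (measurableSet_cong _))
  have hdisj : Pairwise (Function.onFun Disjoint fun α : lambdaPlus n =>
      W ∩ {x | Cong (piMat u π α.1) (xᴴ * A * x)}) := by
    intro α β hαβ
    rw [Function.onFun, Set.disjoint_left]
    intro x hx hx'
    exact hαβ (Subtype.ext (piMat_cong_unique α.2 β.2 (hx'.2.trans hx.2.symm)))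
  have h1 := hasSum_integral_iUnion hmeas hdisj
    (integrable_absPow_gram A hs).integrableOn
  have h2 : ∫ x in ⋃ α : lambdaPlus n, W ∩ {x | Cong (piMat u π α.1) (xᴴ * A * x)},
      absPow s ((xᴴ * A * x).map (toD u π)) ∂vol u π m n =
      ∫ x in W, absPow s ((xᴴ * A * x).map (toD u π)) ∂vol u π m n := by
    symm
    refine setIntegral_eq_of_subset_of_forall_sdiff_eq_zero hW
      (Set.iUnion_subset fun α => Set.inter_subset_left) fun x hx => ?_
    by_contra hne
    obtain ⟨α, hα, hc⟩ := exists_cong_of_absPow_ne_zero hne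
    exact hx.2 (Set.mem_iUnion.2 ⟨⟨α, hα⟩, hx.1, hc⟩)
  rw [h2] at h1
  refine (congrArg (HasSum · _) (funext fun α => ?_)).mpr h1
  rw [setIntegral_gram A (piMat u π α.1) hW hTW (stronglyMeasurable_absPow s) (C := 1)
    (fun y => norm_absPow_le_one hs y), sphericalFn, Complex.real_smul]
  simp only [piMatD, act_map_toD]

/-- Integrals over the primitive matrices are integrals over `Kₘ`. -/
theorem setIntegral_indepMod_eq {m n : ℕ} (hmn : n ≤ m) {E : Type*} [NormedAddCommGroup E]
    [NormedSpace ℝ E] [CompleteSpace E] {F : Matrix (Fin m) (Fin n) (QOrd u π) → E}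
    (hF : StronglyMeasurable F) {C : ℝ} (hb : ∀ y, ‖F y‖ ≤ C) :
    ∫ x in {x | IndepMod n x}, F x ∂vol u π m n =
      (vol u π m n).real {x | IndepMod n x} •
        ∫ g, F ((g.val)ᴴ * firstCols u π m n) ∂haarK u π m := by
  have hcont : Continuous fun p : maxCompact u π m × Matrix (Fin m) (Fin n) (QOrd u π) =>
      (p.1.val)ᴴ * p.2 :=
    (Units.continuous_val.comp continuous_fst).matrix_conjTranspose.matrix_mul continuous_snd
  have hstar (g : maxCompact u π m) : (g.val)ᴴ * ((g⁻¹).val)ᴴ = 1 := by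
    rw [← Matrix.conjTranspose_mul, g.inv_mul, Matrix.conjTranspose_one]
  have hind (g : maxCompact u π m) (x : Matrix (Fin m) (Fin n) (QOrd u π)) (hx : IndepMod n x) :
      IndepMod n ((g.val)ᴴ * x) := by
    intro c hc hm
    refine hx c hc fun t => ?_
    have h1 := mulVec_mem_idealPow ((g⁻¹).val)ᴴ hm t
    rwa [Matrix.mulVec_mulVec, ← Matrix.mul_assoc, mul_conjTranspose_cancel, Matrix.one_mul] at h1
  refine setIntegral_eq_of_average (haarK u π m) (vol u π m n)
    (T := fun g x => (g.val)ᴴ * x) hcont.measurable (fun g => ?_) (measurableSet_indepMod m n n)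
    (fun g x => ⟨fun hx => ?_, hind g x⟩) hF hb fun x hx => ?_
  · let f : Matrix (Fin m) (Fin n) (QOrd u π) →+ Matrix (Fin m) (Fin n) (QOrd u π) :=
      { toFun := fun x => (g.val)ᴴ * x
        map_zero' := Matrix.mul_zero _
        map_add' := fun x y => Matrix.mul_add _ _ _ }
    have hf : Continuous f := continuous_const.matrix_mul continuous_id
    refine measurePreserving_of_surjective (vol u π m n) f hf fun x => ⟨((g⁻¹).val)ᴴ * x, ?_⟩
    change (g.val)ᴴ * (((g⁻¹).val)ᴴ * x) = x
    rw [← Matrix.mul_assoc, hstar, Matrix.one_mul]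
  · have h1 := hind g⁻¹ _ hx
    rwa [← Matrix.mul_assoc, mul_conjTranspose_cancel, Matrix.one_mul] at h1
  · obtain ⟨g₀, hg₀⟩ := (isPrimitive_iff_indepMod hmn x).2 hx
    have h1 (g : maxCompact u π m) : F ((g.val)ᴴ * x) =
        (fun g : maxCompact u π m => F ((g.val)ᴴ * firstCols u π m n)) (star g₀ * g) := by
      have h2 : x = g₀.val * firstCols u π m n := hg₀
      simp only [h2, Units.val_mul, Units.coe_star, Matrix.star_eq_conjTranspose,
        Matrix.conjTranspose_mul, Matrix.conjTranspose_conjTranspose, Matrix.mul_assoc]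
    refine (integral_congr_ae (Eventually.of_forall h1)).trans ?_
    exact integral_mul_left_eq_self
      (fun g : maxCompact u π m => F ((g.val)ᴴ * firstCols u π m n)) (star g₀)

theorem measureReal_indepMod_ne_zero {m n : ℕ} (hmn : n ≤ m) :
    (vol u π m n).real {x | IndepMod n x} ≠ 0 := by
  intro h0
  have h1 := measureReal_indepMod_mul_wPoly (u := u) (π := π) hmn
  rw [h0, Complex.ofReal_zero, zero_mul] at h1
  exact wPoly_ne_zero u π m h1.symm

/-- For almost all `g` no leading minor of `g π^ξ gᴴ` vanishes. -/
theorem ae_minorNorm_conj_ne_zero {m : ℕ} {ξ : Fin m → ℕ} (hξ : ξ ∈ lambdaPlus m) :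
    ∀ᵐ g ∂haarK u π m, ∀ i, minorNorm (g.val * piMat u π ξ * (g.val)ᴴ) i ≠ 0 := by
  set N : Set (Matrix (Fin m) (Fin m) (QOrd u π)) :=
    {y | ∃ i, minorNorm (yᴴ * piMat u π ξ * y) i = 0} with hN
  have hNm : MeasurableSet N := by
    have : N = ⋃ i, {y | minorNorm (yᴴ * piMat u π ξ * y) i = 0} := by ext y; simp [hN]
    rw [this]
    exact MeasurableSet.iUnion fun i => (isClosed_singleton.preimage
      ((continuous_minorNorm i).comp (continuous_gram _))).measurableSet
  have hN0 : vol u π m m N = 0 := by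
    rw [measure_eq_zero_iff_ae_notMem]
    filter_upwards [ae_minorNorm_ne_zero (u := u) (π := π) le_rfl hξ] with y hy hyN
    obtain ⟨i, hi⟩ := hyN
    exact hy i hi
  have h1 := setIntegral_indepMod_eq (u := u) (π := π) (m := m) (n := m) le_rfl
    (F := N.indicator fun _ => (1 : ℝ)) (stronglyMeasurable_const.indicator hNm) (C := 1)
    (fun y => by
      by_cases hy : y ∈ N
      · simp [hy]
      · simp [hy])
  have hone : firstCols u π m m = 1 := by
    ext1 i j
    simp [firstCols, Matrix.one_apply, Fin.ext_iff]
  rw [setIntegral_indicator hNm, setIntegral_const, smul_eq_mul, mul_one, smul_eq_mul,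
    measureReal_def, measure_mono_null Set.inter_subset_right hN0, ENNReal.toReal_zero] at h1
  have hcont : Continuous fun g : maxCompact u π m => (g.val)ᴴ :=
    Units.continuous_val.matrix_conjTranspose
  have h2 : (haarK u π m).real ((fun g : maxCompact u π m => (g.val)ᴴ) ⁻¹' N) = 0 := by
    have h3 := (mul_eq_zero.1 h1.symm).resolve_left (measureReal_indepMod_ne_zero le_rfl)
    simp only [hone, Matrix.mul_one] at h3
    have h4 : (fun g : maxCompact u π m => N.indicator (fun _ => (1 : ℝ)) (g.val)ᴴ) =
        ((fun g : maxCompact u π m => (g.val)ᴴ) ⁻¹' N).indicator fun _ => (1 : ℝ) := rfl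
    rw [h4, integral_indicator (hcont.measurable hNm), setIntegral_const, smul_eq_mul,
      mul_one] at h3
    exact h3
  rw [measureReal_eq_zero_iff] at h2
  rw [measure_eq_zero_iff_ae_notMem] at h2
  filter_upwards [h2] with g hg i hi
  refine hg ⟨i, ?_⟩
  rwa [Matrix.conjTranspose_conjTranspose]

theorem gram_firstCols {m n : ℕ} (hmn : n ≤ m) (A : Matrix (Fin m) (Fin m) (QOrd u π))
    (z : Matrix (Fin m) (Fin m) (QOrd u π)) :
    (z * firstCols u π m n)ᴴ * A * (z * firstCols u π m n) =
      (zᴴ * A * z).submatrix (Fin.castLE hmn) (Fin.castLE hmn) := by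
  have h1 : z * firstCols u π m n = z.submatrix id (Fin.castLE hmn) := by
    ext1 t i
    exact mul_firstCols hmn z t i
  rw [h1]
  rfl

theorem minorNorm_submatrix {m n : ℕ} (hmn : n ≤ m) (Y : Matrix (Fin m) (Fin m) (QOrd u π))
    (i : Fin n) : minorNorm (Y.submatrix (Fin.castLE hmn) (Fin.castLE hmn)) i =
      minorNorm Y (Fin.castLE hmn i) := rfl

/-- If the last exponents vanish, `|d(Y)|ˢ` depends only on the upper left block of size `n`. -/
theorem absPow_extendZero {m n : ℕ} (hmn : n ≤ m) (s : Fin n → ℂ)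
    {Y : Matrix (Fin m) (Fin m) (QOrd u π)} (hY : Yᴴ = Y) (hne : ∀ i, minorNorm Y i ≠ 0) :
    absPow (extendZero m s) (Y.map (toD u π)) =
      absPow s ((Y.submatrix (Fin.castLE hmn) (Fin.castLE hmn)).map (toD u π)) := by
  classical
  rw [absPow_map_toD, absPow_map_toD, if_pos ⟨hY, hne⟩, if_pos]
  · symm
    refine Fintype.prod_of_injective (Fin.castLE hmn) (Fin.castLE_injective _) _ _ (fun i hi => ?_)
      fun i => ?_
    · have : ¬ (i : ℕ) < n := fun hlt => hi ⟨⟨i, hlt⟩, rfl⟩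
      rw [extendZero, dif_neg this, Complex.cpow_zero]
    · rw [minorNorm_submatrix, extendZero, dif_pos (by simp)]
      rfl
  · refine ⟨?_, fun i => ?_⟩
    · rw [Matrix.conjTranspose_submatrix, hY]
    · rw [minorNorm_submatrix]
      exact hne _

theorem extendZero_re_nonneg {n : ℕ} (m : ℕ) {s : Fin n → ℂ} (hs : ∀ i, 0 ≤ (s i).re)
    (i : Fin m) : 0 ≤ (extendZero m s i).re := by
  rw [extendZero]
  split_ifs with hi
  · exact hs _
  · simp

/-- The spherical function as a mean over the primitive matrices. -/
theorem setIntegral_primitive {m n : ℕ} (hmn : n ≤ m) {s : Fin n → ℂ} (hs : ∀ i, 0 ≤ (s i).re)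
    {ξ : Fin m → ℕ} (hξ : ξ ∈ lambdaPlus m) :
    ∫ x in {x | IndepMod n x}, absPow s ((xᴴ * piMat u π ξ * x).map (toD u π)) ∂vol u π m n =
      (((vol u π m n).real {x | IndepMod n x} : ℝ) : ℂ) *
        sphericalFn (piMatD u π ξ) (extendZero m s) := by
  rw [setIntegral_indepMod_eq hmn (stronglyMeasurable_absPow_gram _ s) (C := 1)
    (fun y => norm_absPow_le_one hs _), Complex.real_smul, sphericalFn]
  congr 1
  refine integral_congr_ae ?_
  filter_upwards [ae_minorNorm_conj_ne_zero (u := u) (π := π) hξ] with g hg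
  have hA : (piMat u π ξ)ᴴ = piMat u π ξ := conjTranspose_piMat hξ
  have hY : (g.val * piMat u π ξ * (g.val)ᴴ)ᴴ = g.val * piMat u π ξ * (g.val)ᴴ := by
    simp [Matrix.conjTranspose_mul, hA, Matrix.mul_assoc]
  rw [piMatD, act_map_toD, absPow_extendZero hmn s hY hg, gram_firstCols hmn,
    Matrix.conjTranspose_conjTranspose]

end Spherical

/-! ### Homogeneity under column operations -/

section Homogeneity

/-- The factor by which `|d(Y)|ˢ` changes when column and row `j` are multiplied by `Π`. -/
noncomputable def colFactor (k : Type*) [NontriviallyNormedField k] [IsUltrametricDist k] {n : ℕ}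
    (s : Fin n → ℂ) (j : Fin n) : ℂ :=
  ∏ i ∈ Finset.Ici j, (resCard k : ℂ) ^ (-s i)

theorem minorNorm_colMat {n : ℕ} (Y : Matrix (Fin n) (Fin n) (QOrd u π)) (j : Fin n)
    {a : Fin n → QOrd u π} (ha : ∀ i, j ≤ i → a i = 0) (i : Fin n) :
    minorNorm ((colMat j a)ᴴ * Y * colMat j a) i =
      (if j ≤ i then -(π : k) else 1) ^ 2 * minorNorm Y i := by
  refine minorNorm_conj_upper Y (colMat j a) (fun p l hlp => ?_) i _ ?_
  · by_cases hl : l = j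
    · subst hl
      simp [colMat, ha p hlp.le, hlp.ne']
    · simp [colMat, hl, hlp.ne']
  · have hdiag (l : Fin (i + 1)) :
        (splitting (block ((colMat j a).map (toD u π)) i l l)).det =
          if Fin.castLE i.isLt l = j then (⟨-(π : k), 0⟩ : QuadExt u) else 1 := by
      have h1 : block ((colMat j a).map (toD u π)) i l l =
          toD u π (colMat j a (Fin.castLE i.isLt l) (Fin.castLE i.isLt l)) := rfl
      rw [h1, det_splitting]
      by_cases hl : Fin.castLE i.isLt l = j
      · rw [if_pos hl, hl]
        simp [colMat, ha j le_rfl, toD, primeElt]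
      · rw [if_neg hl]
        simp only [colMat, Matrix.of_apply, if_neg hl, if_true, map_one]
        ext <;> simp [QuadraticAlgebra.re_one, QuadraticAlgebra.im_one]
    simp only [hdiag]
    by_cases hji : j ≤ i
    · rw [if_pos hji]
      have hj : (j : ℕ) < i + 1 := Nat.lt_succ_of_le hji
      rw [Finset.prod_eq_single (⟨j, hj⟩ : Fin (i + 1))]
      · exact if_pos rfl
      · intro l _ hl
        have hne : ¬ Fin.castLE i.isLt l = j := fun hh => hl (Fin.ext (congrArg Fin.val hh :))
        exact if_neg hne
      · simp
    · rw [if_neg hji]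
      refine (Finset.prod_eq_one fun l _ => if_neg fun hh => hji ?_).trans rfl
      rw [← hh, Fin.le_def]
      exact Nat.lt_succ_iff.1 l.isLt

theorem absPow_colMat {n : ℕ} (s : Fin n → ℂ) {Y : Matrix (Fin n) (Fin n) (QOrd u π)} (hY : Yᴴ = Y)
    (j : Fin n) {a : Fin n → QOrd u π} (ha : ∀ i, j ≤ i → a i = 0) :
    absPow s (((colMat j a)ᴴ * Y * colMat j a).map (toD u π)) =
      colFactor k s j * absPow s (Y.map (toD u π)) := by
  classical
  have hπ : (π : k) ≠ 0 := fun h0 => pi_ne_zero u π (Subtype.ext h0)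
  have hc (i : Fin n) : (if j ≤ i then -(π : k) else 1) ≠ 0 := by
    split_ifs
    · exact neg_ne_zero.2 hπ
    · exact one_ne_zero
  have hY' : ((colMat j a)ᴴ * Y * colMat j a)ᴴ = (colMat j a)ᴴ * Y * colMat j a := by
    simp [Matrix.conjTranspose_mul, hY, Matrix.mul_assoc]
  rw [absPow_map_toD, absPow_map_toD]
  simp only [hY, hY', true_and, minorNorm_colMat Y j ha]
  have hiff : (∀ i, (if j ≤ i then -(π : k) else 1) ^ 2 * minorNorm Y i ≠ 0) ↔
      ∀ i, minorNorm Y i ≠ 0 :=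
    forall_congr' fun i => mul_ne_zero_iff.trans (and_iff_right (pow_ne_zero 2 (hc i)))
  simp only [hiff]
  split_ifs with hne
  · have hfac : colFactor k s j = ∏ i, if j ≤ i then (resCard k : ℂ) ^ (-s i) else 1 := by
      rw [colFactor, ← Finset.prod_filter]
      congr 1
      ext i; simp
    rw [hfac, ← Finset.prod_mul_distrib]
    refine Finset.prod_congr rfl fun i _ => ?_
    rw [norm_mul, norm_pow, Real.sqrt_mul (by positivity), Real.sqrt_sq (norm_nonneg _),
      Complex.ofReal_mul, Complex.mul_cpow_ofReal_nonneg (norm_nonneg _) (Real.sqrt_nonneg _)]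
    congr 1
    split_ifs
    · rw [norm_neg, h.norm_eq, Complex.ofReal_inv, Complex.ofReal_natCast, Complex.inv_cpow,
        Complex.cpow_neg]
      rw [Complex.natCast_arg]
      exact Real.pi_pos.ne
    · simp
  · simp

theorem colFactor_eq {m n : ℕ} (u π : 𝒪[k]) [StandardPair u π] (s : Fin n → ℂ) (j : Fin n) :
    (resCard k : ℂ) ^ (2 * (j : ℤ) - 2 * (m : ℤ)) * colFactor k s j =
      (resCard k : ℂ) ^ (-((∑ i ∈ Finset.Ici j, s i) + 2 * (m : ℂ) - 2 * ((j : ℕ) + 1 : ℂ) + 2)) := by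
  have hq : (resCard k : ℂ) ≠ 0 := by
    have := one_lt_resCard u π
    exact_mod_cast (by omega : resCard k ≠ 0)
  have h1 : colFactor k s j = (resCard k : ℂ) ^ (-∑ i ∈ Finset.Ici j, s i) := by
    rw [colFactor, Complex.cpow_def_of_ne_zero hq, ← Finset.sum_neg_distrib, Finset.mul_sum,
      Complex.exp_sum]
    exact Finset.prod_congr rfl fun i _ => Complex.cpow_def_of_ne_zero hq _
  rw [h1, ← Complex.cpow_intCast, ← Complex.cpow_add _ _ hq]
  congr 1
  push_cast
  ring

/-- The integral over the primitive matrices in terms of the integral over all matrices. -/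
theorem setIntegral_primitive_eq [CharZero k] {m n : ℕ} {s : Fin n → ℂ} (hs : ∀ i, 0 ≤ (s i).re)
    {A : Matrix (Fin m) (Fin m) (QOrd u π)} (hA : Aᴴ = A) :
    ∫ x in {x | IndepMod n x}, absPow s ((xᴴ * A * x).map (toD u π)) ∂vol u π m n =
      (∏ i : Fin n, (1 - (resCard k : ℂ) ^
        (-((∑ j ∈ Finset.Ici i, s j) + 2 * (m : ℂ) - 2 * ((i : ℕ) + 1 : ℂ) + 2)))) *
        ∫ x, absPow s ((xᴴ * A * x).map (toD u π)) ∂vol u π m n := by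
  rw [setIntegral_indepMod (integrable_absPow_gram A hs) (c := colFactor k s) fun j a ha x => ?_]
  · simp only [colFactor_eq u π]
  · have h1 : (x * colMat j a)ᴴ * A * (x * colMat j a) =
        (colMat j a)ᴴ * (xᴴ * A * x) * colMat j a := by
      simp [Matrix.conjTranspose_mul, Matrix.mul_assoc]
    rw [h1, absPow_colMat s (conjTranspose_gram hA x) j ha]

end Homogeneity

end

section

variable {k : Type*} [NontriviallyNormedField k] [IsUltrametricDist k] {u π : 𝒪[k]}
variable [ProperSpace k] [CharZero k] [h : StandardPair u π]

/-! ### The identities -/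

section Identities

theorem density_eq {m n : ℕ} {A : Matrix (Fin m) (Fin m) (QOrd u π)} (hA : Aᴴ = A)
    {α : Fin n → ℕ} (hα : α ∈ lambdaPlus n) :
    density (piMat u π α) A = (vol u π m n).real {x | Cong (piMat u π α) (xᴴ * A * x)} /
      (hermVol u π n).real (hermOrbit u π α) :=
  (tendsto_densityRatio hA hα).limUnder_eq

theorem densityPr_eq {m n : ℕ} (hmn : n ≤ m) {A : Matrix (Fin m) (Fin m) (QOrd u π)} (hA : Aᴴ = A)
    {α : Fin n → ℕ} (hα : α ∈ lambdaPlus n) :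
    densityPr (piMat u π α) A =
      (vol u π m n).real ({x | IndepMod n x} ∩ {x | Cong (piMat u π α) (xᴴ * A * x)}) /
        (hermVol u π n).real (hermOrbit u π α) :=
  (tendsto_densityRatioPr hmn hA hα).limUnder_eq

theorem density_self_eq {n : ℕ} {α : Fin n → ℕ} (hα : α ∈ lambdaPlus n) :
    density (piMat u π α) (piMat u π α) =
      (vol u π n n).real {x | IndepMod n x} / (hermVol u π n).real (hermOrbit u π α) :=
  (tendsto_densityRatio_self hα).limUnder_eq

theorem density_self_ne_zero {n : ℕ} {α : Fin n → ℕ} (hα : α ∈ lambdaPlus n) :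
    density (piMat u π α) (piMat u π α) ≠ 0 := by
  rw [density_self_eq hα]
  exact div_ne_zero (measureReal_indepMod_ne_zero le_rfl) (measureReal_hermOrbit_ne_zero hα)

/-- The integral over the primitive matrices, decomposed along the orbits of `xᴴ A x`; the volumes
of the orbits cancel in the quotients of densities. -/
theorem hasSum_densityPr {m n : ℕ} (hmn : n ≤ m) {s : Fin n → ℂ} (hs : ∀ i, 0 ≤ (s i).re)
    {A : Matrix (Fin m) (Fin m) (QOrd u π)} (hA : Aᴴ = A) :
    HasSum (fun α : lambdaPlus n =>
        ((densityPr (piMat u π α.1) A : ℝ) : ℂ) /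
          ((density (piMat u π α.1) (piMat u π α.1) : ℝ) : ℂ) * sphericalFn (piMatD u π α.1) s)
      ((((vol u π n n).real {x | IndepMod n x} : ℝ) : ℂ)⁻¹ *
        ∫ x in {x | IndepMod n x}, absPow s ((xᴴ * A * x).map (toD u π)) ∂vol u π m n) := by
  have h1 := (hasSum_setIntegral_gram A hs (measurableSet_indepMod m n n)
    indepMod_rightAct_iff).mul_left ((((vol u π n n).real {x | IndepMod n x} : ℝ) : ℂ)⁻¹)
  refine (congrArg (HasSum · _) (funext fun α => ?_)).mpr h1
  rw [densityPr_eq hmn hA α.2, density_self_eq α.2, ← Complex.ofReal_div,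
    div_div_div_cancel_right₀ (measureReal_hermOrbit_ne_zero α.2), Complex.ofReal_div]
  ring

/-- The integral over all matrices, decomposed along the orbits of `xᴴ A x`. -/
theorem hasSum_density {m n : ℕ} {s : Fin n → ℂ} (hs : ∀ i, 0 ≤ (s i).re)
    {A : Matrix (Fin m) (Fin m) (QOrd u π)} (hA : Aᴴ = A) :
    HasSum (fun α : lambdaPlus n =>
        ((density (piMat u π α.1) A : ℝ) : ℂ) /
          ((density (piMat u π α.1) (piMat u π α.1) : ℝ) : ℂ) * sphericalFn (piMatD u π α.1) s)
      ((((vol u π n n).real {x | IndepMod n x} : ℝ) : ℂ)⁻¹ *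
        ∫ x, absPow s ((xᴴ * A * x).map (toD u π)) ∂vol u π m n) := by
  have h1 := (hasSum_setIntegral_gram A hs MeasurableSet.univ
    (fun _ _ => Iff.rfl)).mul_left ((((vol u π n n).real {x | IndepMod n x} : ℝ) : ℂ)⁻¹)
  rw [setIntegral_univ] at h1
  simp only [Set.univ_inter] at h1
  refine (congrArg (HasSum · _) (funext fun α => ?_)).mpr h1
  rw [density_eq hA α.2, density_self_eq α.2, ← Complex.ofReal_div,
    div_div_div_cancel_right₀ (measureReal_hermOrbit_ne_zero α.2), Complex.ofReal_div]
  ring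

/-- `ω(π^ξ; s, 0)` is the mean of `|d(xᴴ π^ξ x)|ˢ` over the primitive matrices; the volumes of the
primitive `m × n` and `n × n` matrices produce the factors `w_r(q⁻²)`. -/
theorem sphericalFn_extendZero {m n : ℕ} (hmn : n ≤ m) {s : Fin n → ℂ} (hs : ∀ i, 0 ≤ (s i).re)
    {ξ : Fin m → ℕ} (hξ : ξ ∈ lambdaPlus m) :
    sphericalFn (piMatD u π ξ) (extendZero m s) =
      wPoly n ((resCard k : ℂ) ^ (-2 : ℤ)) * wPoly (m - n) ((resCard k : ℂ) ^ (-2 : ℤ)) /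
        wPoly m ((resCard k : ℂ) ^ (-2 : ℤ)) *
      ((((vol u π n n).real {x | IndepMod n x} : ℝ) : ℂ)⁻¹ *
        ∫ x in {x | IndepMod n x},
          absPow s ((xᴴ * piMat u π ξ * x).map (toD u π)) ∂vol u π m n) := by
  have h1 := measureReal_indepMod_mul_wPoly (u := u) (π := π) hmn
  have h2 := measureReal_indepMod_mul_wPoly (u := u) (π := π) (le_refl n)
  rw [Nat.sub_self, wPoly, Finset.Icc_eq_empty (by norm_num), Finset.prod_empty, mul_one] at h2
  have h3 := wPoly_ne_zero u π n
  have h4 := wPoly_ne_zero u π m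
  rw [setIntegral_primitive hmn hs hξ, h2, ← h1]
  rw [← h1] at h4
  have h5 := left_ne_zero_of_mul h4
  have h6 := right_ne_zero_of_mul h4
  generalize wPoly n ((resCard k : ℂ) ^ (-2 : ℤ)) = a at *
  generalize wPoly (m - n) ((resCard k : ℂ) ^ (-2 : ℤ)) = b at *
  field_simp

end Identities

end

end QuatHerm

theorem theorem2p1 {k : Type*} [NontriviallyNormedField k] [IsUltrametricDist k] [ProperSpace k]
    [CharZero k] (hodd : Odd (QuatHerm.resCard k))
    (π : 𝒪[k]) (hπ : Irreducible π) (hnorm : ‖(π : k)‖ = (QuatHerm.resCard k : ℝ)⁻¹)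
    (u : 𝒪[k]) (hu : IsUnit u) (hns : ¬ IsSquare (u : k))
    {m n : ℕ} (hmn : n < m) (s : Fin n → ℂ) (hs : ∀ i, 0 ≤ (s i).re)
    (ξ : Fin m → ℕ) (hξ : ξ ∈ QuatHerm.lambdaPlus m) :
    -- the integrals that define the spherical functions converge absolutely
    QuatHerm.SphericalConverges (QuatHerm.piMatD u π ξ) (QuatHerm.extendZero m s) ∧
    (∀ α ∈ QuatHerm.lambdaPlus n, QuatHerm.SphericalConverges (QuatHerm.piMatD u π α) s) ∧
    -- the limits that define the local densities exist, and the denominators do not vanish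
    (∀ α ∈ QuatHerm.lambdaPlus n,
      Tendsto (QuatHerm.densityRatioPr (QuatHerm.piMat u π α) (QuatHerm.piMat u π ξ)) atTop
        (𝓝 (QuatHerm.densityPr (QuatHerm.piMat u π α) (QuatHerm.piMat u π ξ))) ∧
      Tendsto (QuatHerm.densityRatio (QuatHerm.piMat u π α) (QuatHerm.piMat u π ξ)) atTop
        (𝓝 (QuatHerm.density (QuatHerm.piMat u π α) (QuatHerm.piMat u π ξ))) ∧
      Tendsto (QuatHerm.densityRatio (QuatHerm.piMat u π α) (QuatHerm.piMat u π α)) atTop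
        (𝓝 (QuatHerm.density (QuatHerm.piMat u π α) (QuatHerm.piMat u π α))) ∧
      QuatHerm.density (QuatHerm.piMat u π α) (QuatHerm.piMat u π α) ≠ 0) ∧
    -- the identity with primitive local densities
    (Summable fun α : QuatHerm.lambdaPlus n =>
      ((QuatHerm.densityPr (QuatHerm.piMat u π α.1) (QuatHerm.piMat u π ξ) : ℝ) : ℂ) /
        ((QuatHerm.density (QuatHerm.piMat u π α.1) (QuatHerm.piMat u π α.1) : ℝ) : ℂ) *
        QuatHerm.sphericalFn (QuatHerm.piMatD u π α.1) s) ∧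
    QuatHerm.sphericalFn (QuatHerm.piMatD u π ξ) (QuatHerm.extendZero m s) =
      QuatHerm.wPoly n ((QuatHerm.resCard k : ℂ) ^ (-2 : ℤ)) *
        QuatHerm.wPoly (m - n) ((QuatHerm.resCard k : ℂ) ^ (-2 : ℤ)) /
        QuatHerm.wPoly m ((QuatHerm.resCard k : ℂ) ^ (-2 : ℤ)) *
      ∑' α : QuatHerm.lambdaPlus n,
        ((QuatHerm.densityPr (QuatHerm.piMat u π α.1) (QuatHerm.piMat u π ξ) : ℝ) : ℂ) /
          ((QuatHerm.density (QuatHerm.piMat u π α.1) (QuatHerm.piMat u π α.1) : ℝ) : ℂ) *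
          QuatHerm.sphericalFn (QuatHerm.piMatD u π α.1) s ∧
    -- the identity with local densities
    (Summable fun α : QuatHerm.lambdaPlus n =>
      ((QuatHerm.density (QuatHerm.piMat u π α.1) (QuatHerm.piMat u π ξ) : ℝ) : ℂ) /
        ((QuatHerm.density (QuatHerm.piMat u π α.1) (QuatHerm.piMat u π α.1) : ℝ) : ℂ) *
        QuatHerm.sphericalFn (QuatHerm.piMatD u π α.1) s) ∧
    QuatHerm.sphericalFn (QuatHerm.piMatD u π ξ) (QuatHerm.extendZero m s) =
      QuatHerm.wPoly n ((QuatHerm.resCard k : ℂ) ^ (-2 : ℤ)) *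
        QuatHerm.wPoly (m - n) ((QuatHerm.resCard k : ℂ) ^ (-2 : ℤ)) /
        QuatHerm.wPoly m ((QuatHerm.resCard k : ℂ) ^ (-2 : ℤ)) *
      (∏ i : Fin n, (1 - (QuatHerm.resCard k : ℂ) ^
        (-((∑ j ∈ Finset.Ici i, s j) + 2 * (m : ℂ) - 2 * ((i : ℕ) + 1 : ℂ) + 2)))) *
      ∑' α : QuatHerm.lambdaPlus n,
        ((QuatHerm.density (QuatHerm.piMat u π α.1) (QuatHerm.piMat u π ξ) : ℝ) : ℂ) /
          ((QuatHerm.density (QuatHerm.piMat u π α.1) (QuatHerm.piMat u π α.1) : ℝ) : ℂ) *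
          QuatHerm.sphericalFn (QuatHerm.piMatD u π α.1) s := by
  have : QuatHerm.StandardPair u π := ⟨hodd, hπ, hnorm, hu, hns⟩
  have hA : (QuatHerm.piMat u π ξ)ᴴ = QuatHerm.piMat u π ξ := QuatHerm.conjTranspose_piMat hξ
  have h1 := QuatHerm.hasSum_densityPr hmn.le hs hA
  have h2 := QuatHerm.hasSum_density hs hA
  refine ⟨QuatHerm.sphericalConverges_map_toD (QuatHerm.extendZero_re_nonneg m hs) _,
    fun α _ => QuatHerm.sphericalConverges_map_toD hs _, fun α hα => ⟨?_, ?_, ?_, ?_⟩,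
    h1.summable, ?_, h2.summable, ?_⟩
  · rw [QuatHerm.densityPr_eq hmn.le hA hα]
    exact QuatHerm.tendsto_densityRatioPr hmn.le hA hα
  · rw [QuatHerm.density_eq hA hα]
    exact QuatHerm.tendsto_densityRatio hA hα
  · rw [QuatHerm.density_self_eq hα]
    exact QuatHerm.tendsto_densityRatio_self hα
  · exact QuatHerm.density_self_ne_zero hα
  · rw [h1.tsum_eq]
    exact QuatHerm.sphericalFn_extendZero hmn.le hs hξ
  · rw [h2.tsum_eq, QuatHerm.sphericalFn_extendZero hmn.le hs hξ,
      QuatHerm.setIntegral_primitive_eq hs hA]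
    ring
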